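/- Let $k$ be a field and let $R$ be a differential graded (DG) algebra over $k$, with differential of degree $+1$, such that $R^{i}=0$ for $i<0$, $R^{0}=k$, $R^{1}=0$ and $\dim_k R<\infty$. Let $\mathsf D(R)$ be the derived category of DG left-$R$-modules, that is, the triangulated category obtained from the homotopy category of DG left-$R$-modules by formally inverting the quasi-isomorphisms. Let $\mathsf D^{\mathrm f}(R)$ be the full subcategory of $\mathsf D(R)$ of the DG modules $M$ with $\dim_k \mathrm H M<\infty$, where $\mathrm H M=\bigoplus_i \mathrm H^iM$ is the total cohomology, and let $\mathsf D^{\mathrm c}(R)$ be the full subcategory of the objects which are finitely built from ${}_RR$ in $\mathsf D(R)$ using distinguished triangles, (de)suspensions, finite coproducts and direct summands. Then, for each of the two categories $\mathsf T=\mathsf D^{\mathrm f}(R)$ and $\mathsf T=\mathsf D^{\mathrm c}(R)$: 1. $\operatorname{Hom}_{\mathsf T}(M,N)$ is a finite dimensional $k$-vector space for all objects $M,N$ of $\mathsf T$; 2. idempotents split in $\mathsf T$; 3. $\mathsf T$ is a Krull-Schmidt category: it has finite direct sums, each indecomposable object has a local endomorphism ring, and each object is a direct sum of finitely many indecomposable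 objects, which are unique up to isomorphism and order. -/

import Mathlib

open CategoryTheory CategoryTheory.Limits

universe w v u

/-! ### DG algebras and DG left modules -/

/-- A differential graded algebra over a commutative ring `k` (cohomological grading), given by
its total `k`-algebra, the internal `ℤ`-grading and the differential. -/
structure DGAlgebra (k : Type u) [CommRing k] where
  carrier : Type v
  [ring : Ring carrier]
  [algebra : Algebra k carrier]
  /-- the homogeneous component of each degree -/
  grading : ℤ → Submodule k carrier
  isInternal : DirectSum.IsInternal grading
  [gradedMonoid : SetLike.GradedMonoid grading]
  d : carrier →ₗ[k] carrier
  d_mem : ∀ {i : ℤ} {a : carrier}, a ∈ grading i → d a ∈ grading (i + 1)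
  d_d : ∀ a : carrier, d (d a) = 0
  leibniz : ∀ {i : ℤ} {a : carrier}, a ∈ grading i → ∀ b : carrier,
    d (a * b) = d a * b + i.negOnePow • (a * d b)

attribute [instance] DGAlgebra.ring DGAlgebra.algebra DGAlgebra.gradedMonoid

/-- A DG left module over the DG algebra `R`. -/
structure DGModule {k : Type u} [CommRing k] (R : DGAlgebra.{v} k) where
  carrier : Type w
  [addCommGroup : AddCommGroup carrier]
  [module : Module k carrier]
  [moduleR : Module R.carrier carrier]
  [isScalarTower : IsScalarTower k R.carrier carrier]
  /-- the homogeneous component of each degree -/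
  grading : ℤ → Submodule k carrier
  isInternal : DirectSum.IsInternal grading
  smul_mem : ∀ {i j : ℤ} {a : R.carrier} {m : carrier},
    a ∈ R.grading i → m ∈ grading j → a • m ∈ grading (i + j)
  d : carrier →ₗ[k] carrier
  d_mem : ∀ {i : ℤ} {m : carrier}, m ∈ grading i → d m ∈ grading (i + 1)
  d_d : ∀ m : carrier, d (d m) = 0
  leibniz : ∀ {i : ℤ} {a : R.carrier}, a ∈ R.grading i → ∀ m : carrier,
    d (a • m) = R.d a • m + i.negOnePow • (a • d m)

attribute [instance] DGModule.addCommGroup DGModule.module DGModule.moduleR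
  DGModule.isScalarTower

section Gradings

variable {k : Type u} [CommRing k] {M : Type v} [AddCommGroup M] [Module k M]
  {N : Type w} [AddCommGroup N] [Module k N]

theorem DirectSum.IsInternal.exists_proj {A : ℤ → Submodule k M} (h : DirectSum.IsInternal A) :
    ∃ p : ℤ → M →ₗ[k] M, (∀ i, ∀ m ∈ A i, p i m = m) ∧
      ∀ i j, j ≠ i → ∀ m ∈ A j, p i m = 0 := by
  classical
  let := h.chooseDecomposition
  refine ⟨fun i => (A i).subtype ∘ₗ DirectSum.component k ℤ (fun i => A i) i ∘ₗ
    (DirectSum.decomposeLinearEquiv A).toLinearMap, fun i m hm => ?_, fun i j hij m hm => ?_⟩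
  · exact DirectSum.decompose_of_mem_same A hm
  · exact DirectSum.decompose_of_mem_ne A hm hij

theorem isInternal_of_proj {A : ℤ → Submodule k M} (p : ℤ → M →ₗ[k] M)
    (h1 : ∀ i, ∀ m ∈ A i, p i m = m) (h2 : ∀ i j, j ≠ i → ∀ m ∈ A j, p i m = 0)
    (h3 : iSup A = ⊤) : DirectSum.IsInternal A := by
  classical
  rw [DirectSum.isInternal_submodule_iff_iSupIndep_and_iSup_eq_top]
  refine ⟨?_, h3⟩
  intro i
  rw [Submodule.disjoint_def]
  intro x hx hx'
  have : (⨆ j, ⨆ (_ : j ≠ i), A j) ≤ LinearMap.ker (p i) :=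
    iSup₂_le fun j hj m hm => h2 i j hj m hm
  rw [← h1 i x hx]
  exact this hx'

theorem DirectSum.IsInternal.prod {A : ℤ → Submodule k M} {B : ℤ → Submodule k N}
    (hA : DirectSum.IsInternal A) (hB : DirectSum.IsInternal B) :
    DirectSum.IsInternal (fun i => (A i).prod (B i)) := by
  obtain ⟨p, p1, p2⟩ := hA.exists_proj
  obtain ⟨q, q1, q2⟩ := hB.exists_proj
  refine isInternal_of_proj (fun i => (p i).prodMap (q i)) ?_ ?_ ?_
  · rintro i ⟨m, n⟩ ⟨hm, hn⟩
    exact Prod.ext (p1 i m hm) (q1 i n hn)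
  · rintro i j hij ⟨m, n⟩ ⟨hm, hn⟩
    exact Prod.ext (p2 i j hij m hm) (q2 i j hij n hn)
  · rw [eq_top_iff]
    rintro ⟨m, n⟩ -
    have h1 : (⊤ : Submodule k M) ≤
        (⨆ i, (A i).prod (B i)).comap (LinearMap.inl k M N) := by
      rw [← hA.submodule_iSup_eq_top]
      exact iSup_le fun i x hx =>
        le_iSup (fun i => (A i).prod (B i)) i ⟨hx, Submodule.zero_mem _⟩
    have h2 : (⊤ : Submodule k N) ≤
        (⨆ i, (A i).prod (B i)).comap (LinearMap.inr k M N) := by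
      rw [← hB.submodule_iSup_eq_top]
      exact iSup_le fun i x hx =>
        le_iSup (fun i => (A i).prod (B i)) i ⟨Submodule.zero_mem _, hx⟩
    have := Submodule.add_mem _ (Submodule.mem_comap.1 (h1 (x := m) trivial))
      (Submodule.mem_comap.1 (h2 (x := n) trivial))
    simpa using this

theorem DirectSum.IsInternal.shift {A : ℤ → Submodule k M} (hA : DirectSum.IsInternal A)
    (n : ℤ) : DirectSum.IsInternal (fun i => A (i + n)) := by
  obtain ⟨p, p1, p2⟩ := hA.exists_proj
  refine isInternal_of_proj (fun i => p (i + n)) (fun i => p1 _)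
    (fun i j hij => p2 _ _ (by simpa using hij)) ?_
  rw [← hA.submodule_iSup_eq_top]
  exact (Equiv.addRight n).iSup_comp (g := A)

/-- Induction on homogeneous elements. -/
theorem DirectSum.IsInternal.induction {A : ℤ → Submodule k M} (hA : DirectSum.IsInternal A)
    {P : M → Prop} (h0 : P 0) (hadd : ∀ x y, P x → P y → P (x + y))
    (hom : ∀ i, ∀ x ∈ A i, P x) (x : M) : P x := by
  have hx : x ∈ iSup A := by rw [hA.submodule_iSup_eq_top]; trivial
  exact Submodule.iSup_induction A (motive := P) hx hom h0 hadd

end Gradings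

namespace DGAlgebra

variable {k : Type u} [CommRing k] (R : DGAlgebra.{v} k)

theorem exists_twist (n : ℤ) : ∃ f : R.carrier →+* R.carrier,
    ∀ i, ∀ a ∈ R.grading i, f a = (n * i).negOnePow • a := by
  classical
  let := R.isInternal.chooseDecomposition
  let g : R.carrier →ₗ[k] R.carrier :=
    DirectSum.toModule k ℤ R.carrier (fun i => (n * i).negOnePow • (R.grading i).subtype) ∘ₗ
      (DirectSum.decomposeLinearEquiv R.grading).toLinearMap
  have hg : ∀ i, ∀ a ∈ R.grading i, g a = (n * i).negOnePow • a := by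
    intro i a ha
    simp only [g, LinearMap.comp_apply, LinearEquiv.coe_coe, DirectSum.decomposeLinearEquiv_apply,
      DirectSum.decompose_of_mem R.grading ha]
    erw [DirectSum.toModule_lof]
    rfl
  refine ⟨{ g with
    map_one' := ?_
    map_mul' := ?_
    map_zero' := map_zero g }, hg⟩
  · have := hg 0 1 (SetLike.GradedOne.one_mem)
    simpa using this
  · intro x y
    change g (x * y) = g x * g y
    induction x using R.isInternal.induction with
    | h0 => simp
    | hadd x x' hx hx' => simp only [add_mul, map_add, hx, hx']
    | hom i x hx =>
      induction y using R.isInternal.induction with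
      | h0 => simp
      | hadd y y' hy hy' => simp only [mul_add, map_add, hy, hy']
      | hom j y hy =>
        rw [hg i x hx, hg j y hy, hg (i + j) (x * y) (SetLike.GradedMul.mul_mem hx hy),
          mul_add, Int.negOnePow_add]
        simp only [Units.smul_def, smul_mul_smul_comm, Units.val_mul]

/-- The ring endomorphism multiplying elements of degree `i` by `(-1) ^ (n * i)`. -/
noncomputable def twist (n : ℤ) : R.carrier →+* R.carrier := (R.exists_twist n).choose

theorem twist_of_mem (n : ℤ) {i : ℤ} {a : R.carrier} (ha : a ∈ R.grading i) :
    R.twist n a = (n * i).negOnePow • a := (R.exists_twist n).choose_spec i a ha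

end DGAlgebra

namespace DGModule

variable {k : Type u} [CommRing k] {R : DGAlgebra.{v} k}

/-! ### The category of DG modules -/

/-- Morphisms of DG modules: `R`-linear maps of degree `0` commuting with the differentials. -/
@[ext]
structure Hom (M N : DGModule.{w} R) where
  toLin : M.carrier →ₗ[R.carrier] N.carrier
  map_mem : ∀ {i : ℤ} {m : M.carrier}, m ∈ M.grading i → toLin m ∈ N.grading i
  map_d : ∀ m : M.carrier, toLin (M.d m) = N.d (toLin m)

instance : Category (DGModule.{w} R) where
  Hom := Hom
  id M := ⟨LinearMap.id, fun h => h, fun _ => rfl⟩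
  comp f g := ⟨g.toLin ∘ₗ f.toLin, fun h => g.map_mem (f.map_mem h), fun m => by
    simp [f.map_d, g.map_d]⟩

/-- The underlying linear map of a morphism. -/
abbrev lin {M N : DGModule.{w} R} (f : M ⟶ N) : M.carrier →ₗ[R.carrier] N.carrier :=
  Hom.toLin f

theorem map_mem {M N : DGModule.{w} R} (f : M ⟶ N) {i : ℤ} {m : M.carrier}
    (h : m ∈ M.grading i) : lin f m ∈ N.grading i := Hom.map_mem f h

theorem map_d {M N : DGModule.{w} R} (f : M ⟶ N) (m : M.carrier) :
    lin f (M.d m) = N.d (lin f m) := Hom.map_d f m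

theorem hom_ext {M N : DGModule.{w} R} {f g : M ⟶ N} (h : ∀ m, lin f m = lin g m) : f = g :=
  Hom.ext (LinearMap.ext h)

theorem map_ksmul {M N : DGModule.{w} R} (f : M ⟶ N) (c : k) (m : M.carrier) :
    lin f (c • m) = c • lin f m := LinearMap.map_smul_of_tower _ c m

@[simp] theorem lin_id (M : DGModule.{w} R) (m : M.carrier) : lin (𝟙 M) m = m := rfl

@[simp] theorem lin_comp {M N P : DGModule.{w} R} (f : M ⟶ N) (g : N ⟶ P) (m : M.carrier) :
    lin (f ≫ g) m = lin g (lin f m) := rfl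

theorem smul_comm_k (M : DGModule.{w} R) (c : k) (a : R.carrier) (m : M.carrier) :
    a • c • m = c • a • m := by
  rw [← IsScalarTower.algebraMap_smul R.carrier c m, ← IsScalarTower.algebraMap_smul R.carrier c
    (a • m), smul_smul, smul_smul, Algebra.commutes]

section Preadditive

variable {M N : DGModule.{w} R}

instance : Zero (M ⟶ N) := ⟨⟨0, fun _ => Submodule.zero_mem _, fun m => by simp⟩⟩

instance : Add (M ⟶ N) :=
  ⟨fun f g => ⟨lin f + lin g, fun h => Submodule.add_mem _ (map_mem f h) (map_mem g h),
    fun m => by simp [map_d]⟩⟩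

instance : Neg (M ⟶ N) :=
  ⟨fun f => ⟨-lin f, fun h => Submodule.neg_mem _ (map_mem f h), fun m => by simp [map_d]⟩⟩

instance : SMul k (M ⟶ N) :=
  ⟨fun c f => ⟨{ toFun := fun m => c • lin f m
                 map_add' := by simp
                 map_smul' := fun a m => by simp [smul_comm_k] },
    fun h => Submodule.smul_mem _ c (map_mem f h), fun m => by
      change c • lin f (M.d m) = N.d (c • lin f m)
      rw [map_d, map_smul]⟩⟩

@[simp] theorem lin_zero (m : M.carrier) : lin (0 : M ⟶ N) m = 0 := rfl

@[simp] theorem lin_add (f g : M ⟶ N) (m : M.carrier) : lin (f + g) m = lin f m + lin g m := rfl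

@[simp] theorem lin_neg (f : M ⟶ N) (m : M.carrier) : lin (-f) m = -lin f m := rfl

@[simp] theorem lin_smul (c : k) (f : M ⟶ N) (m : M.carrier) : lin (c • f) m = c • lin f m := rfl

instance : AddCommGroup (M ⟶ N) where
  add_assoc f g h := hom_ext fun m => by simp [add_assoc]
  zero_add f := hom_ext fun m => by simp
  add_zero f := hom_ext fun m => by simp
  add_comm f g := hom_ext fun m => by simp [add_comm]
  neg_add_cancel f := hom_ext fun m => by simp
  nsmul := nsmulRec
  zsmul := zsmulRec

instance : Module k (M ⟶ N) where
  one_smul f := hom_ext fun m => by simp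
  mul_smul c c' f := hom_ext fun m => by simp [mul_smul]
  smul_zero c := hom_ext fun m => by simp
  smul_add c f g := hom_ext fun m => by simp
  add_smul c c' f := hom_ext fun m => by simp [add_smul]
  zero_smul f := hom_ext fun m => by simp

end Preadditive

instance : Preadditive (DGModule.{w} R) where
  add_comp _ _ _ f f' g := hom_ext fun m => by simp
  comp_add _ _ _ f g g' := hom_ext fun m => by simp

instance : Linear k (DGModule.{w} R) where
  smul_comp _ _ _ c f g := hom_ext fun m => by simp
  comp_smul _ _ _ f c g := hom_ext fun m => by simp

/-- The DG algebra `R` as a DG left module over itself. -/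
def regular (R : DGAlgebra.{v} k) : DGModule.{v} R where
  carrier := R.carrier
  grading := R.grading
  isInternal := R.isInternal
  smul_mem h h' := SetLike.GradedMul.mul_mem h h'
  d := R.d
  d_mem := R.d_mem
  d_d := R.d_d
  leibniz := R.leibniz

/-! ### Homotopies and cohomology -/

/-- A morphism `f` is null homotopic if `f = d θ + θ d` for a homomorphism `θ` of degree `-1` of
the underlying graded modules. As usual, a homomorphism `θ` of degree `n` of graded left modules
satisfies `θ (a m) = (-1) ^ (n i) a θ m` for `a` of degree `i`. -/
def NullHomotopic {M N : DGModule.{w} R} (f : M ⟶ N) : Prop :=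
  ∃ θ : M.carrier →ₗ[k] N.carrier,
    (∀ (i : ℤ) (m : M.carrier), m ∈ M.grading i → θ m ∈ N.grading (i - 1)) ∧
    (∀ (i : ℤ) (a : R.carrier) (m : M.carrier), a ∈ R.grading i →
      θ (a • m) = i.negOnePow • (a • θ m)) ∧
    ∀ m : M.carrier, lin f m = N.d (θ m) + θ (M.d m)

theorem NullHomotopic.zero (M N : DGModule.{w} R) : NullHomotopic (0 : M ⟶ N) :=
  ⟨0, by simp, by simp, by simp⟩

theorem NullHomotopic.smul {M N : DGModule.{w} R} {f : M ⟶ N} (hf : NullHomotopic f) (c : k) :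
    NullHomotopic (c • f) := by
  obtain ⟨θ, h1, h2, h3⟩ := hf
  refine ⟨c • θ, fun i m hm => Submodule.smul_mem _ c (h1 i m hm), fun i a m ha => ?_,
    fun m => ?_⟩
  · simp only [LinearMap.smul_apply, h2 i a m ha, smul_comm_k, Units.smul_def]
    rw [smul_comm]
  · simp [h3 m]

theorem NullHomotopic.neg {M N : DGModule.{w} R} {f : M ⟶ N} (hf : NullHomotopic f) :
    NullHomotopic (-f) := by
  simpa using hf.smul (-1)

theorem NullHomotopic.add {M N : DGModule.{w} R} {f g : M ⟶ N} (hf : NullHomotopic f)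
    (hg : NullHomotopic g) : NullHomotopic (f + g) := by
  obtain ⟨θ, h1, h2, h3⟩ := hf
  obtain ⟨η, k1, k2, k3⟩ := hg
  refine ⟨θ + η, fun i m hm => Submodule.add_mem _ (h1 i m hm) (k1 i m hm), fun i a m ha => ?_,
    fun m => ?_⟩
  · simp [h2 i a m ha, k2 i a m ha]
  · simp only [lin_add, h3 m, k3 m, LinearMap.add_apply, map_add]
    abel

theorem NullHomotopic.comp_right {M N P : DGModule.{w} R} {f : M ⟶ N} (hf : NullHomotopic f)
    (g : N ⟶ P) : NullHomotopic (f ≫ g) := by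
  obtain ⟨θ, h1, h2, h3⟩ := hf
  refine ⟨(lin g).restrictScalars k ∘ₗ θ, fun i m hm => map_mem g (h1 i m hm), fun i a m ha => ?_,
    fun m => ?_⟩
  · simp [h2 i a m ha, Units.smul_def]
  · simp [h3 m, map_d]

theorem NullHomotopic.comp_left {M N P : DGModule.{w} R} {g : N ⟶ P} (hg : NullHomotopic g)
    (f : M ⟶ N) : NullHomotopic (f ≫ g) := by
  obtain ⟨θ, h1, h2, h3⟩ := hg
  refine ⟨θ ∘ₗ (lin f).restrictScalars k, fun i m hm => h1 i _ (map_mem f hm), fun i a m ha => ?_,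
    fun m => ?_⟩
  · simp [h2 i a _ ha]
  · simp [h3, map_d]

/-- Two morphisms are homotopic if their difference is null homotopic. -/
def homotopic (R : DGAlgebra.{v} k) : HomRel (DGModule.{w} R) :=
  fun _ _ f g => NullHomotopic (f - g)

instance : Congruence (homotopic.{w} R) where
  equivalence :=
    { refl := fun f => by
        change NullHomotopic (f - f)
        rw [sub_self]; exact NullHomotopic.zero _ _
      symm := fun {f g} h => by
        have := NullHomotopic.neg h
        rwa [neg_sub] at this
      trans := fun {f g h} h1 h2 => by
        have := NullHomotopic.add h1 h2
        rwa [sub_add_sub_cancel] at this }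
  comp_left f _ _ h := by
    have := NullHomotopic.comp_left h f
    rwa [Preadditive.comp_sub] at this
  comp_right g h := by
    have := NullHomotopic.comp_right h g
    rwa [Preadditive.sub_comp] at this

/-- The submodule of cocycles. -/
def cocycles (M : DGModule.{w} R) : Submodule k M.carrier := LinearMap.ker M.d

/-- The (total) cohomology of a DG module. -/
abbrev cohomology (M : DGModule.{w} R) : Type w :=
  M.cocycles ⧸ (LinearMap.range M.d).submoduleOf M.cocycles

/-- The map induced by a morphism on cocycles. -/
def cocyclesMap {M N : DGModule.{w} R} (f : M ⟶ N) : M.cocycles →ₗ[k] N.cocycles :=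
  ((lin f).restrictScalars k).restrict fun m hm => by
    have hm' : M.d m = 0 := hm
    change N.d (lin f m) = 0
    rw [← map_d, hm', map_zero]

/-- The map induced by a morphism on cohomology. -/
def cohomologyMap {M N : DGModule.{w} R} (f : M ⟶ N) : M.cohomology →ₗ[k] N.cohomology :=
  Submodule.mapQ _ _ (cocyclesMap f) <| by
    rintro ⟨m, hm⟩ ⟨x, rfl⟩
    exact ⟨lin f x, (map_d f x).symm⟩

/-- Cohomology as a functor. -/
def cohomologyFunctor (R : DGAlgebra.{v} k) : DGModule.{w} R ⥤ ModuleCat.{w} k where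
  obj M := ModuleCat.of k M.cohomology
  map f := ModuleCat.ofHom (cohomologyMap f)
  map_id M := by
    ext x
    rfl
  map_comp f g := by
    ext x
    rfl

theorem cohomologyMap_eq_of_homotopic {M N : DGModule.{w} R} {f g : M ⟶ N}
    (h : homotopic R f g) : cohomologyMap f = cohomologyMap g := by
  obtain ⟨θ, -, -, h3⟩ := h
  ext ⟨m, hm⟩
  have hm' : M.d m = 0 := hm
  refine (Submodule.Quotient.eq _).2 ⟨θ m, ?_⟩
  have := h3 m
  rw [hm', map_zero, add_zero] at this
  change N.d (θ m) = lin f m - lin g m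
  rw [← this, sub_eq_add_neg, sub_eq_add_neg]
  rfl

theorem cohomologyMap_bijective_iff {M N : DGModule.{w} R} (f : M ⟶ N) :
    Function.Bijective (cohomologyMap f) ↔
      (∀ m, M.d m = 0 → ∀ n, lin f m = N.d n → ∃ x, m = M.d x) ∧
      ∀ n, N.d n = 0 → ∃ m, M.d m = 0 ∧ ∃ x, n = lin f m + N.d x := by
  constructor
  · rintro ⟨hi, hs⟩
    refine ⟨fun m hm n hn => ?_, fun n hn => ?_⟩
    · have : cohomologyMap f (Submodule.Quotient.mk ⟨m, hm⟩) = 0 :=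
        (Submodule.Quotient.mk_eq_zero _).2 ⟨n, hn.symm⟩
      obtain ⟨x, hx⟩ := (Submodule.Quotient.mk_eq_zero _).1
        (hi (this.trans (map_zero _).symm))
      exact ⟨x, hx.symm⟩
    · obtain ⟨y, hy⟩ := hs (Submodule.Quotient.mk ⟨n, hn⟩)
      obtain ⟨⟨m, hm⟩, rfl⟩ := Submodule.Quotient.mk_surjective _ y
      obtain ⟨x, hx⟩ := (Submodule.Quotient.eq _).1 hy
      refine ⟨m, hm, -x, ?_⟩
      have hx' : N.d x = lin f m - n := hx
      rw [map_neg, hx']; abel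
  · rintro ⟨hi, hs⟩
    constructor
    · rw [injective_iff_map_eq_zero]
      intro y hy
      obtain ⟨⟨m, hm⟩, rfl⟩ := Submodule.Quotient.mk_surjective _ y
      obtain ⟨x, hx⟩ := (Submodule.Quotient.mk_eq_zero _).1 hy
      obtain ⟨z, hz⟩ := hi m hm x hx.symm
      exact (Submodule.Quotient.mk_eq_zero _).2 ⟨z, hz.symm⟩
    · intro y
      obtain ⟨⟨n, hn⟩, rfl⟩ := Submodule.Quotient.mk_surjective _ y
      obtain ⟨m, hm, x, hx⟩ := hs n hn
      refine ⟨Submodule.Quotient.mk ⟨m, hm⟩, (Submodule.Quotient.eq _).2 ⟨-x, ?_⟩⟩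
      change N.d (-x) = lin f m - n
      rw [map_neg, hx]; abel

/-! ### Shifts, products and mapping cones -/

theorem twist_ksmul (n : ℤ) (c : k) (a : R.carrier) : R.twist n (c • a) = c • R.twist n a := by
  rw [Algebra.smul_def, map_mul, R.twist_of_mem n (SetLike.algebraMap_mem_graded R.grading c),
    mul_zero, Int.negOnePow_zero, one_smul, Algebra.smul_def]

/-- The underlying type of the `n`-th suspension of `M`. -/
def ShiftCarrier (_ : ℤ) (M : DGModule.{w} R) : Type w := M.carrier

instance (n : ℤ) (M : DGModule.{w} R) : AddCommGroup (ShiftCarrier n M) :=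
  inferInstanceAs (AddCommGroup M.carrier)

instance (n : ℤ) (M : DGModule.{w} R) : Module k (ShiftCarrier n M) :=
  inferInstanceAs (Module k M.carrier)

noncomputable instance (n : ℤ) (M : DGModule.{w} R) : Module R.carrier (ShiftCarrier n M) :=
  Module.compHom M.carrier (R.twist n)

/-- Auxiliary version of `toShift`. -/
def toShiftAux (n : ℤ) (M : DGModule.{w} R) : M.carrier ≃ₗ[k] ShiftCarrier n M :=
  LinearEquiv.refl k M.carrier

theorem smul_toShiftAux_eq (n : ℤ) (M : DGModule.{w} R) (a : R.carrier) (m : M.carrier) :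
    a • toShiftAux n M m = toShiftAux n M (R.twist n a • m) := rfl

theorem smul_toShiftAux (n : ℤ) (M : DGModule.{w} R) {i : ℤ} {a : R.carrier}
    (ha : a ∈ R.grading i) (m : M.carrier) :
    a • toShiftAux n M m = (n * i).negOnePow • toShiftAux n M (a • m) := by
  rw [smul_toShiftAux_eq, R.twist_of_mem n ha]
  simp only [Units.smul_def, smul_assoc, map_zsmul]

instance (n : ℤ) (M : DGModule.{w} R) : IsScalarTower k R.carrier (ShiftCarrier n M) :=
  ⟨fun c a m => by
    obtain ⟨m, rfl⟩ := (toShiftAux n M).surjective m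
    rw [smul_toShiftAux_eq, twist_ksmul, smul_assoc, map_smul, smul_toShiftAux_eq]⟩

theorem negOnePow_smul_mem {M : Type w} [AddCommGroup M] [Module k M] (S : Submodule k M)
    (n : ℤ) {m : M} (hm : m ∈ S) : n.negOnePow • m ∈ S := by
  rw [Units.smul_def]
  exact S.toAddSubgroup.zsmul_mem hm _

/-- The `n`-th suspension `Σⁿ M`: its component of degree `i` is `M^{i+n}`, its differential is
`(-1) ^ n d`, and `a` of degree `i` acts on it as `(-1) ^ (n i) a`. -/
noncomputable def shift (n : ℤ) (M : DGModule.{w} R) : DGModule.{w} R where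
  carrier := ShiftCarrier n M
  grading i := (M.grading (i + n)).comap (toShiftAux n M).symm.toLinearMap
  isInternal := M.isInternal.shift n
  smul_mem := by
    intro i j a m ha hm
    obtain ⟨m, rfl⟩ := (toShiftAux n M).surjective m
    rw [smul_toShiftAux n M ha]
    refine negOnePow_smul_mem _ _ ?_
    change a • m ∈ M.grading (i + j + n)
    rw [add_assoc]
    exact M.smul_mem ha hm
  d := n.negOnePow • ((toShiftAux n M).toLinearMap ∘ₗ M.d ∘ₗ (toShiftAux n M).symm.toLinearMap)
  d_mem := by
    intro i m hm
    obtain ⟨m, rfl⟩ := (toShiftAux n M).surjective m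
    refine negOnePow_smul_mem _ _ ?_
    change M.d m ∈ M.grading (i + 1 + n)
    rw [add_right_comm]
    exact M.d_mem hm
  d_d m := by
    obtain ⟨m, rfl⟩ := (toShiftAux n M).surjective m
    change n.negOnePow • toShiftAux n M (M.d (n.negOnePow • M.d m)) = 0
    simp only [Units.smul_def, map_zsmul, M.d_d, map_zero, smul_zero]
  leibniz := by
    intro i a ha m
    obtain ⟨m, rfl⟩ := (toShiftAux n M).surjective m
    simp only [smul_toShiftAux n M ha, Units.smul_def, LinearMap.smul_apply, LinearMap.comp_apply,
      LinearEquiv.coe_coe, map_zsmul, LinearEquiv.symm_apply_apply, M.leibniz ha, map_add,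
      smul_toShiftAux n M (R.d_mem ha), smul_add, smul_comm a, smul_smul]
    simp only [← Units.val_mul, ← Int.negOnePow_add]
    congr 3
    · rw [Int.negOnePow_eq_iff]; exact ⟨0, by ring⟩
    · congr 1; ring

/-- The identity map from the underlying set of `M` to that of `Σⁿ M`. -/
noncomputable def toShift (n : ℤ) (M : DGModule.{w} R) : M.carrier ≃ₗ[k] (shift n M).carrier :=
  toShiftAux n M

theorem smul_toShift_eq (n : ℤ) (M : DGModule.{w} R) (a : R.carrier) (m : M.carrier) :
    a • toShift n M m = toShift n M (R.twist n a • m) := rfl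

theorem smul_toShift (n : ℤ) (M : DGModule.{w} R) {i : ℤ} {a : R.carrier}
    (ha : a ∈ R.grading i) (m : M.carrier) :
    a • toShift n M m = (n * i).negOnePow • toShift n M (a • m) := smul_toShiftAux n M ha m

theorem shift_d (n : ℤ) (M : DGModule.{w} R) (m : M.carrier) :
    (shift n M).d (toShift n M m) = n.negOnePow • toShift n M (M.d m) := rfl

theorem toShift_mem (n : ℤ) (M : DGModule.{w} R) {i : ℤ} {m : M.carrier} :
    toShift n M m ∈ (shift n M).grading i ↔ m ∈ M.grading (i + n) := Iff.rfl

/-- The suspension of a morphism. -/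
noncomputable def shiftMap (n : ℤ) {M N : DGModule.{w} R} (f : M ⟶ N) : shift n M ⟶ shift n N where
  toLin :=
    { toFun := fun m => toShift n N (lin f ((toShift n M).symm m))
      map_add' := fun x y => by simp only [map_add]
      map_smul' := fun a m => by
        obtain ⟨m, rfl⟩ := (toShift n M).surjective m
        change toShift n N (lin f (R.twist n a • m)) = a • toShift n N (lin f m)
        rw [smul_toShift_eq, map_smul] }
  map_mem := by
    intro i m hm
    obtain ⟨m, rfl⟩ := (toShift n M).surjective m
    exact (toShift_mem n N).2 (map_mem f ((toShift_mem n M).1 hm))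
  map_d := by
    intro m
    obtain ⟨m, rfl⟩ := (toShift n M).surjective m
    change toShift n N (lin f (n.negOnePow • M.d m)) = n.negOnePow • toShift n N (N.d (lin f m))
    simp only [Units.smul_def, map_zsmul, map_d]

@[simp] theorem lin_shiftMap (n : ℤ) {M N : DGModule.{w} R} (f : M ⟶ N) (m : M.carrier) :
    lin (shiftMap n f) (toShift n M m) = toShift n N (lin f m) := rfl

/-- The suspension functor `Σⁿ` on DG modules. -/
noncomputable def shiftFunctor (R : DGAlgebra.{v} k) (n : ℤ) :
    DGModule.{w} R ⥤ DGModule.{w} R where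
  obj := shift n
  map := shiftMap n
  map_id _ := rfl
  map_comp _ _ := rfl

theorem NullHomotopic.shiftMap (n : ℤ) {M N : DGModule.{w} R} {f : M ⟶ N}
    (hf : NullHomotopic f) : NullHomotopic (DGModule.shiftMap n f) := by
  obtain ⟨θ, h1, h2, h3⟩ := hf
  refine ⟨n.negOnePow • ((toShift n N).toLinearMap ∘ₗ θ ∘ₗ (toShift n M).symm.toLinearMap),
    ?_, ?_, ?_⟩
  · intro i m hm
    obtain ⟨m, rfl⟩ := (toShift n M).surjective m
    refine negOnePow_smul_mem _ _ ?_
    change θ m ∈ N.grading (i - 1 + n)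
    have := h1 _ m ((toShift_mem n M).1 hm)
    rwa [add_sub_right_comm] at this
  · intro i a m ha
    obtain ⟨m, rfl⟩ := (toShift n M).surjective m
    change _ = i.negOnePow • (a • (n.negOnePow • toShift n N (θ m)))
    change n.negOnePow • toShift n N (θ (R.twist n a • m)) = _
    rw [R.twist_of_mem n ha]
    simp only [Units.smul_def, smul_assoc, map_zsmul, h2 i a m ha, smul_comm a,
      smul_toShift n N ha, smul_smul]
    congr 1
    ring
  · intro m
    obtain ⟨m, rfl⟩ := (toShift n M).surjective m
    change toShift n N (lin f m) = n.negOnePow • toShift n N (N.d (n.negOnePow • θ m)) +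
      n.negOnePow • toShift n N (θ (n.negOnePow • M.d m))
    rw [h3 m]
    simp only [Units.smul_def, map_zsmul, map_add, smul_smul]
    simp only [← Units.val_mul, Int.units_mul_self, Units.val_one, one_smul]

/-- The product of two DG modules. -/
def prod (M N : DGModule.{w} R) : DGModule.{w} R where
  carrier := M.carrier × N.carrier
  grading i := (M.grading i).prod (N.grading i)
  isInternal := M.isInternal.prod N.isInternal
  smul_mem h h' := ⟨M.smul_mem h h'.1, N.smul_mem h h'.2⟩
  d := M.d.prodMap N.d
  d_mem h := ⟨M.d_mem h.1, N.d_mem h.2⟩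
  d_d _ := Prod.ext (M.d_d _) (N.d_d _)
  leibniz h _ := Prod.ext (M.leibniz h _) (N.leibniz h _)

/-- The element `(m, n)` of the product. -/
def prodMk {M N : DGModule.{w} R} (m : M.carrier) (n : N.carrier) : (prod M N).carrier := (m, n)

theorem prodMk_inj {M N : DGModule.{w} R} {m m' : M.carrier} {n n' : N.carrier} :
    prodMk m n = prodMk m' n' ↔ m = m' ∧ n = n' := Prod.mk.injEq _ _ _ _ ▸ Iff.rfl

/-- The morphism to a product with the given components. -/
def prodLift {M N P : DGModule.{w} R} (f : P ⟶ M) (g : P ⟶ N) : P ⟶ prod M N where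
  toLin := (lin f).prod (lin g)
  map_mem h := ⟨map_mem f h, map_mem g h⟩
  map_d _ := Prod.ext (map_d f _) (map_d g _)

/-- The inclusion of the first factor. -/
def prodInl (M N : DGModule.{w} R) : M ⟶ prod M N where
  toLin := LinearMap.inl R.carrier M.carrier N.carrier
  map_mem h := ⟨h, Submodule.zero_mem _⟩
  map_d _ := Prod.ext rfl (map_zero N.d).symm

/-- The inclusion of the second factor. -/
def prodInr (M N : DGModule.{w} R) : N ⟶ prod M N where
  toLin := LinearMap.inr R.carrier M.carrier N.carrier
  map_mem h := ⟨Submodule.zero_mem _, h⟩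
  map_d _ := Prod.ext (map_zero M.d).symm rfl

/-- The mapping cone of `f : M ⟶ N`: the graded module `N ⊕ ΣM` with the differential
`d (n, m) = (d n + f m, -d m)`. -/
noncomputable def cone {M N : DGModule.{w} R} (f : M ⟶ N) : DGModule.{w} R where
  carrier := N.carrier × (shift 1 M).carrier
  grading i := (N.grading i).prod ((shift 1 M).grading i)
  isInternal := N.isInternal.prod (shift 1 M).isInternal
  smul_mem h h' := ⟨N.smul_mem h h'.1, (shift 1 M).smul_mem h h'.2⟩
  d := ((N.d ∘ₗ LinearMap.fst k N.carrier (shift 1 M).carrier) +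
    ((lin f).restrictScalars k ∘ₗ (toShift 1 M).symm.toLinearMap ∘ₗ
      LinearMap.snd k N.carrier (shift 1 M).carrier)).prod
      ((shift 1 M).d ∘ₗ LinearMap.snd k N.carrier (shift 1 M).carrier)
  d_mem := by
    rintro i ⟨n, m⟩ ⟨hn, hm⟩
    exact ⟨Submodule.add_mem _ (N.d_mem hn) (map_mem f hm), (shift 1 M).d_mem hm⟩
  d_d := by
    rintro ⟨n, m⟩
    obtain ⟨m, rfl⟩ := (toShift 1 M).surjective m
    refine Prod.ext ?_ ((shift 1 M).d_d _)
    change N.d (N.d n + lin f m) + lin f ((1 : ℤ).negOnePow • M.d m) = 0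
    simp [N.d_d, map_d]
  leibniz := by
    rintro i a ha ⟨n, m⟩
    obtain ⟨m, rfl⟩ := (toShift 1 M).surjective m
    refine Prod.ext ?_ ((shift 1 M).leibniz ha _)
    change N.d (a • n) + lin f (R.twist 1 a • m) = R.d a • n +
      i.negOnePow • (a • (N.d n + lin f m))
    rw [N.leibniz ha, R.twist_of_mem 1 ha]
    simp only [Units.smul_def, one_mul, smul_assoc, map_zsmul, map_smul, smul_add, add_assoc]

/-- The element `(n, m)` of the mapping cone. -/
noncomputable def coneMk {M N : DGModule.{w} R} (f : M ⟶ N) (n : N.carrier) (m : M.carrier) :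
    (cone f).carrier := (n, toShift 1 M m)

theorem coneMk_surj {M N : DGModule.{w} R} (f : M ⟶ N) (c : (cone f).carrier) :
    ∃ n m, c = coneMk f n m := ⟨c.1, (toShift 1 M).symm c.2, rfl⟩

theorem coneMk_inj {M N : DGModule.{w} R} {f : M ⟶ N} {n n' : N.carrier} {m m' : M.carrier} :
    coneMk f n m = coneMk f n' m' ↔ n = n' ∧ m = m' :=
  ⟨fun h => ⟨congrArg Prod.fst h, congrArg Prod.snd h⟩, fun h => by rw [h.1, h.2]⟩

theorem coneMk_zero {M N : DGModule.{w} R} (f : M ⟶ N) : coneMk f 0 0 = 0 := rfl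

theorem coneMk_add {M N : DGModule.{w} R} (f : M ⟶ N) (n n' : N.carrier) (m m' : M.carrier) :
    coneMk f n m + coneMk f n' m' = coneMk f (n + n') (m + m') := rfl

theorem coneMk_mem {M N : DGModule.{w} R} (f : M ⟶ N) {i : ℤ} {n : N.carrier} {m : M.carrier} :
    coneMk f n m ∈ (cone f).grading i ↔ n ∈ N.grading i ∧ m ∈ M.grading (i + 1) := Iff.rfl

theorem smul_coneMk {M N : DGModule.{w} R} (f : M ⟶ N) {i : ℤ} {a : R.carrier}
    (ha : a ∈ R.grading i) (n : N.carrier) (m : M.carrier) :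
    a • coneMk f n m = coneMk f (a • n) (i.negOnePow • (a • m)) := by
  refine Prod.ext rfl ?_
  have := smul_toShift 1 M ha m
  rw [one_mul] at this
  exact this

theorem cone_d {M N : DGModule.{w} R} (f : M ⟶ N) (n : N.carrier) (m : M.carrier) :
    (cone f).d (coneMk f n m) = coneMk f (N.d n + lin f m) (-M.d m) := by
  refine Prod.ext rfl ?_
  change (1 : ℤ).negOnePow • M.d m = - M.d m
  simp

/-- The inclusion `N ⟶ cone f`. -/
noncomputable def coneInl {M N : DGModule.{w} R} (f : M ⟶ N) : N ⟶ cone f where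
  toLin := LinearMap.inl R.carrier N.carrier (shift 1 M).carrier
  map_mem h := ⟨h, Submodule.zero_mem _⟩
  map_d n := by
    have := cone_d f n 0
    simp only [map_zero, add_zero, neg_zero] at this
    exact this.symm

theorem lin_coneInl {M N : DGModule.{w} R} (f : M ⟶ N) (n : N.carrier) :
    lin (coneInl f) n = coneMk f n 0 := rfl

/-- The projection `cone f ⟶ ΣM`. -/
noncomputable def coneSnd {M N : DGModule.{w} R} (f : M ⟶ N) : cone f ⟶ shift 1 M where
  toLin := LinearMap.snd R.carrier N.carrier (shift 1 M).carrier
  map_mem h := h.2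
  map_d c := by
    obtain ⟨n, m, rfl⟩ := coneMk_surj f c
    rfl

theorem lin_coneSnd {M N : DGModule.{w} R} (f : M ⟶ N) (n : N.carrier) (m : M.carrier) :
    lin (coneSnd f) (coneMk f n m) = toShift 1 M m := rfl

/-- The `k`-linear inclusion of the second summand of the cone. -/
noncomputable def coneInrLin {M N : DGModule.{w} R} (f : M ⟶ N) :
    M.carrier →ₗ[k] (cone f).carrier :=
  LinearMap.inr k N.carrier (shift 1 M).carrier ∘ₗ (toShift 1 M).toLinearMap

theorem coneInrLin_apply {M N : DGModule.{w} R} (f : M ⟶ N) (m : M.carrier) :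
    coneInrLin f m = coneMk f 0 m := rfl

theorem nullHomotopic_comp_coneInl {M N : DGModule.{w} R} (f : M ⟶ N) :
    NullHomotopic (f ≫ coneInl f) := by
  refine ⟨coneInrLin f, ?_, ?_, ?_⟩
  · intro i m hm
    rw [coneInrLin_apply, coneMk_mem, sub_add_cancel]
    exact ⟨Submodule.zero_mem _, hm⟩
  · intro i a m ha
    rw [coneInrLin_apply, coneInrLin_apply, smul_coneMk f ha, smul_zero]
    refine Prod.ext ?_ ?_
    · exact (smul_zero i.negOnePow).symm
    · change a • m = i.negOnePow • i.negOnePow • (a • m)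
      rw [smul_smul, Int.units_mul_self, one_smul]
  · intro m
    rw [coneInrLin_apply, coneInrLin_apply, cone_d, coneMk_add, lin_comp, lin_coneInl, coneMk_inj]
    simp

/-- If `M` is acyclic, then the inclusion `N ⟶ cone f` is a quasi-isomorphism. -/
theorem coneInl_bijective {M N : DGModule.{w} R} (f : M ⟶ N)
    (hM : ∀ m, M.d m = 0 → ∃ x, m = M.d x) : Function.Bijective (cohomologyMap (coneInl f)) := by
  rw [cohomologyMap_bijective_iff]
  constructor
  · intro n _ c h
    obtain ⟨y, m, rfl⟩ := coneMk_surj f c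
    rw [cone_d, lin_coneInl, coneMk_inj] at h
    obtain ⟨x, rfl⟩ := hM m (neg_eq_zero.1 h.2.symm)
    exact ⟨y + lin f x, by rw [h.1, map_d, map_add]⟩
  · intro c h
    obtain ⟨n, m, rfl⟩ := coneMk_surj f c
    rw [cone_d, ← coneMk_zero, coneMk_inj] at h
    obtain ⟨x, rfl⟩ := hM m (neg_eq_zero.1 h.2)
    refine ⟨n + lin f x, by rw [map_add, ← map_d, h.1], coneMk f 0 (-x), ?_⟩
    rw [cone_d, lin_coneInl, coneMk_add, coneMk_inj]
    simp

/-- The cone of a quasi-isomorphism is acyclic. -/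
theorem cone_acyclic {M N : DGModule.{w} R} (f : M ⟶ N)
    (hf : Function.Bijective (cohomologyMap f)) (c : (cone f).carrier)
    (hc : (cone f).d c = 0) : ∃ x, c = (cone f).d x := by
  rw [cohomologyMap_bijective_iff] at hf
  obtain ⟨hi, hs⟩ := hf
  obtain ⟨n, m, rfl⟩ := coneMk_surj f c
  rw [cone_d, ← coneMk_zero, coneMk_inj] at hc
  obtain ⟨w, rfl⟩ := hi m (neg_eq_zero.1 hc.2) (-n)
    (by rw [map_neg, eq_neg_iff_add_eq_zero, add_comm, hc.1])
  obtain ⟨z, hz, x, hx⟩ := hs (n + lin f w) (by rw [map_add, ← map_d, hc.1])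
  refine ⟨coneMk f x (z - w), ?_⟩
  rw [cone_d, coneMk_inj]
  constructor
  · rw [map_sub, eq_sub_of_add_eq hx]; abel
  · simp [hz]

/-! ### Homotopy and derived categories -/

/-- The homotopy category `K(R)` of DG left `R`-modules. -/
abbrev HomotopyCat (R : DGAlgebra.{v} k) := CategoryTheory.Quotient (homotopic.{w} R)

/-- The functor from DG modules to the homotopy category. -/
abbrev toK (R : DGAlgebra.{v} k) : DGModule.{w} R ⥤ HomotopyCat.{w} R :=
  CategoryTheory.Quotient.functor (homotopic.{w} R)

theorem homotopic_add ⦃M N : DGModule.{w} R⦄ (f₁ f₂ g₁ g₂ : M ⟶ N) (h : homotopic R f₁ f₂)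
    (h' : homotopic R g₁ g₂) : homotopic R (f₁ + g₁) (f₂ + g₂) := by
  have := NullHomotopic.add h h'
  rwa [← add_sub_add_comm] at this

theorem homotopic_smul (c : k) ⦃M N : DGModule.{w} R⦄ (f₁ f₂ : M ⟶ N) (h : homotopic R f₁ f₂) :
    homotopic R (c • f₁) (c • f₂) := by
  have := NullHomotopic.smul h c
  rwa [smul_sub] at this

instance : Preadditive (HomotopyCat.{w} R) := Quotient.preadditive _ homotopic_add

instance : (toK.{w} R).Additive := Quotient.functor_additive _ homotopic_add

instance : Linear k (HomotopyCat.{w} R) := Quotient.linear k _ homotopic_smul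

instance : (toK.{w} R).Linear k := Quotient.linear_functor k _ homotopic_smul

theorem toK_map_eq_iff {M N : DGModule.{w} R} (f g : M ⟶ N) :
    (toK R).map f = (toK R).map g ↔ NullHomotopic (f - g) :=
  Quotient.functor_map_eq_iff (homotopic R) f g

/-- Cohomology as a functor on the homotopy category. -/
def cohomologyK (R : DGAlgebra.{v} k) : HomotopyCat.{w} R ⥤ ModuleCat.{w} k :=
  CategoryTheory.Quotient.lift _ (cohomologyFunctor R) fun _ _ _ _ h =>
    congrArg ModuleCat.ofHom (cohomologyMap_eq_of_homotopic h)

/-- The quasi-isomorphisms of the homotopy category: the morphisms inducing an isomorphism on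
cohomology. -/
def quasiIso (R : DGAlgebra.{v} k) : MorphismProperty (HomotopyCat.{w} R) :=
  (MorphismProperty.isomorphisms (ModuleCat.{w} k)).inverseImage (cohomologyK R)

theorem quasiIso_map_iff {M N : DGModule.{w} R} (f : M ⟶ N) :
    quasiIso R ((toK R).map f) ↔ Function.Bijective (cohomologyMap f) := by
  change IsIso (ModuleCat.ofHom (cohomologyMap f)) ↔ _
  rw [ConcreteCategory.isIso_iff_bijective]
  rfl

instance : (quasiIso.{w} R).IsMultiplicative := by
  unfold quasiIso
  infer_instance

theorem exists_leftFraction_aux {X X' Y : DGModule.{w} R} (s : X' ⟶ X) (f : X' ⟶ Y)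
    (hs : Function.Bijective (cohomologyMap s)) :
    ∃ (Y' : DGModule.{w} R) (g : X ⟶ Y') (t : Y ⟶ Y'), Function.Bijective (cohomologyMap t) ∧
      NullHomotopic (f ≫ t - s ≫ g) := by
  let φ : X' ⟶ prod Y X := prodLift f (-s)
  refine ⟨cone φ, prodInr Y X ≫ coneInl φ, prodInl Y X ≫ coneInl φ, ?_, ?_⟩
  · have hφ : ∀ x, lin φ x = prodMk (lin f x) (-lin s x) := fun _ => rfl
    have hd : ∀ y x, (prod Y X).d (prodMk y x) = prodMk (Y.d y) (X.d x) := fun _ _ => rfl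
    have ha : ∀ (y y' : Y.carrier) (x x' : X.carrier),
      prodMk y x + prodMk y' x' = prodMk (y + y') (x + x') := fun _ _ _ _ => rfl
    have hι : ∀ y, lin (prodInl Y X ≫ coneInl φ) y = coneMk φ (prodMk y 0) 0 := fun _ => rfl
    have h0 : (0 : (prod Y X).carrier) = prodMk 0 0 := rfl
    rw [cohomologyMap_bijective_iff] at hs ⊢
    obtain ⟨hi, hs⟩ := hs
    constructor
    · intro y _ c h
      obtain ⟨z, x', rfl⟩ := coneMk_surj φ c
      obtain ⟨b, x, rfl⟩ : ∃ b x, z = prodMk b x := ⟨z.1, z.2, rfl⟩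
      rw [cone_d, hι, coneMk_inj, hd, hφ, ha, prodMk_inj] at h
      obtain ⟨⟨h1, h2⟩, h3⟩ := h
      obtain ⟨w, rfl⟩ := hi x' (neg_eq_zero.1 h3.symm) x
        (by rw [← sub_eq_add_neg] at h2; exact (sub_eq_zero.1 h2.symm).symm)
      exact ⟨b + lin f w, by rw [h1, map_add, map_d]⟩
    · intro c h
      obtain ⟨z, x', rfl⟩ := coneMk_surj φ c
      obtain ⟨y, x, rfl⟩ : ∃ y x, z = prodMk y x := ⟨z.1, z.2, rfl⟩
      rw [cone_d, ← coneMk_zero, coneMk_inj, hd, hφ, ha, h0, prodMk_inj] at h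
      obtain ⟨⟨h1, h2⟩, h3⟩ := h
      rw [← sub_eq_add_neg, sub_eq_zero] at h2
      obtain ⟨w, rfl⟩ := hi x' (neg_eq_zero.1 h3) x h2.symm
      obtain ⟨z, hz, x'', hx⟩ := hs (x - lin s w) (by rw [map_sub, ← map_d, h2, sub_self])
      refine ⟨y + lin f w + lin f z, ?_, coneMk φ (prodMk 0 x'') (-w - z), ?_⟩
      · rw [map_add, map_add, ← map_d, ← map_d, hz, h1, map_zero, zero_add]
      · rw [cone_d, hι, coneMk_add, coneMk_inj, hd, hφ, ha, ha, prodMk_inj]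
        refine ⟨⟨?_, ?_⟩, ?_⟩
        · simp
        · rw [eq_add_of_sub_eq hx, map_sub, map_neg]; abel
        · simp [hz]
  · have := nullHomotopic_comp_coneInl φ
    have e : φ ≫ coneInl φ = f ≫ prodInl Y X ≫ coneInl φ - s ≫ prodInr Y X ≫ coneInl φ := by
      have e' : φ = f ≫ prodInl Y X - s ≫ prodInr Y X := by
        refine hom_ext fun m => ?_
        rw [sub_eq_add_neg]
        refine Prod.ext ?_ ?_
        · change lin f m = lin f m + -0
          simp
        · change -lin s m = 0 + -lin s m
          simp
      rw [← Category.assoc, ← Category.assoc, ← Preadditive.sub_comp, ← e']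
    rwa [e] at this

theorem exists_cancel_aux {X X' Y : DGModule.{w} R} (s : X' ⟶ X) (g : X ⟶ Y)
    (hs : Function.Bijective (cohomologyMap s)) (h : NullHomotopic (s ≫ g)) :
    ∃ (Y' : DGModule.{w} R) (t : Y ⟶ Y'), Function.Bijective (cohomologyMap t) ∧
      NullHomotopic (g ≫ t) := by
  obtain ⟨θ, h1, h2, h3⟩ := h
  let l : (cone s).carrier →ₗ[k] Y.carrier :=
    (lin g).restrictScalars k ∘ₗ LinearMap.fst k X.carrier (shift 1 X').carrier +
      θ ∘ₗ (toShift 1 X').symm.toLinearMap ∘ₗ LinearMap.snd k X.carrier (shift 1 X').carrier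
  have hl : ∀ x x', l (coneMk s x x') = lin g x + θ x' := fun _ _ => rfl
  have hls : ∀ (a : R.carrier) (c : (cone s).carrier), l (a • c) = a • l c := by
    intro a c
    obtain ⟨x, x', rfl⟩ := coneMk_surj s c
    induction a using R.isInternal.induction with
    | h0 => simp
    | hadd a b ha hb => rw [add_smul, map_add, ha, hb, add_smul]
    | hom i a ha =>
      rw [smul_coneMk s ha, hl, hl, map_smul, Units.smul_def, map_zsmul, h2 i a x' ha,
        ← Units.smul_def, smul_smul, Int.units_mul_self, one_smul, smul_add]
  let φ : cone s ⟶ Y :=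
    { toLin := { l with map_smul' := hls }
      map_mem := by
        intro i c hc
        obtain ⟨x, x', rfl⟩ := coneMk_surj s c
        rw [coneMk_mem] at hc
        have := h1 _ x' hc.2
        rw [add_sub_cancel_right] at this
        exact Submodule.add_mem _ (map_mem g hc.1) this
      map_d := by
        intro c
        obtain ⟨x, x', rfl⟩ := coneMk_surj s c
        change l _ = Y.d (l _)
        have := h3 x'
        rw [lin_comp] at this
        rw [cone_d, hl, hl, map_add, map_add, this, map_d, map_neg]
        abel }
  refine ⟨cone φ, coneInl φ, coneInl_bijective φ (cone_acyclic s hs), ?_⟩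
  have e : g = coneInl s ≫ φ := hom_ext fun m => by
    change lin g m = lin g m + θ 0
    simp
  have := (nullHomotopic_comp_coneInl φ).comp_left (coneInl s)
  rw [← Category.assoc, ← e] at this
  exact this

instance : (quasiIso.{w} R).HasLeftCalculusOfFractions where
  exists_leftFraction := by
    rintro ⟨X⟩ ⟨Y⟩ ⟨s, hs, f⟩
    rename_i X'
    obtain ⟨X'⟩ := X'
    obtain ⟨s, rfl⟩ := (toK R).map_surjective s
    obtain ⟨f, rfl⟩ := (toK R).map_surjective f
    obtain ⟨Y', g, t, ht, h⟩ := exists_leftFraction_aux s f ((quasiIso_map_iff s).1 hs)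
    refine ⟨⟨(toK R).map g, (toK R).map t, (quasiIso_map_iff t).2 ht⟩, ?_⟩
    change (toK R).map f ≫ (toK R).map t = (toK R).map s ≫ (toK R).map g
    rw [← Functor.map_comp, ← Functor.map_comp, toK_map_eq_iff]
    exact h
  ext := by
    rintro ⟨X'⟩ ⟨X⟩ ⟨Y⟩ f₁ f₂ s hs h
    obtain ⟨s, rfl⟩ := (toK R).map_surjective s
    obtain ⟨f₁, rfl⟩ := (toK R).map_surjective f₁
    obtain ⟨f₂, rfl⟩ := (toK R).map_surjective f₂
    have h' : (toK R).map (s ≫ f₁) = (toK R).map (s ≫ f₂) := by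
      rw [Functor.map_comp, Functor.map_comp]; exact h
    rw [toK_map_eq_iff, ← Preadditive.comp_sub] at h'
    obtain ⟨Y', t, ht, h⟩ := exists_cancel_aux s (f₁ - f₂) ((quasiIso_map_iff s).1 hs) h'
    refine ⟨(toK R).obj Y', (toK R).map t, (quasiIso_map_iff t).2 ht, ?_⟩
    rw [Preadditive.sub_comp, ← toK_map_eq_iff, Functor.map_comp, Functor.map_comp] at h
    exact h

/-- The derived category `D(R)`: the localization of `K(R)` at the quasi-isomorphisms. Its
`k`-linear structure is the one for which the localization functor is `k`-linear. -/
abbrev DerivedCat (R : DGAlgebra.{v} k) := (quasiIso.{w} R).Localization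

/-- The localization functor `K(R) ⥤ D(R)`. -/
noncomputable abbrev toD (R : DGAlgebra.{v} k) : HomotopyCat.{w} R ⥤ DerivedCat.{w} R := (quasiIso.{w} R).Q

/-- The canonical functor from DG modules to the derived category. -/
noncomputable abbrev ofModule (R : DGAlgebra.{v} k) : DGModule.{w} R ⥤ DerivedCat.{w} R := toK R ⋙ toD R

/-- The suspension functor `Σⁿ` on the homotopy category. -/
noncomputable def shiftK (R : DGAlgebra.{v} k) (n : ℤ) : HomotopyCat.{w} R ⥤ HomotopyCat.{w} R :=
  CategoryTheory.Quotient.lift _ (shiftFunctor R n ⋙ toK R) fun M N f g h => by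
    change (toK R).map (shiftMap n f) = (toK R).map (shiftMap n g)
    rw [toK_map_eq_iff]
    have e : shiftMap n f - shiftMap n g = shiftMap n (f - g) := by
      rw [sub_eq_iff_eq_add]
      refine hom_ext fun m => ?_
      obtain ⟨m, rfl⟩ := (toShift n M).surjective m
      rw [lin_add, lin_shiftMap, lin_shiftMap, lin_shiftMap, ← map_add, ← lin_add, sub_add_cancel]
    rw [e]
    exact NullHomotopic.shiftMap n h

theorem shiftMap_bijective (n : ℤ) {M N : DGModule.{w} R} (f : M ⟶ N)
    (hf : Function.Bijective (cohomologyMap f)) :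
    Function.Bijective (cohomologyMap (shiftMap n f)) := by
  have hd : ∀ (M : DGModule.{w} R) (m : M.carrier),
      (shift n M).d (toShift n M m) = toShift n M (n.negOnePow • M.d m) := fun M m => by
    rw [shift_d, Units.smul_def, Units.smul_def, map_zsmul]
  have h2 : ∀ (M : DGModule.{w} R) (m x : M.carrier),
      m = n.negOnePow • M.d x → m = M.d (n.negOnePow • x) := fun M m x h => by
    rw [h, Units.smul_def, Units.smul_def, map_zsmul]
  have h3 : ∀ (M : DGModule.{w} R) (m x : M.carrier),
      m = M.d x → m = n.negOnePow • M.d (n.negOnePow • x) := fun M m x h => by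
    rw [← h2 M _ _ rfl, smul_smul, Int.units_mul_self, one_smul, h]
  have h4 : ∀ (M : DGModule.{w} R) (m : M.carrier),
      (shift n M).d (toShift n M m) = 0 ↔ M.d m = 0 := fun M m => by
    rw [hd, LinearEquiv.map_eq_zero_iff]
    exact smul_eq_zero_iff_eq _
  rw [cohomologyMap_bijective_iff] at hf ⊢
  obtain ⟨hi, hs⟩ := hf
  constructor
  · intro m hm y h
    obtain ⟨m, rfl⟩ := (toShift n M).surjective m
    obtain ⟨y, rfl⟩ := (toShift n N).surjective y
    rw [lin_shiftMap, hd] at h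
    obtain ⟨x, hx⟩ := hi m ((h4 M m).1 hm) _ (h2 N _ _ ((toShift n N).injective h))
    exact ⟨toShift n M (n.negOnePow • x), by rw [hd, ← h3 M m x hx]⟩
  · intro y hy
    obtain ⟨y, rfl⟩ := (toShift n N).surjective y
    obtain ⟨m, hm, x, hx⟩ := hs y ((h4 N y).1 hy)
    refine ⟨toShift n M m, (h4 M m).2 hm, toShift n N (n.negOnePow • x), ?_⟩
    rw [hd, ← h3 N _ x rfl, lin_shiftMap, ← map_add, ← hx]

theorem shiftK_inverts (R : DGAlgebra.{v} k) (n : ℤ) :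
    (quasiIso.{w} R).IsInvertedBy (shiftK R n ⋙ toD R) := by
  rintro ⟨M⟩ ⟨N⟩ f hf
  obtain ⟨f, rfl⟩ := (toK R).map_surjective f
  exact Localization.inverts (toD R) (quasiIso R) ((toK R).map (shiftMap n f))
    ((quasiIso_map_iff _).2 (shiftMap_bijective n f ((quasiIso_map_iff f).1 hf)))

/-- The suspension functor `Σⁿ` on the derived category. -/
noncomputable def shiftD (R : DGAlgebra.{v} k) (n : ℤ) : DerivedCat.{w} R ⥤ DerivedCat.{w} R :=
  Localization.lift (shiftK R n ⋙ toD R) (shiftK_inverts R n) (toD R)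

/-- The suspension of the derived category extends that of DG modules. -/
noncomputable def shiftDIso (n : ℤ) (M : DGModule.{w} R) :
    (shiftD R n).obj ((ofModule R).obj M) ≅ (ofModule R).obj (shift n M) :=
  (Localization.fac (shiftK R n ⋙ toD R) (shiftK_inverts R n) (toD R)).app ((toK R).obj M)

/-- A triangle `X ⟶ Y ⟶ Z ⟶ ΣX` of the derived category is distinguished if it is isomorphic to
the triangle `M ⟶ N ⟶ cone φ ⟶ ΣM` of a morphism `φ` of DG modules. -/
def IsDistinguished {X Y Z : DerivedCat.{w} R} (f : X ⟶ Y) (g : Y ⟶ Z)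
    (h : Z ⟶ (shiftD R 1).obj X) : Prop :=
  ∃ (M N : DGModule.{w} R) (φ : M ⟶ N) (a : (ofModule R).obj M ≅ X) (b : (ofModule R).obj N ≅ Y)
    (c : (ofModule R).obj (cone φ) ≅ Z),
    (ofModule R).map φ ≫ b.hom = a.hom ≫ f ∧
    (ofModule R).map (coneInl φ) ≫ c.hom = b.hom ≫ g ∧
    (ofModule R).map (coneSnd φ) ≫ (shiftDIso 1 M).inv ≫ (shiftD R 1).map a.hom = c.hom ≫ h

/-- The objects of `D(R)` finitely built from `G` using distinguished triangles,
(de)suspensions, finite coproducts and direct summands. (Isomorphic objects and zero objects are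
covered by direct summands; the other two objects of a distinguished triangle are covered by
rotating the triangle.) -/
inductive FinitelyBuilt (G : DerivedCat.{w} R) : DerivedCat.{w} R → Prop
  | base : FinitelyBuilt G G
  | shift (n : ℤ) {X : DerivedCat.{w} R} (hX : FinitelyBuilt G X) :
      FinitelyBuilt G ((shiftD R n).obj X)
  | coprod {X Y Z : DerivedCat.{w} R} (i : X ⟶ Z) (j : Y ⟶ Z)
      (hZ : Nonempty (IsColimit (BinaryCofan.mk i j))) (hX : FinitelyBuilt G X)
      (hY : FinitelyBuilt G Y) : FinitelyBuilt G Z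
  | summand {X Y : DerivedCat.{w} R} (r : Retract X Y) (hY : FinitelyBuilt G Y) :
      FinitelyBuilt G X
  | triangle {X Y Z : DerivedCat.{w} R} (f : X ⟶ Y) (g : Y ⟶ Z) (h : Z ⟶ (shiftD R 1).obj X)
      (hfgh : IsDistinguished f g h) (hX : FinitelyBuilt G X) (hY : FinitelyBuilt G Y) :
      FinitelyBuilt G Z

/-- The objects of `D(R)` whose cohomology is finitely generated over `k` (for a field `k`: whose
total cohomology is finite dimensional). -/
def isFinite (R : DGAlgebra.{v} k) : ObjectProperty (DerivedCat.{w} R) := fun X =>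
  ∃ M : DGModule.{w} R, Module.Finite k M.cohomology ∧ Nonempty ((ofModule R).obj M ≅ X)

/-- The objects of `D(R)` finitely built from `R`. -/
def isCompact (R : DGAlgebra.{v} k) : ObjectProperty (DerivedCat.{v} R) :=
  FinitelyBuilt ((ofModule R).obj (regular R))

/-- The full subcategory `Dᶠ(R)` of `D(R)`. -/
abbrev Df (R : DGAlgebra.{v} k) := (isFinite.{v} R).FullSubcategory

/-- The full subcategory `Dᶜ(R)` of `D(R)`. -/
abbrev Dc (R : DGAlgebra.{v} k) := (isCompact R).FullSubcategory

end DGModule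

/-! ### Krull-Schmidt categories -/

section KrullSchmidt

variable {C : Type u} [Category.{v} C] [Preadditive C]

/-- `X` is indecomposable: nonzero, and whenever it is the direct sum of two objects, one of them
is zero. -/
def IsIndecomposableObj (X : C) : Prop :=
  ¬ IsZero X ∧ ∀ (Y Z : C) (b : BinaryBicone Y Z), Nonempty b.IsBilimit → Nonempty (b.pt ≅ X) →
    IsZero Y ∨ IsZero Z

/-- `X` is the direct sum of the finite family `Y`. -/
def IsDirectSumOf {n : ℕ} (X : C) (Y : Fin n → C) : Prop :=
  ∃ b : Bicone Y, Nonempty b.IsBilimit ∧ Nonempty (b.pt ≅ X)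

variable (C) in
/-- An additive category is Krull-Schmidt if indecomposable objects have local endomorphism rings
and each object is a finite direct sum of indecomposable objects, which are unique up to
isomorphism (and order). -/
structure IsKrullSchmidt : Prop where
  hasFiniteBiproducts : HasFiniteBiproducts C
  isLocalRing_end : ∀ X : C, IsIndecomposableObj X → IsLocalRing (End X)
  exists_decomposition : ∀ X : C, ∃ (n : ℕ) (Y : Fin n → C),
    (∀ i, IsIndecomposableObj (Y i)) ∧ IsDirectSumOf X Y
  unique_decomposition : ∀ (X : C) (n m : ℕ) (Y : Fin n → C) (Z : Fin m → C),
    (∀ i, IsIndecomposableObj (Y i)) → IsDirectSumOf X Y →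
    (∀ i, IsIndecomposableObj (Z i)) → IsDirectSumOf X Z →
    ∃ σ : Fin n ≃ Fin m, ∀ i, Nonempty (Y i ≅ Z (σ i))

end KrullSchmidt

/-!
The theorem is reduced to two facts about DG modules `M` and `N` with finite dimensional cohomology:
`Hom(M, N)` in the derived category is finite dimensional (`DGModule.finite_hom`), and idempotent
endomorphisms of `M` split (`DGModule.exists_splitting`). Both categories consist of such modules,
since the class of objects with finite dimensional cohomology contains `R` and is closed under the
operations defining `Dᶜ(R)` (`DGModule.isFinite_of_isCompact`). A linear category with finite
biproducts, finite dimensional morphism spaces and split idempotents is Krull-Schmidt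
(`isKrullSchmidt_of_finite`): an indecomposable object has an endomorphism algebra without
nontrivial idempotents, which is local by Fitting's lemma.

For the two facts, no semi-free resolution of `M` is needed, but only approximations of it. As
`Rⁱ = 0` for `i < 0`, `R⁰ = k` and `R¹ = 0`, attaching a cell `Σⁿ R` to kill a class of lowest
degree in the cohomology of the cone of `P ⟶ M` creates no new classes in this or lower degrees
(`DGModule.exists_attach`). So for each `c` there is a finite dimensional `P`, made of cells with
generators in degrees `< c`, with a morphism to `M` inducing isomorphisms on cohomology in degrees
`< c` and an injection in degree `c` (`DGModule.exists_approximation`). On the other hand, the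
hypotheses on `R` allow DG modules to be truncated (`DGModule.exists_truncSub`), so that an object
with cohomology in degrees `≥ c` has no nonzero morphisms to one with cohomology in degrees `< c`
(`DGModule.eq_zero_of_isAcyclic`). Hence, if the cohomology of `N` lives in degrees `≤ b`, then
`Hom(M, N) ⟶ Hom(P, N)` is injective for `c > b` (`DGModule.IsTruncEquiv.precomp_injective`) and
bijective for `c ≥ b + 2` (`DGModule.IsTruncEquiv.exists_precomp_eq`).

Since morphisms out of `P` in the derived category come from morphisms of DG modules, which lift to
an approximation `P'` of `N`, the first fact follows: the morphisms `P ⟶ P'` of DG modules form a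
finite dimensional space. For the second one, an idempotent `e` of `M` lifts to an endomorphism of
`P`, and so do its powers, one of which is the projection to a direct summand `I` of `P` followed by
an automorphism of `I`, by Fitting's lemma. As `M` has no cohomology just above degree `b`, neither
has `I`, and the truncation of `I` in degrees `≤ b` splits `e`.
-/

namespace DGModule

variable {k : Type u} [CommRing k] {R : DGAlgebra.{v} k}

/-! ### Homogeneous components -/

/-- The projection of a DG module onto its homogeneous component of degree `i`, as an
endomorphism of the total module. -/
noncomputable def proj (M : DGModule.{w} R) (i : ℤ) : M.carrier →ₗ[k] M.carrier :=
  M.isInternal.exists_proj.choose i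

theorem proj_of_mem (M : DGModule.{w} R) {i : ℤ} {m : M.carrier} (hm : m ∈ M.grading i) :
    M.proj i m = m := M.isInternal.exists_proj.choose_spec.1 i m hm

theorem proj_of_mem_ne (M : DGModule.{w} R) {i j : ℤ} (h : j ≠ i) {m : M.carrier}
    (hm : m ∈ M.grading j) : M.proj i m = 0 :=
  M.isInternal.exists_proj.choose_spec.2 i j h m hm

theorem proj_mem (M : DGModule.{w} R) (i : ℤ) (m : M.carrier) : M.proj i m ∈ M.grading i := by
  induction m using M.isInternal.induction with
  | h0 => simp
  | hadd x y hx hy => rw [map_add]; exact Submodule.add_mem _ hx hy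
  | hom j x hx =>
    by_cases h : j = i
    · subst h; rwa [proj_of_mem M hx]
    · rw [proj_of_mem_ne M h hx]; exact Submodule.zero_mem _

theorem proj_d (M : DGModule.{w} R) (i : ℤ) (m : M.carrier) :
    M.proj (i + 1) (M.d m) = M.d (M.proj i m) := by
  induction m using M.isInternal.induction with
  | h0 => simp
  | hadd x y hx hy => simp only [map_add, hx, hy]
  | hom j x hx =>
    by_cases h : j = i
    · subst h; rw [proj_of_mem M hx, proj_of_mem M (M.d_mem hx)]
    · rw [proj_of_mem_ne M h hx, proj_of_mem_ne M (by simpa using h) (M.d_mem hx), map_zero]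

theorem proj_d' (M : DGModule.{w} R) (i : ℤ) (m : M.carrier) :
    M.proj i (M.d m) = M.d (M.proj (i - 1) m) := by
  have := proj_d M (i - 1) m
  rwa [sub_add_cancel] at this

theorem lin_proj {M N : DGModule.{w} R} (f : M ⟶ N) (i : ℤ) (m : M.carrier) :
    lin f (M.proj i m) = N.proj i (lin f m) := by
  induction m using M.isInternal.induction with
  | h0 => simp
  | hadd x y hx hy => simp only [map_add, hx, hy]
  | hom j x hx =>
    by_cases h : j = i
    · subst h; rw [proj_of_mem M hx, proj_of_mem N (map_mem f hx)]
    · rw [proj_of_mem_ne M h hx, proj_of_mem_ne N h (map_mem f hx), map_zero]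

theorem exists_finset_proj (M : DGModule.{w} R) (m : M.carrier) :
    ∃ s : Finset ℤ, m = ∑ i ∈ s, M.proj i m ∧ ∀ i ∉ s, M.proj i m = 0 := by
  classical
  induction m using M.isInternal.induction with
  | h0 => exact ⟨∅, by simp, by simp⟩
  | hadd x y hx hy =>
    obtain ⟨s, hs, hs'⟩ := hx
    obtain ⟨t, ht, ht'⟩ := hy
    refine ⟨s ∪ t, ?_, fun i hi => ?_⟩
    · simp only [map_add, Finset.sum_add_distrib]
      congr 1
      · rw [← Finset.sum_subset Finset.subset_union_left (fun i _ hi => hs' i hi)]; exact hs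
      · rw [← Finset.sum_subset Finset.subset_union_right (fun i _ hi => ht' i hi)]; exact ht
    · rw [Finset.notMem_union] at hi
      rw [map_add, hs' i hi.1, ht' i hi.2, add_zero]
  | hom j x hx =>
    refine ⟨{j}, by simp [proj_of_mem M hx], fun i hi => proj_of_mem_ne M ?_ hx⟩
    rintro rfl
    simp at hi

/-- Membership in a submodule, not necessarily graded, can be checked on homogeneous components. -/
theorem mem_of_proj_mem (M : DGModule.{w} R) (S : Submodule k M.carrier) {m : M.carrier}
    (h : ∀ i, M.proj i m ∈ S) : m ∈ S := by
  obtain ⟨s, hs, -⟩ := M.exists_finset_proj m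
  rw [hs]
  exact Submodule.sum_mem _ fun i _ => h i

theorem exists_boundary_mem (M : DGModule.{w} R) {i : ℤ} {x y : M.carrier}
    (hx : x ∈ M.grading (i + 1)) (h : x = M.d y) : ∃ y' ∈ M.grading i, x = M.d y' :=
  ⟨M.proj i y, M.proj_mem i y, by rw [← proj_d, ← h, proj_of_mem M hx]⟩

theorem mem_grading_congr {M : DGModule.{w} R} {i j : ℤ} {x : M.carrier}
    (hx : x ∈ M.grading i) (h : i = j) : x ∈ M.grading j := h ▸ hx

theorem exists_boundary_mem' (M : DGModule.{w} R) {i : ℤ} {x y : M.carrier}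
    (hx : x ∈ M.grading i) (h : x = M.d y) : ∃ y' ∈ M.grading (i - 1), x = M.d y' :=
  M.exists_boundary_mem (mem_grading_congr hx (by ring)) h

/-! ### Graded DG submodules -/

/-- A DG submodule of `M`, given by its homogeneous components. -/
structure GradedSub (M : DGModule.{w} R) where
  /-- the homogeneous component of each degree -/
  component : ℤ → Submodule k M.carrier
  le : ∀ i, component i ≤ M.grading i
  smul_mem : ∀ {i j : ℤ} {a : R.carrier} {m : M.carrier},
    a ∈ R.grading i → m ∈ component j → a • m ∈ component (i + j)
  d_mem : ∀ {i : ℤ} {m : M.carrier}, m ∈ component i → M.d m ∈ component (i + 1)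

namespace GradedSub

variable {M : DGModule.{w} R} (S : GradedSub M)

theorem d_mem_iSup {m : M.carrier} (hm : m ∈ iSup S.component) : M.d m ∈ iSup S.component := by
  induction hm using Submodule.iSup_induction' with
  | mem i x hx => exact Submodule.mem_iSup_of_mem (i + 1) (S.d_mem hx)
  | zero => rw [map_zero]; exact Submodule.zero_mem _
  | add x y _ _ hx hy => rw [map_add]; exact Submodule.add_mem _ hx hy

theorem smul_mem_iSup (a : R.carrier) {m : M.carrier} (hm : m ∈ iSup S.component) :
    a • m ∈ iSup S.component := by
  induction hm using Submodule.iSup_induction' with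
  | mem j x hx =>
    induction a using R.isInternal.induction with
    | h0 => rw [zero_smul]; exact Submodule.zero_mem _
    | hadd a b ha hb => rw [add_smul]; exact Submodule.add_mem _ ha hb
    | hom i a ha => exact Submodule.mem_iSup_of_mem (i + j) (S.smul_mem ha hx)
  | zero => rw [smul_zero]; exact Submodule.zero_mem _
  | add x y _ _ hx hy => rw [smul_add]; exact Submodule.add_mem _ hx hy

theorem proj_mem_component (i : ℤ) {m : M.carrier} (hm : m ∈ iSup S.component) :
    M.proj i m ∈ S.component i := by
  induction hm using Submodule.iSup_induction' with
  | mem j x hx =>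
    by_cases h : j = i
    · subst h; rwa [proj_of_mem M (S.le _ hx)]
    · rw [proj_of_mem_ne M h (S.le _ hx)]; exact Submodule.zero_mem _
  | zero => rw [map_zero]; exact Submodule.zero_mem _
  | add x y _ _ hx hy => rw [map_add]; exact Submodule.add_mem _ hx hy

/-- The underlying `R`-submodule. -/
def submodule : Submodule R.carrier M.carrier where
  carrier := {m | m ∈ iSup S.component}
  add_mem' hx hy := (iSup S.component).add_mem hx hy
  zero_mem' := (iSup S.component).zero_mem
  smul_mem' a _ hm := S.smul_mem_iSup a hm

/-- A DG submodule as a DG module. -/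
noncomputable def toDGModule : DGModule.{w} R where
  carrier := S.submodule
  grading i := (S.component i).comap (S.submodule.subtype.restrictScalars k)
  isInternal := by
    refine isInternal_of_proj
      (fun i => ((M.proj i).comp (S.submodule.subtype.restrictScalars k)).codRestrict
        (S.submodule.restrictScalars k)
        fun x => Submodule.mem_iSup_of_mem (p := S.component) i (S.proj_mem_component i x.2))
      (fun i m hm => Subtype.ext (proj_of_mem M (S.le i hm)))
      (fun i j hij m hm => Subtype.ext (proj_of_mem_ne M hij (S.le j hm))) ?_
    rw [eq_top_iff]
    rintro ⟨x, hx⟩ -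
    have hx' : x ∈ iSup S.component := hx
    induction hx' using Submodule.iSup_induction' with
    | mem i x h =>
      exact Submodule.mem_iSup_of_mem
        (p := fun i => (S.component i).comap (S.submodule.subtype.restrictScalars k)) i h
    | zero => exact Submodule.zero_mem _
    | add x y h1 h2 h3 h4 => exact Submodule.add_mem _ (h3 h1) (h4 h2)
  smul_mem ha hm := S.smul_mem ha hm
  d := (M.d.comp (S.submodule.subtype.restrictScalars k)).codRestrict
    (S.submodule.restrictScalars k) fun x => S.d_mem_iSup x.2
  d_mem hm := S.d_mem hm
  d_d m := Subtype.ext (M.d_d _)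
  leibniz ha m := Subtype.ext (M.leibniz ha _)

/-- The inclusion of a DG submodule. -/
noncomputable def incl : S.toDGModule ⟶ M where
  toLin := S.submodule.subtype
  map_mem hm := S.le _ hm
  map_d _ := rfl

theorem incl_injective : Function.Injective (lin S.incl) := Subtype.val_injective

theorem exists_incl_eq {i : ℤ} {m : M.carrier} (hm : m ∈ S.component i) :
    ∃ x ∈ S.toDGModule.grading i, lin S.incl x = m :=
  ⟨⟨m, Submodule.mem_iSup_of_mem (p := S.component) i hm⟩, hm, rfl⟩

/-- A morphism with values in a DG submodule factors through it. -/
theorem exists_lift {T : DGModule.{w} R} (f : T ⟶ M)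
    (hf : ∀ i, ∀ x ∈ T.grading i, lin f x ∈ S.component i) :
    ∃ g : T ⟶ S.toDGModule, g ≫ S.incl = f := by
  have h : ∀ x, lin f x ∈ S.submodule := by
    intro x
    induction x using T.isInternal.induction with
    | h0 => rw [map_zero]; exact Submodule.zero_mem _
    | hadd x y hx hy => rw [map_add]; exact Submodule.add_mem _ hx hy
    | hom i x hx => exact Submodule.mem_iSup_of_mem (p := S.component) i (hf i x hx)
  exact ⟨⟨(lin f).codRestrict S.submodule h, fun hm => hf _ _ hm,
    fun m => Subtype.ext (map_d f m)⟩, rfl⟩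

/-- The image of a morphism of DG modules. -/
noncomputable def image {M N : DGModule.{w} R} (f : M ⟶ N) : GradedSub N where
  component i := (M.grading i).map ((lin f).restrictScalars k)
  le i := by
    rintro _ ⟨m, hm, rfl⟩
    exact map_mem f hm
  smul_mem := by
    rintro i j a _ ha ⟨m, hm, rfl⟩
    exact ⟨a • m, M.smul_mem ha hm, map_smul (lin f) a m⟩
  d_mem := by
    rintro i _ ⟨m, hm, rfl⟩
    exact ⟨M.d m, M.d_mem hm, map_d f m⟩

theorem exists_image_fac {M N : DGModule.{w} R} (f : M ⟶ N) :
    ∃ (I : DGModule.{w} R) (p : M ⟶ I) (i : I ⟶ N), p ≫ i = f ∧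
      Function.Surjective (lin p) ∧ Function.Injective (lin i) := by
  obtain ⟨p, hp⟩ := (image f).exists_lift f fun i x hx => ⟨x, hx, rfl⟩
  refine ⟨_, p, (image f).incl, hp, fun y => ?_, (image f).incl_injective⟩
  suffices ∃ x, lin f x = lin (image f).incl y by
    obtain ⟨x, hx⟩ := this
    refine ⟨x, (image f).incl_injective ?_⟩
    rw [← hx, ← lin_comp, hp]
  change lin (image f).incl y ∈ LinearMap.range ((lin f).restrictScalars k)
  have : iSup (image f).component ≤ LinearMap.range ((lin f).restrictScalars k) :=
    iSup_le fun i => by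
      rintro _ ⟨m, -, rfl⟩
      exact ⟨m, rfl⟩
  exact this y.2

/-- For a non-negatively graded `R` with `R⁰ = k`: the DG submodule which is `M` in degrees `> n`,
a given subspace `V` in degree `n`, and zero in degrees `< n`. -/
noncomputable def trunc (hneg : ∀ i : ℤ, i < 0 → R.grading i = ⊥)
    (hzero : ∀ a : R.carrier, a ∈ R.grading 0 → ∃ c : k, algebraMap k R.carrier c = a)
    (M : DGModule.{w} R) (n : ℤ) (V : Submodule k M.carrier) : GradedSub M where
  component i :=
    { carrier := {x | x ∈ M.grading i ∧ (i < n → x = 0) ∧ (i = n → x ∈ V)}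
      add_mem' := fun {x y} hx hy => ⟨Submodule.add_mem _ hx.1 hy.1,
        fun h => by rw [hx.2.1 h, hy.2.1 h, add_zero],
        fun h => Submodule.add_mem _ (hx.2.2 h) (hy.2.2 h)⟩
      zero_mem' := ⟨Submodule.zero_mem _, fun _ => rfl, fun _ => Submodule.zero_mem _⟩
      smul_mem' := fun c x hx => ⟨Submodule.smul_mem _ c hx.1,
        fun h => by rw [hx.2.1 h, smul_zero], fun h => Submodule.smul_mem _ c (hx.2.2 h)⟩ }
  le _ _ hx := hx.1
  smul_mem := by
    rintro i j a m ha ⟨h1, h2, h3⟩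
    have h0 : i < 0 → a • m = 0 := fun h => by
      rw [hneg i h, Submodule.mem_bot] at ha
      rw [ha, zero_smul]
    refine ⟨M.smul_mem ha h1, fun h => ?_, fun h => ?_⟩
    · rcases lt_or_ge i 0 with hi | hi
      · exact h0 hi
      · rw [h2 (by omega), smul_zero]
    · rcases lt_trichotomy i 0 with hi | rfl | hi
      · rw [h0 hi]; exact Submodule.zero_mem _
      · obtain ⟨c, rfl⟩ := hzero a ha
        rw [algebraMap_smul]
        exact Submodule.smul_mem _ c (h3 (by omega))
      · rw [h2 (by omega), smul_zero]; exact Submodule.zero_mem _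
  d_mem := by
    rintro i m ⟨h1, h2, h3⟩
    refine ⟨M.d_mem h1, fun h => ?_, fun h => ?_⟩
    · rw [h2 (by omega), map_zero]
    · rw [h2 (by omega), map_zero]; exact Submodule.zero_mem _

end GradedSub

/-! ### Cohomology in a range of degrees -/

/-- The cohomology of `M` vanishes in degree `i`. -/
def IsAcyclicAt (M : DGModule.{w} R) (i : ℤ) : Prop :=
  ∀ x ∈ M.grading i, M.d x = 0 → ∃ y, x = M.d y

/-- The cohomology of `M` vanishes in degrees `< c`. -/
def IsAcyclicBelow (M : DGModule.{w} R) (c : ℤ) : Prop := ∀ i < c, M.IsAcyclicAt i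

/-- The cohomology of `M` vanishes in degrees `> b`. -/
def IsAcyclicAbove (M : DGModule.{w} R) (b : ℤ) : Prop := ∀ i, b < i → M.IsAcyclicAt i

theorem IsAcyclicBelow.mono {M : DGModule.{w} R} {c c' : ℤ} (h : M.IsAcyclicBelow c)
    (hc : c' ≤ c) : M.IsAcyclicBelow c' := fun i hi => h i (lt_of_lt_of_le hi hc)

/-- The map induced by `f` on cohomology is injective in degree `i`. -/
def InjAt {M N : DGModule.{w} R} (f : M ⟶ N) (i : ℤ) : Prop :=
  ∀ x ∈ M.grading i, M.d x = 0 → ∀ y, lin f x = N.d y → ∃ z, x = M.d z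

/-- The map induced by `f` on cohomology is surjective in degree `i`. -/
def SurjAt {M N : DGModule.{w} R} (f : M ⟶ N) (i : ℤ) : Prop :=
  ∀ y ∈ N.grading i, N.d y = 0 → ∃ x ∈ M.grading i, M.d x = 0 ∧ ∃ z, y = lin f x + N.d z

theorem InjAt.comp {M N P : DGModule.{w} R} {f : M ⟶ N} {g : N ⟶ P} {i : ℤ} (hf : InjAt f i)
    (hg : InjAt g i) : InjAt (f ≫ g) i := by
  intro x hx hdx y hy
  obtain ⟨z, hz⟩ := hg (lin f x) (map_mem f hx) (by rw [← map_d, hdx, map_zero]) y hy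
  exact hf x hx hdx z hz

theorem SurjAt.comp {M N P : DGModule.{w} R} {f : M ⟶ N} {g : N ⟶ P} {i : ℤ} (hf : SurjAt f i)
    (hg : SurjAt g i) : SurjAt (f ≫ g) i := by
  intro x hx hdx
  obtain ⟨y, hy, hdy, z, rfl⟩ := hg x hx hdx
  obtain ⟨m, hm, hdm, w, rfl⟩ := hf y hy hdy
  refine ⟨m, hm, hdm, lin g w + z, ?_⟩
  rw [lin_comp, map_add, map_add, map_d, add_assoc]

theorem IsAcyclicAt.injAt {M N : DGModule.{w} R} {i : ℤ} (h : M.IsAcyclicAt i) (f : M ⟶ N) :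
    InjAt f i := fun x hx hdx _ _ => h x hx hdx

theorem IsAcyclicAt.surjAt {M N : DGModule.{w} R} {i : ℤ} (h : N.IsAcyclicAt i) (f : M ⟶ N) :
    SurjAt f i := fun x hx hdx => by
  obtain ⟨y, rfl⟩ := h x hx hdx
  exact ⟨0, Submodule.zero_mem _, map_zero _, y, by rw [map_zero, zero_add]⟩

theorem IsAcyclicAt.of_surjAt {M N : DGModule.{w} R} {i : ℤ} {f : M ⟶ N} (h : M.IsAcyclicAt i)
    (hf : SurjAt f i) : N.IsAcyclicAt i := fun y hy hdy => by
  obtain ⟨x, hx, hdx, z, rfl⟩ := hf y hy hdy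
  obtain ⟨w, rfl⟩ := h x hx hdx
  exact ⟨lin f w + z, by rw [map_add, map_d]⟩

theorem IsAcyclicAt.of_injAt {M N : DGModule.{w} R} {i : ℤ} {f : M ⟶ N} (h : N.IsAcyclicAt i)
    (hf : InjAt f i) : M.IsAcyclicAt i := fun x hx hdx => by
  obtain ⟨y, hy⟩ := h (lin f x) (map_mem f hx) (by rw [← map_d, hdx, map_zero])
  exact hf x hx hdx y hy

/-- A DG module is acyclic as soon as its homogeneous cocycles are coboundaries. -/
theorem acyclic_of_forall_isAcyclicAt {M : DGModule.{w} R} (h : ∀ i, M.IsAcyclicAt i)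
    (m : M.carrier) (hm : M.d m = 0) : ∃ x, m = M.d x := by
  have : m ∈ LinearMap.range M.d := M.mem_of_proj_mem _ fun i => by
    obtain ⟨y, hy⟩ := h i _ (M.proj_mem i m) (by rw [← proj_d, hm, map_zero])
    exact ⟨y, hy.symm⟩
  obtain ⟨x, hx⟩ := this
  exact ⟨x, hx.symm⟩

theorem bijective_of_injAt_surjAt {M N : DGModule.{w} R} {f : M ⟶ N} (hi : ∀ i, InjAt f i)
    (hs : ∀ i, SurjAt f i) : Function.Bijective (cohomologyMap f) := by
  rw [cohomologyMap_bijective_iff]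
  constructor
  · intro m hm n hn
    have : m ∈ LinearMap.range M.d := M.mem_of_proj_mem _ fun i => by
      obtain ⟨y, hy⟩ := hi i _ (M.proj_mem i m) (by rw [← proj_d, hm, map_zero])
        (N.proj (i - 1) n) (by rw [lin_proj, hn, proj_d'])
      exact ⟨y, hy.symm⟩
    obtain ⟨x, hx⟩ := this
    exact ⟨x, hx.symm⟩
  · intro n hn
    have : n ∈ (LinearMap.ker M.d).map ((lin f).restrictScalars k) ⊔ LinearMap.range N.d :=
      N.mem_of_proj_mem _ fun i => by
        obtain ⟨x, -, hdx, z, hz⟩ := hs i _ (N.proj_mem i n) (by rw [← proj_d, hn, map_zero])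
        exact Submodule.mem_sup.2 ⟨_, ⟨x, hdx, rfl⟩, _, ⟨z, rfl⟩, hz.symm⟩
    obtain ⟨_, ⟨x, hx, rfl⟩, _, ⟨z, rfl⟩, h⟩ := Submodule.mem_sup.1 this
    exact ⟨x, hx, z, h.symm⟩

theorem injAt_of_bijective {M N : DGModule.{w} R} {f : M ⟶ N}
    (hf : Function.Bijective (cohomologyMap f)) (i : ℤ) : InjAt f i := fun x _ hdx y hy =>
  ((cohomologyMap_bijective_iff f).1 hf).1 x hdx y hy

theorem surjAt_of_bijective {M N : DGModule.{w} R} {f : M ⟶ N}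
    (hf : Function.Bijective (cohomologyMap f)) (i : ℤ) : SurjAt f i := fun y hy hdy => by
  obtain ⟨x, hdx, z, hz⟩ := ((cohomologyMap_bijective_iff f).1 hf).2 y hdy
  refine ⟨M.proj i x, M.proj_mem i x, by rw [← proj_d, hdx, map_zero], N.proj (i - 1) z, ?_⟩
  rw [lin_proj, ← proj_d', ← map_add, ← hz, proj_of_mem N hy]

/-- `f` induces isomorphisms on cohomology in degrees `< c` and an injection in degree `c`;
equivalently, the mapping cone of `f` has no cohomology in degrees `< c`. -/
structure IsTruncEquiv {M N : DGModule.{w} R} (f : M ⟶ N) (c : ℤ) : Prop where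
  injAt : ∀ i ≤ c, InjAt f i
  surjAt : ∀ i < c, SurjAt f i

theorem IsTruncEquiv.mono {M N : DGModule.{w} R} {f : M ⟶ N} {c c' : ℤ} (h : IsTruncEquiv f c)
    (hc : c' ≤ c) : IsTruncEquiv f c' :=
  ⟨fun i hi => h.injAt i (hi.trans hc), fun i hi => h.surjAt i (hi.trans_le hc)⟩

theorem IsTruncEquiv.comp {M N P : DGModule.{w} R} {f : M ⟶ N} {g : N ⟶ P} {c : ℤ}
    (hf : IsTruncEquiv f c) (hg : IsTruncEquiv g c) : IsTruncEquiv (f ≫ g) c :=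
  ⟨fun i hi => (hf.injAt i hi).comp (hg.injAt i hi),
    fun i hi => (hf.surjAt i hi).comp (hg.surjAt i hi)⟩

theorem IsTruncEquiv.of_bijective {M N : DGModule.{w} R} {f : M ⟶ N}
    (hf : Function.Bijective (cohomologyMap f)) (c : ℤ) : IsTruncEquiv f c :=
  ⟨fun i _ => injAt_of_bijective hf i, fun i _ => surjAt_of_bijective hf i⟩

theorem IsTruncEquiv.bijective {M N : DGModule.{w} R} {f : M ⟶ N} {c b : ℤ}
    (h : IsTruncEquiv f c) (hM : M.IsAcyclicAbove b) (hN : N.IsAcyclicAbove b) (hbc : b < c) :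
    Function.Bijective (cohomologyMap f) :=
  bijective_of_injAt_surjAt
    (fun i => (le_or_gt i b).elim (fun hi => h.injAt i (by omega)) fun hi => (hM i hi).injAt f)
    (fun i => (le_or_gt i b).elim (fun hi => h.surjAt i (by omega)) fun hi => (hN i hi).surjAt f)

theorem IsTruncEquiv.isAcyclicBelow_cone {M N : DGModule.{w} R} {f : M ⟶ N} {c : ℤ}
    (h : IsTruncEquiv f c) : (cone f).IsAcyclicBelow c := by
  intro i hi x hx hdx
  obtain ⟨n, m, rfl⟩ := coneMk_surj f x
  rw [coneMk_mem] at hx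
  rw [cone_d, ← coneMk_zero, coneMk_inj] at hdx
  obtain ⟨w, hw, rfl⟩ : ∃ w ∈ M.grading i, m = M.d w := by
    obtain ⟨w, hw⟩ := h.injAt (i + 1) (by omega) m hx.2 (neg_eq_zero.1 hdx.2) (-n)
      (by rw [map_neg, eq_neg_iff_add_eq_zero, add_comm, hdx.1])
    exact M.exists_boundary_mem hx.2 hw
  obtain ⟨z, hz, hdz, x, hx'⟩ := h.surjAt i hi (n + lin f w)
    (Submodule.add_mem _ hx.1 (map_mem f hw)) (by rw [map_add, ← map_d, hdx.1])
  refine ⟨coneMk f x (z - w), ?_⟩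
  rw [cone_d, coneMk_inj]
  constructor
  · rw [map_sub, eq_sub_of_add_eq hx']; abel
  · simp [hdz]

theorem IsTruncEquiv.of_isAcyclicBelow_cone {M N : DGModule.{w} R} {f : M ⟶ N} {c : ℤ}
    (h : (cone f).IsAcyclicBelow c) : IsTruncEquiv f c := by
  constructor
  · intro i hi m hm hdm y hy
    obtain ⟨n, hn, hn'⟩ := N.exists_boundary_mem' (map_mem f hm) hy
    obtain ⟨x, hx⟩ := h (i - 1) (by omega) (coneMk f (-n) m)
      ((coneMk_mem f).2 ⟨Submodule.neg_mem _ hn, mem_grading_congr hm (by ring)⟩)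
      (by rw [cone_d, ← coneMk_zero, coneMk_inj, map_neg, hn', hdm]; simp)
    obtain ⟨x, w, rfl⟩ := coneMk_surj f x
    rw [cone_d, coneMk_inj] at hx
    exact ⟨-w, by rw [map_neg, hx.2]⟩
  · intro i hi n hn hdn
    obtain ⟨x, hx⟩ := h i hi (coneMk f n 0) ⟨hn, Submodule.zero_mem _⟩
      (by rw [cone_d, ← coneMk_zero, coneMk_inj, hdn]; simp)
    obtain ⟨y, hy, hxy⟩ := (cone f).exists_boundary_mem'
      (show coneMk f n 0 ∈ (cone f).grading i from ⟨hn, Submodule.zero_mem _⟩) hx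
    obtain ⟨x, w, rfl⟩ := coneMk_surj f y
    rw [cone_d, coneMk_inj] at hxy
    refine ⟨w, mem_grading_congr hy.2 (by ring), neg_eq_zero.1 hxy.2.symm, x, ?_⟩
    rw [hxy.1, add_comm]

/-- The homotopy pushout of a morphism `s` along any morphism `f`, for `s` inducing isomorphisms on
cohomology in low degrees. -/
theorem IsTruncEquiv.exists_pushout {X X' Y : DGModule.{w} R} (s : X' ⟶ X) (f : X' ⟶ Y)
    {c : ℤ} (hs : IsTruncEquiv s c) :
    ∃ (Y' : DGModule.{w} R) (g : X ⟶ Y') (t : Y ⟶ Y'), IsTruncEquiv t c ∧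
      NullHomotopic (f ≫ t - s ≫ g) := by
  let φ : X' ⟶ prod Y X := prodLift f (-s)
  refine ⟨cone φ, prodInr Y X ≫ coneInl φ, prodInl Y X ≫ coneInl φ, ?_, ?_⟩
  · have hφ : ∀ x, lin φ x = prodMk (lin f x) (-lin s x) := fun _ => rfl
    have hd : ∀ y x, (prod Y X).d (prodMk y x) = prodMk (Y.d y) (X.d x) := fun _ _ => rfl
    have ha : ∀ (y y' : Y.carrier) (x x' : X.carrier),
      prodMk y x + prodMk y' x' = prodMk (y + y') (x + x') := fun _ _ _ _ => rfl
    have hι : ∀ y, lin (prodInl Y X ≫ coneInl φ) y = coneMk φ (prodMk y 0) 0 := fun _ => rfl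
    have h0 : (0 : (prod Y X).carrier) = prodMk 0 0 := rfl
    constructor
    · intro i hi y hy _ e he
      obtain ⟨e', he', h⟩ := (cone φ).exists_boundary_mem' (map_mem _ hy) he
      obtain ⟨z, x', rfl⟩ := coneMk_surj φ e'
      obtain ⟨b, x, rfl⟩ : ∃ b x, z = prodMk b x := ⟨z.1, z.2, rfl⟩
      rw [cone_d, hι, coneMk_inj, hd, hφ, ha, prodMk_inj] at h
      obtain ⟨⟨h1, h2⟩, h3⟩ := h
      obtain ⟨w, rfl⟩ := hs.injAt i hi x' (mem_grading_congr he'.2 (by ring))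
        (neg_eq_zero.1 h3.symm) x
        (by rw [← sub_eq_add_neg] at h2; exact (sub_eq_zero.1 h2.symm).symm)
      exact ⟨b + lin f w, by rw [h1, map_add, map_d]⟩
    · intro i hi e he h
      obtain ⟨z, x', rfl⟩ := coneMk_surj φ e
      obtain ⟨y, x, rfl⟩ : ∃ y x, z = prodMk y x := ⟨z.1, z.2, rfl⟩
      obtain ⟨⟨hy, hx⟩, hx'⟩ := he
      rw [cone_d, ← coneMk_zero, coneMk_inj, hd, hφ, ha, h0, prodMk_inj] at h
      obtain ⟨⟨h1, h2⟩, h3⟩ := h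
      rw [← sub_eq_add_neg, sub_eq_zero] at h2
      obtain ⟨w, hw, rfl⟩ : ∃ w ∈ X'.grading i, x' = X'.d w := by
        obtain ⟨w, hw⟩ := hs.injAt (i + 1) (by omega) x' hx' (neg_eq_zero.1 h3) x h2.symm
        exact X'.exists_boundary_mem hx' hw
      obtain ⟨z, hz, hdz, x'', hx''⟩ := hs.surjAt i hi (x - lin s w)
        (Submodule.sub_mem _ hx (map_mem s hw)) (by rw [map_sub, ← map_d, h2, sub_self])
      refine ⟨y + lin f w + lin f z, Submodule.add_mem _ (Submodule.add_mem _ hy (map_mem f hw))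
        (map_mem f hz), ?_, coneMk φ (prodMk 0 x'') (-w - z), ?_⟩
      · rw [map_add, map_add, ← map_d, ← map_d, hdz, h1, map_zero, zero_add]
      · rw [cone_d, hι, coneMk_add, coneMk_inj, hd, hφ, ha, ha, prodMk_inj]
        refine ⟨⟨?_, ?_⟩, ?_⟩
        · simp
        · rw [eq_add_of_sub_eq hx'', map_sub, map_neg]; abel
        · simp [hdz]
  · have := nullHomotopic_comp_coneInl φ
    have e : φ ≫ coneInl φ = f ≫ prodInl Y X ≫ coneInl φ - s ≫ prodInr Y X ≫ coneInl φ := by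
      have e' : φ = f ≫ prodInl Y X - s ≫ prodInr Y X := by
        refine hom_ext fun m => ?_
        rw [sub_eq_add_neg]
        refine Prod.ext ?_ ?_
        · change lin f m = lin f m + -0
          simp
        · change -lin s m = 0 + -lin s m
          simp
      rw [← Category.assoc, ← Category.assoc, ← Preadditive.sub_comp, ← e']
    rwa [e] at this

/-! ### Mapping cones and null homotopies -/

/-- A null homotopy of `s ≫ g` extends `g` to the mapping cone of `s`. -/
theorem exists_coneDesc {X X' Y : DGModule.{w} R} (s : X' ⟶ X) (g : X ⟶ Y)
    (θ : X'.carrier →ₗ[k] Y.carrier)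
    (h1 : ∀ (i : ℤ) (m : X'.carrier), m ∈ X'.grading i → θ m ∈ Y.grading (i - 1))
    (h2 : ∀ (i : ℤ) (a : R.carrier) (m : X'.carrier), a ∈ R.grading i →
      θ (a • m) = i.negOnePow • (a • θ m))
    (h3 : ∀ m : X'.carrier, lin (s ≫ g) m = Y.d (θ m) + θ (X'.d m)) :
    ∃ φ : cone s ⟶ Y, coneInl s ≫ φ = g ∧ ∀ x x', lin φ (coneMk s x x') = lin g x + θ x' := by
  let l : (cone s).carrier →ₗ[k] Y.carrier :=
    (lin g).restrictScalars k ∘ₗ LinearMap.fst k X.carrier (shift 1 X').carrier +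
      θ ∘ₗ (toShift 1 X').symm.toLinearMap ∘ₗ LinearMap.snd k X.carrier (shift 1 X').carrier
  have hl : ∀ x x', l (coneMk s x x') = lin g x + θ x' := fun _ _ => rfl
  have hls : ∀ (a : R.carrier) (c : (cone s).carrier), l (a • c) = a • l c := by
    intro a c
    obtain ⟨x, x', rfl⟩ := coneMk_surj s c
    induction a using R.isInternal.induction with
    | h0 => simp
    | hadd a b ha hb => rw [add_smul, map_add, ha, hb, add_smul]
    | hom i a ha =>
      rw [smul_coneMk s ha, hl, hl, map_smul, Units.smul_def, map_zsmul, h2 i a x' ha,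
        ← Units.smul_def, smul_smul, Int.units_mul_self, one_smul, smul_add]
  let φ : cone s ⟶ Y :=
    { toLin := { l with map_smul' := hls }
      map_mem := by
        intro i c hc
        obtain ⟨x, x', rfl⟩ := coneMk_surj s c
        rw [coneMk_mem] at hc
        have := h1 _ x' hc.2
        rw [add_sub_cancel_right] at this
        exact Submodule.add_mem _ (map_mem g hc.1) this
      map_d := by
        intro c
        obtain ⟨x, x', rfl⟩ := coneMk_surj s c
        change l _ = Y.d (l _)
        have := h3 x'
        rw [lin_comp] at this
        rw [cone_d, hl, hl, map_add, map_add, this, map_d, map_neg]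
        abel }
  refine ⟨φ, hom_ext fun m => ?_, hl⟩
  change lin g m + θ 0 = lin g m
  simp

theorem NullHomotopic.exists_coneDesc {X X' Y : DGModule.{w} R} {s : X' ⟶ X} {g : X ⟶ Y}
    (h : NullHomotopic (s ≫ g)) : ∃ φ : cone s ⟶ Y, coneInl s ≫ φ = g := by
  obtain ⟨θ, h1, h2, h3⟩ := h
  obtain ⟨φ, hφ, -⟩ := DGModule.exists_coneDesc s g θ h1 h2 h3
  exact ⟨φ, hφ⟩

/-- If the composite of `f` with `N ⟶ cone π` is null homotopic, then `f` lifts through `π` up to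
homotopy. -/
theorem NullHomotopic.exists_lift {P M N : DGModule.{w} R} {π : M ⟶ N} {f : P ⟶ N}
    (h : NullHomotopic (f ≫ coneInl π)) : ∃ g : P ⟶ M, NullHomotopic (f - g ≫ π) := by
  obtain ⟨θ, h1, h2, h3⟩ := h
  -- the two components of the null homotopy
  let α : P.carrier →ₗ[k] N.carrier :=
    LinearMap.fst k N.carrier (shift 1 M).carrier ∘ₗ θ
  let β : P.carrier →ₗ[k] M.carrier :=
    (toShift 1 M).symm.toLinearMap ∘ₗ LinearMap.snd k N.carrier (shift 1 M).carrier ∘ₗ θ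
  have hθ : ∀ p, θ p = coneMk π (α p) (β p) := fun p => rfl
  have hm : ∀ i, ∀ p ∈ P.grading i, α p ∈ N.grading (i - 1) ∧ β p ∈ M.grading i := by
    intro i p hp
    have := h1 i p hp
    rw [hθ, coneMk_mem, sub_add_cancel] at this
    exact this
  have hs : ∀ (i : ℤ) (a : R.carrier) (p : P.carrier), a ∈ R.grading i →
      α (a • p) = i.negOnePow • (a • α p) ∧ β (a • p) = a • β p := by
    intro i a p ha
    have := h2 i a p ha
    rw [hθ, hθ, smul_coneMk π ha] at this
    have e : i.negOnePow • coneMk π (a • α p) (i.negOnePow • (a • β p)) =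
      coneMk π (i.negOnePow • (a • α p)) (i.negOnePow • i.negOnePow • (a • β p)) := rfl
    rw [e, coneMk_inj, smul_smul, Int.units_mul_self, one_smul] at this
    exact this
  have hd : ∀ p, lin f p = N.d (α p) + lin π (β p) + α (P.d p) ∧ 0 = -M.d (β p) + β (P.d p) := by
    intro p
    have := h3 p
    rw [lin_comp, lin_coneInl, hθ, hθ, cone_d, coneMk_add, coneMk_inj] at this
    exact this
  let g : P ⟶ M :=
    { toLin := { β with
        map_smul' := fun a p => by
          change β (a • p) = a • β p
          induction a using R.isInternal.induction with
          | h0 => simp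
          | hadd a b ha hb => rw [add_smul, map_add, ha, hb, add_smul]
          | hom i a ha => exact (hs i a p ha).2 }
      map_mem := fun {i p} hp => (hm i p hp).2
      map_d := fun p => by
        have := (hd p).2
        rw [eq_comm, neg_add_eq_zero] at this
        exact this.symm }
  have hg : ∀ p, lin g p = β p := fun _ => rfl
  refine ⟨g, α, fun i p hp => (hm i p hp).1, fun i a p ha => (hs i a p ha).1, fun p => ?_⟩
  have e : lin (f - g ≫ π) p = lin f p - lin π (β p) := by
    rw [sub_eq_add_neg, lin_add, lin_neg, lin_comp, hg, sub_eq_add_neg]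
  rw [e, (hd p).1]
  abel

end DGModule

namespace DGModule

variable {k : Type u} [Field k] {R : DGAlgebra.{v} k}

/-! ### Truncations -/

/-- The DG submodule `L` of `M` which is `M` in degrees `> n`, zero in degrees `< n`, and in
degree `n` a complement of `S ∩ Mⁿ`. Taking the cocycles or the coboundaries for `S` gives the two
kinds of truncations of `M`. -/
theorem exists_truncSub (hneg : ∀ i : ℤ, i < 0 → R.grading i = ⊥)
    (hzero : ∀ a : R.carrier, a ∈ R.grading 0 → ∃ c : k, algebraMap k R.carrier c = a)
    (M : DGModule.{w} R) (n : ℤ) (S : Submodule k M.carrier) :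
    ∃ (L : DGModule.{w} R) (ι : L ⟶ M), Function.Injective (lin ι) ∧
      (∀ i < n, ∀ l ∈ L.grading i, l = 0) ∧
      (∀ l ∈ L.grading n, lin ι l ∈ S → l = 0) ∧
      (∀ i, n < i → ∀ m ∈ M.grading i, ∃ l ∈ L.grading i, lin ι l = m) ∧
      (∀ m ∈ M.grading n, ∃ l ∈ L.grading n, ∃ s ∈ S, s ∈ M.grading n ∧ m = s + lin ι l) ∧
      (∀ (T : DGModule.{w} R) (f : T ⟶ M), (∀ i ≤ n, ∀ t ∈ T.grading i, t = 0) →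
        ∃ g : T ⟶ L, g ≫ ι = f) := by
  obtain ⟨W, hW⟩ := Submodule.exists_isCompl (S ⊓ M.grading n)
  let G := GradedSub.trunc hneg hzero M n W
  have hG : ∀ i m, m ∈ G.component i ↔ m ∈ M.grading i ∧ (i < n → m = 0) ∧ (i = n → m ∈ W) :=
    fun i m => Iff.rfl
  refine ⟨G.toDGModule, G.incl, G.incl_injective, ?_, ?_, ?_, ?_, ?_⟩
  · intro i hi l hl
    apply G.incl_injective
    rw [map_zero]
    exact ((hG i _).1 hl).2.1 hi
  · intro l hl hS
    apply G.incl_injective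
    rw [map_zero]
    have h := (hG n _).1 hl
    exact Submodule.disjoint_def.1 hW.disjoint _ ⟨hS, h.1⟩ (h.2.2 rfl)
  · intro i hi m hm
    exact G.exists_incl_eq ((hG i m).2 ⟨hm, fun h => by omega, fun h => by omega⟩)
  · intro m hm
    have : m ∈ (S ⊓ M.grading n) ⊔ W := by rw [hW.sup_eq_top]; trivial
    obtain ⟨s, hs, w, hw, rfl⟩ := Submodule.mem_sup.1 this
    have hw' : w ∈ M.grading n := by
      have := Submodule.sub_mem _ hm hs.2
      rwa [add_sub_cancel_left] at this
    obtain ⟨l, hl, rfl⟩ := G.exists_incl_eq (i := n)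
      ((hG n w).2 ⟨hw', fun h => by omega, fun _ => hw⟩)
    exact ⟨l, hl, s, hs.1, hs.2, rfl⟩
  · intro T f hT
    refine G.exists_lift f fun i x hx => (hG i _).2 ⟨map_mem f hx, fun h => ?_, fun h => ?_⟩
    · rw [hT i h.le x hx, map_zero]
    · rw [hT i h.le x hx, map_zero]; exact Submodule.zero_mem _

/-- If `M` has no cohomology in degrees `< n`, it is quasi-isomorphic to a DG submodule
concentrated in degrees `≥ n`. -/
theorem IsAcyclicBelow.exists_truncBelow (hneg : ∀ i : ℤ, i < 0 → R.grading i = ⊥)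
    (hzero : ∀ a : R.carrier, a ∈ R.grading 0 → ∃ c : k, algebraMap k R.carrier c = a)
    {M : DGModule.{w} R} {n : ℤ} (hM : M.IsAcyclicBelow n) :
    ∃ (L : DGModule.{w} R) (ι : L ⟶ M), (∀ i < n, ∀ l ∈ L.grading i, l = 0) ∧
      Function.Bijective (cohomologyMap ι) := by
  obtain ⟨L, ι, hinj, h0, h1, h2, h3, -⟩ :=
    exists_truncSub hneg hzero M n (LinearMap.range M.d)
  refine ⟨L, ι, h0, bijective_of_injAt_surjAt (fun i l hl hdl y hy => ?_) fun i m hm hdm => ?_⟩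
  · rcases lt_trichotomy i n with hi | rfl | hi
    · exact ⟨0, by rw [h0 i hi l hl, map_zero]⟩
    · exact ⟨0, by rw [h1 l hl ⟨y, hy.symm⟩, map_zero]⟩
    · obtain ⟨y, hy', hy⟩ := M.exists_boundary_mem' (map_mem ι hl) hy
      rcases lt_or_eq_of_le (show n ≤ i - 1 by omega) with h | rfl
      · obtain ⟨z, -, rfl⟩ := h2 _ h y hy'
        exact ⟨z, hinj (by rw [hy, map_d])⟩
      · obtain ⟨z, -, _, ⟨s, rfl⟩, -, rfl⟩ := h3 y hy'
        exact ⟨z, hinj (by rw [hy, map_d, map_add, M.d_d, zero_add])⟩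
  · rcases lt_trichotomy i n with hi | rfl | hi
    · exact (hM i hi).surjAt ι m hm hdm
    · obtain ⟨l, hl, _, ⟨s, rfl⟩, -, rfl⟩ := h3 m hm
      rw [map_add, M.d_d, zero_add, ← map_d] at hdm
      exact ⟨l, hl, hinj (by rw [hdm, map_zero]), s, add_comm _ _⟩
    · obtain ⟨l, hl, rfl⟩ := h2 i hi m hm
      exact ⟨l, hl, hinj (by rw [map_d, hdm, map_zero]), 0, by rw [map_zero, add_zero]⟩

/-- If `M` has no cohomology in degrees `> n`, then a morphism to `M` from a DG module
concentrated in degrees `> n` factors through an acyclic DG module. -/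
theorem IsAcyclicAbove.exists_acyclic_fac (hneg : ∀ i : ℤ, i < 0 → R.grading i = ⊥)
    (hzero : ∀ a : R.carrier, a ∈ R.grading 0 → ∃ c : k, algebraMap k R.carrier c = a)
    {M : DGModule.{w} R} {n : ℤ} (hM : M.IsAcyclicAbove n) {T : DGModule.{w} R} (f : T ⟶ M)
    (hT : ∀ i ≤ n, ∀ t ∈ T.grading i, t = 0) :
    ∃ (L : DGModule.{w} R) (g : T ⟶ L) (ι : L ⟶ M), g ≫ ι = f ∧
      ∀ l, L.d l = 0 → ∃ x, l = L.d x := by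
  obtain ⟨L, ι, hinj, h0, h1, h2, h3, h4⟩ :=
    exists_truncSub hneg hzero M n (LinearMap.ker M.d)
  obtain ⟨g, hg⟩ := h4 T f hT
  refine ⟨L, g, ι, hg, acyclic_of_forall_isAcyclicAt fun i l hl hdl => ?_⟩
  have hdl' : M.d (lin ι l) = 0 := by rw [← map_d, hdl, map_zero]
  rcases lt_trichotomy i n with hi | rfl | hi
  · exact ⟨0, by rw [h0 i hi l hl, map_zero]⟩
  · exact ⟨0, by rw [h1 l hl hdl', map_zero]⟩
  · obtain ⟨y, hy⟩ := hM i hi _ (map_mem ι hl) hdl'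
    obtain ⟨y, hy', hy⟩ := M.exists_boundary_mem' (map_mem ι hl) hy
    rcases lt_or_eq_of_le (show n ≤ i - 1 by omega) with h | rfl
    · obtain ⟨z, -, rfl⟩ := h2 _ h y hy'
      exact ⟨z, hinj (by rw [hy, map_d])⟩
    · obtain ⟨z, -, s, hs, -, rfl⟩ := h3 y hy'
      rw [map_add, show M.d s = 0 from hs, zero_add] at hy
      exact ⟨z, hinj (by rw [hy, map_d])⟩

/-- The truncation of `M` in degrees `≤ n`, provided `M` has no cohomology in degree `n + 1`. -/
theorem IsAcyclicAt.exists_truncAbove (hneg : ∀ i : ℤ, i < 0 → R.grading i = ⊥)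
    (hzero : ∀ a : R.carrier, a ∈ R.grading 0 → ∃ c : k, algebraMap k R.carrier c = a)
    {M : DGModule.{w} R} {n : ℤ} (hM : M.IsAcyclicAt (n + 1)) :
    ∃ (Y : DGModule.{w} R) (q : M ⟶ Y), Y.IsAcyclicAbove n ∧ IsTruncEquiv q (n + 1) := by
  obtain ⟨L, ι, hinj, h0, h1, h2, h3, -⟩ :=
    exists_truncSub hneg hzero M n (LinearMap.ker M.d)
  have hcoc : ∀ i ≤ n, ∀ l ∈ L.grading i, L.d l = 0 → l = 0 := by
    intro i hi l hl hdl
    rcases lt_or_eq_of_le hi with hi | rfl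
    · exact h0 i hi l hl
    · exact h1 l hl (show M.d _ = 0 by rw [← map_d, hdl, map_zero])
  refine ⟨cone ι, coneInl ι, ?_, ?_, ?_⟩
  · intro i hi c hc hdc
    obtain ⟨m, l, rfl⟩ := coneMk_surj ι c
    rw [coneMk_mem] at hc
    rw [cone_d, ← coneMk_zero, coneMk_inj] at hdc
    obtain ⟨l', -, rfl⟩ := h2 i hi m hc.1
    refine ⟨coneMk ι 0 l', ?_⟩
    rw [cone_d, coneMk_inj]
    refine ⟨by simp, hinj ?_⟩
    rw [map_neg, map_d, eq_neg_iff_add_eq_zero, add_comm, hdc.1]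
  · intro i hi m hm hdm y hy
    rcases lt_or_eq_of_le hi with hi | rfl
    · obtain ⟨y, hy', hy⟩ := (cone ι).exists_boundary_mem' (map_mem _ hm) hy
      obtain ⟨m', l, rfl⟩ := coneMk_surj ι y
      rw [cone_d, lin_coneInl, coneMk_inj] at hy
      have := hcoc i (by omega) l (mem_grading_congr hy'.2 (by ring)) (neg_eq_zero.1 hy.2.symm)
      exact ⟨m', by rw [hy.1, this, map_zero, add_zero]⟩
    · exact hM m hm hdm
  · intro i hi c hc hdc
    obtain ⟨m, l, rfl⟩ := coneMk_surj ι c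
    rw [coneMk_mem] at hc
    rw [cone_d, ← coneMk_zero, coneMk_inj] at hdc
    rcases lt_or_eq_of_le (show i ≤ n by omega) with hi | rfl
    · have := hcoc (i + 1) (by omega) l hc.2 (neg_eq_zero.1 hdc.2)
      rw [this, map_zero, add_zero] at hdc
      exact ⟨m, hc.1, hdc.1, 0, by rw [this, map_zero, add_zero, lin_coneInl]⟩
    · obtain ⟨v, hv, z, hz, hz', rfl⟩ := h3 m hc.1
      have hz0 : M.d z = 0 := hz
      refine ⟨z, hz', hz0, coneMk ι 0 v, ?_⟩
      rw [lin_coneInl, cone_d, coneMk_add, coneMk_inj]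
      refine ⟨by simp, hinj ?_⟩
      have := hdc.1
      rw [map_add, hz0, zero_add, ← map_d] at this
      rw [zero_add, map_neg, eq_neg_iff_add_eq_zero, add_comm, this]

/-! ### Morphisms of the derived category -/

theorem isIso_ofModule_map {M N : DGModule.{w} R} {f : M ⟶ N}
    (hf : Function.Bijective (cohomologyMap f)) : IsIso ((ofModule R).map f) :=
  Localization.inverts (toD R) (quasiIso R) ((toK R).map f) ((quasiIso_map_iff f).2 hf)

theorem ofModule_map_eq_of_nullHomotopic {M N : DGModule.{w} R} {f g : M ⟶ N}
    (h : NullHomotopic (f - g)) : (ofModule R).map f = (ofModule R).map g := by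
  have := (toK_map_eq_iff f g).2 h
  change (toD R).map ((toK R).map f) = (toD R).map ((toK R).map g)
  rw [this]

/-- Each morphism of the derived category is represented by a left fraction. -/
theorem exists_leftFraction {M N : DGModule.{w} R}
    (φ : (ofModule R).obj M ⟶ (ofModule R).obj N) :
    ∃ (N' : DGModule.{w} R) (f : M ⟶ N') (s : N ⟶ N'), Function.Bijective (cohomologyMap s) ∧
      φ ≫ (ofModule R).map s = (ofModule R).map f := by
  obtain ⟨⟨f, s, hs⟩, hφ⟩ := Localization.exists_leftFraction (toD R) (quasiIso R) φ
  rename_i Y'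
  obtain ⟨N'⟩ := Y'
  obtain ⟨f, rfl⟩ := (toK R).map_surjective f
  obtain ⟨s, rfl⟩ := (toK R).map_surjective s
  refine ⟨N', f, s, (quasiIso_map_iff s).1 hs, ?_⟩
  rw [hφ]
  exact MorphismProperty.LeftFraction.map_comp_map_s _ _ _

theorem exists_of_ofModule_map_eq {M N : DGModule.{w} R} {f g : M ⟶ N}
    (h : (ofModule R).map f = (ofModule R).map g) :
    ∃ (N' : DGModule.{w} R) (s : N ⟶ N'), Function.Bijective (cohomologyMap s) ∧
      NullHomotopic ((f - g) ≫ s) := by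
  obtain ⟨N', s, hs, h⟩ := (MorphismProperty.map_eq_iff_postcomp (toD R) (quasiIso R)
    ((toK R).map f) ((toK R).map g)).1 h
  obtain ⟨N'⟩ := N'
  obtain ⟨s, rfl⟩ := (toK R).map_surjective s
  refine ⟨N', s, (quasiIso_map_iff s).1 hs, ?_⟩
  rw [Preadditive.sub_comp, ← toK_map_eq_iff, Functor.map_comp, Functor.map_comp]
  exact h

/-- A morphism which factors through an acyclic DG module is zero in the derived category. -/
theorem ofModule_map_eq_zero_of_acyclic {T L M : DGModule.{w} R} (g : T ⟶ L) (ι : L ⟶ M)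
    (hL : ∀ l, L.d l = 0 → ∃ x, l = L.d x) : (ofModule R).map (g ≫ ι) = 0 := by
  have h : Function.Bijective (cohomologyMap (0 : L ⟶ L)) :=
    (cohomologyMap_bijective_iff _).2 ⟨fun m hm _ _ => hL m hm, fun n hn =>
      ⟨0, map_zero _, (hL n hn).imp fun x hx => by rw [hx, map_zero, zero_add]⟩⟩
  have := isIso_ofModule_map h
  have hid : 𝟙 ((ofModule R).obj L) = 0 := by
    rw [← cancel_epi ((ofModule R).map (0 : L ⟶ L)), Functor.map_zero, zero_comp, zero_comp]
  rw [Functor.map_comp, ← Category.comp_id ((ofModule R).map g), hid, comp_zero, zero_comp]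

variable (hneg : ∀ i : ℤ, i < 0 → R.grading i = ⊥)
    (hzero : ∀ a : R.carrier, a ∈ R.grading 0 → ∃ c : k, algebraMap k R.carrier c = a)

include hneg hzero

/-- There are no nonzero morphisms in the derived category from an object with cohomology in
degrees `≥ c` to one with cohomology in degrees `< c`. -/
theorem eq_zero_of_isAcyclic {C N : DGModule.{w} R} {b c : ℤ} (hC : C.IsAcyclicBelow c)
    (hN : N.IsAcyclicAbove b) (hbc : b < c) (φ : (ofModule R).obj C ⟶ (ofModule R).obj N) :
    φ = 0 := by
  obtain ⟨N', f, s, hs, hφ⟩ := exists_leftFraction φ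
  obtain ⟨T, j, hT, hj⟩ := hC.exists_truncBelow hneg hzero
  have hN' : N'.IsAcyclicAbove b := fun i hi => (hN i hi).of_surjAt (surjAt_of_bijective hs i)
  obtain ⟨L, g, ι, hg, hL⟩ := hN'.exists_acyclic_fac hneg hzero (j ≫ f)
    fun i hi t ht => hT i (by omega) t ht
  have := isIso_ofModule_map hs
  have := isIso_ofModule_map hj
  rw [← cancel_mono ((ofModule R).map s), hφ, ← cancel_epi ((ofModule R).map j),
    ← Functor.map_comp, ← hg, ofModule_map_eq_zero_of_acyclic g ι hL, zero_comp, comp_zero]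

/-- Morphisms from `M` to an object with cohomology in degrees `≤ b` are determined by their
restriction to an approximation of `M` in degrees `≤ b`: the difference of two of them factors
through the mapping cone, which has cohomology in degrees `> b` only. -/
theorem IsTruncEquiv.precomp_injective {P M N : DGModule.{w} R} {π : P ⟶ M} {b c : ℤ}
    (hπ : IsTruncEquiv π c) (hN : N.IsAcyclicAbove b) (hbc : b < c)
    {φ ψ : (ofModule R).obj M ⟶ (ofModule R).obj N}
    (h : (ofModule R).map π ≫ φ = (ofModule R).map π ≫ ψ) : φ = ψ := by
  rw [← sub_eq_zero] at h ⊢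
  rw [← Preadditive.comp_sub] at h
  generalize φ - ψ = χ at h
  obtain ⟨N', f, s, hs, hχ⟩ := exists_leftFraction χ
  have h0 : (ofModule R).map (π ≫ f) = (ofModule R).map (0 : P ⟶ N') := by
    rw [Functor.map_comp, ← hχ, ← Category.assoc, h, zero_comp, Functor.map_zero]
  obtain ⟨N'', t, ht, hnull⟩ := exists_of_ofModule_map_eq h0
  rw [sub_zero, Category.assoc] at hnull
  obtain ⟨g, hg⟩ := hnull.exists_coneDesc
  have hN'' : N''.IsAcyclicAbove b := fun i hi =>
    ((hN i hi).of_surjAt (surjAt_of_bijective hs i)).of_surjAt (surjAt_of_bijective ht i)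
  have hg0 := eq_zero_of_isAcyclic hneg hzero hπ.isAcyclicBelow_cone hN'' hbc
    ((ofModule R).map g)
  have := isIso_ofModule_map hs
  have := isIso_ofModule_map ht
  rw [← cancel_mono ((ofModule R).map s), hχ, ← cancel_mono ((ofModule R).map t),
    ← Functor.map_comp, ← hg, Functor.map_comp, hg0, comp_zero, zero_comp, zero_comp]

/-- Morphisms from an approximation `P` of `M` in degrees `≤ b + 1` to an object with cohomology in
degrees `≤ b` extend to `M`: they extend to the homotopy pushout, whose truncation in degrees `≤ b`
is the target. -/
theorem IsTruncEquiv.exists_precomp_eq {P M N : DGModule.{w} R} {π : P ⟶ M} {b c : ℤ}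
    (hπ : IsTruncEquiv π c) (hN : N.IsAcyclicAbove b) (hbc : b + 2 ≤ c)
    (χ : (ofModule R).obj P ⟶ (ofModule R).obj N) :
    ∃ φ : (ofModule R).obj M ⟶ (ofModule R).obj N, (ofModule R).map π ≫ φ = χ := by
  obtain ⟨N', f, s, hs, hχ⟩ := exists_leftFraction χ
  have hN' : N'.IsAcyclicAbove b := fun i hi => (hN i hi).of_surjAt (surjAt_of_bijective hs i)
  obtain ⟨Y, g, t, ht, hnull⟩ := hπ.exists_pushout π f
  have hY : Y.IsAcyclicAt (b + 1) :=
    (hN' _ (by omega)).of_surjAt (ht.surjAt (b + 1) (by omega))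
  obtain ⟨Z, q, hZ, hq⟩ := hY.exists_truncAbove hneg hzero
  have := isIso_ofModule_map hs
  have := isIso_ofModule_map
    (((ht.mono (by omega)).comp hq).bijective hN' hZ (lt_add_one b))
  refine ⟨(ofModule R).map (g ≫ q) ≫ inv ((ofModule R).map (t ≫ q)) ≫
    inv ((ofModule R).map s), ?_⟩
  rw [← cancel_mono ((ofModule R).map s), hχ]
  simp only [Category.assoc, IsIso.inv_hom_id, Category.comp_id]
  have e := ofModule_map_eq_of_nullHomotopic hnull
  rw [Functor.map_comp, Functor.map_comp] at e
  rw [← Category.assoc, IsIso.comp_inv_eq, Functor.map_comp, Functor.map_comp,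
    ← Category.assoc, ← e, Category.assoc]

end DGModule

namespace DGModule

/-! ### Cells -/

section Cells

variable {k : Type u} [CommRing k] {R : DGAlgebra.{v} k}

variable (R) in
/-- The free DG module `Σⁿ R` of rank one, with a generator in degree `-n`. -/
noncomputable abbrev cell (n : ℤ) : DGModule.{v} R := shift n (regular R)

variable (R) in
/-- The identity map from the underlying set of `R` to that of `Σⁿ R`. -/
noncomputable def cellMk (n : ℤ) : R.carrier ≃ₗ[k] (cell R n).carrier := toShift n (regular R)

theorem cellMk_mem (n : ℤ) {i : ℤ} {r : R.carrier} :
    cellMk R n r ∈ (cell R n).grading i ↔ r ∈ R.grading (i + n) := Iff.rfl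

theorem smul_cellMk (n : ℤ) {i : ℤ} {a : R.carrier} (ha : a ∈ R.grading i) (r : R.carrier) :
    a • cellMk R n r = (n * i).negOnePow • cellMk R n (a * r) :=
  smul_toShift n (regular R) ha r

theorem cell_d (n : ℤ) (r : R.carrier) :
    (cell R n).d (cellMk R n r) = n.negOnePow • cellMk R n (R.d r) := rfl

theorem d_one (R : DGAlgebra.{v} k) : R.d 1 = 0 := by
  have := R.leibniz (i := 0) (a := 1) SetLike.GradedOne.one_mem 1
  simpa using this

theorem cell_d_one (n : ℤ) : (cell R n).d (cellMk R n 1) = 0 := by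
  rw [cell_d, d_one, map_zero, smul_zero]

theorem cellMk_one_mem (n : ℤ) : cellMk R n 1 ∈ (cell R n).grading (-n) := by
  rw [cellMk_mem, neg_add_cancel]
  exact SetLike.GradedOne.one_mem

theorem cell_induction {n : ℤ} {p : (cell R n).carrier → Prop} (h0 : p 0)
    (hadd : ∀ x y, p x → p y → p (x + y))
    (hom : ∀ i, ∀ r ∈ R.grading i, p (cellMk R n r)) (x : (cell R n).carrier) : p x := by
  obtain ⟨r, rfl⟩ := (cellMk R n).surjective x
  induction r using R.isInternal.induction with
  | h0 => rw [map_zero]; exact h0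
  | hadd x y hx hy => rw [map_add]; exact hadd _ _ hx hy
  | hom i r hr => exact hom i r hr

/-- The map `Σⁿ R → N` sending `a` of degree `i` in `R` to `(-1) ^ (m i) a y`. It is `R`-linear for
`m = n`, and satisfies the sign rule of a null homotopy for `m = n + 1`. -/
noncomputable def cellMap (n m : ℤ) {N : DGModule.{w} R} (y : N.carrier) :
    (cell R n).carrier →ₗ[k] N.carrier where
  toFun x := R.twist m ((cellMk R n).symm x) • y
  map_add' x x' := by rw [map_add, map_add, add_smul]
  map_smul' c x := by rw [map_smul, RingHom.id_apply, twist_ksmul, smul_assoc]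

theorem cellMap_apply (n m : ℤ) {N : DGModule.{w} R} (y : N.carrier) {i : ℤ} {r : R.carrier}
    (hr : r ∈ R.grading i) :
    cellMap n m y (cellMk R n r) = (m * i).negOnePow • (r • y) := by
  change R.twist m ((cellMk R n).symm (cellMk R n r)) • y = _
  rw [LinearEquiv.symm_apply_apply, R.twist_of_mem m hr]
  simp only [Units.smul_def, smul_assoc]

theorem cellMap_one (n m : ℤ) {N : DGModule.{w} R} (y : N.carrier) :
    cellMap n m y (cellMk R n 1) = y := by
  rw [cellMap_apply n m y (i := 0) SetLike.GradedOne.one_mem, mul_zero, Int.negOnePow_zero,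
    one_smul, one_smul]

theorem cellMap_add (n m : ℤ) {N : DGModule.{w} R} (y y' : N.carrier) (x : (cell R n).carrier) :
    cellMap n m (y + y') x = cellMap n m y x + cellMap n m y' x := smul_add _ _ _

theorem cellMap_zero (n m : ℤ) {N : DGModule.{w} R} (x : (cell R n).carrier) :
    cellMap n m (0 : N.carrier) x = 0 := smul_zero _

theorem cellMap_add_two (n m : ℤ) {N : DGModule.{w} R} (y : N.carrier)
    (x : (cell R n).carrier) : cellMap n (m + 1 + 1) y x = cellMap n m y x := by
  induction x using cell_induction with
  | h0 => simp
  | hadd x x' hx hx' => rw [map_add, map_add, hx, hx']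
  | hom i r hr =>
    rw [cellMap_apply n _ y hr, cellMap_apply n m y hr]
    congr 1
    rw [Int.negOnePow_eq_iff]
    exact ⟨i, by ring⟩

theorem cellMap_mem (n m : ℤ) {N : DGModule.{w} R} {y : N.carrier} {j : ℤ}
    (hy : y ∈ N.grading j) {i : ℤ} {x : (cell R n).carrier}
    (hx : x ∈ (cell R n).grading i) : cellMap n m y x ∈ N.grading (i + n + j) := by
  obtain ⟨r, rfl⟩ := (cellMk R n).surjective x
  rw [cellMk_mem] at hx
  rw [cellMap_apply n m y hx]
  exact negOnePow_smul_mem _ _ (N.smul_mem hx hy)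

theorem units_smul_map {M : Type*} {N : Type*} [AddCommGroup M] [AddCommGroup N] [Module k M]
    [Module k N] (l : M →ₗ[k] N) (ε : ℤˣ) (m : M) : l (ε • m) = ε • l m := by
  rw [Units.smul_def, Units.smul_def, map_zsmul]

theorem smul_units_smul (N : DGModule.{w} R) (ε : ℤˣ) (a : R.carrier) (m : N.carrier) :
    a • ε • m = ε • a • m := by
  rw [Units.smul_def, Units.smul_def, smul_comm]

theorem cellMap_smul (n m : ℤ) {N : DGModule.{w} R} (y : N.carrier) {i : ℤ} {a : R.carrier}
    (ha : a ∈ R.grading i) (x : (cell R n).carrier) :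
    cellMap n m y (a • x) = ((m - n) * i).negOnePow • (a • cellMap n m y x) := by
  induction x using cell_induction with
  | h0 => simp
  | hadd x x' hx hx' => simp only [smul_add, map_add, hx, hx']
  | hom j r hr =>
    have har : a * r ∈ R.grading (i + j) := SetLike.GradedMul.mul_mem ha hr
    rw [smul_cellMk n ha, cellMap_apply n m y hr, units_smul_map, cellMap_apply n m y har,
      smul_units_smul, smul_smul, smul_smul, smul_smul, ← Int.negOnePow_add, ← Int.negOnePow_add]
    congr 1
    rw [Int.negOnePow_eq_iff]
    exact ⟨n * i, by ring⟩

theorem d_cellMap (n m : ℤ) {N : DGModule.{w} R} (y : N.carrier) (x : (cell R n).carrier) :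
    N.d (cellMap n m y x) = (m - n).negOnePow • cellMap n m y ((cell R n).d x) +
      cellMap n (m + 1) (N.d y) x := by
  induction x using cell_induction with
  | h0 => simp
  | hadd x x' hx hx' => simp only [smul_add, map_add, hx, hx']; abel
  | hom i r hr =>
    have hdr : R.d r ∈ R.grading (i + 1) := R.d_mem hr
    rw [cell_d, cellMap_apply n m y hr, cellMap_apply n (m + 1) _ hr, units_smul_map,
      units_smul_map, cellMap_apply n m y hdr, N.leibniz hr, smul_add, smul_smul, smul_smul,
      smul_smul, ← Int.negOnePow_add, ← Int.negOnePow_add, ← Int.negOnePow_add]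
    congr 2
    · rw [Int.negOnePow_eq_iff]
      exact ⟨-m, by ring⟩
    · congr 1; ring

/-- A map out of a cell satisfying a sign rule is determined by its value on the generator. -/
theorem eq_cellMap (n m : ℤ) {N : DGModule.{w} R} (l : (cell R n).carrier →ₗ[k] N.carrier)
    (hl : ∀ (i : ℤ) (a : R.carrier) (x : (cell R n).carrier), a ∈ R.grading i →
      l (a • x) = ((m - n) * i).negOnePow • (a • l x)) (x : (cell R n).carrier) :
    l x = cellMap n m (l (cellMk R n 1)) x := by
  induction x using cell_induction with
  | h0 => simp
  | hadd x x' hx hx' => simp only [map_add, hx, hx']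
  | hom i r hr =>
    have h := hl i r (cellMk R n 1) hr
    rw [smul_cellMk n hr, mul_one, units_smul_map] at h
    rw [cellMap_apply n m _ hr, ← one_smul ℤˣ (l _), ← Int.units_mul_self (n * i).negOnePow,
      mul_smul, h, smul_smul, ← Int.negOnePow_add]
    congr 2
    ring

/-- The morphism `Σⁿ R ⟶ P` given by a cocycle of degree `-n`. -/
noncomputable def cellHom (n : ℤ) {P : DGModule.{v} R} {p : P.carrier} (hp : p ∈ P.grading (-n))
    (hdp : P.d p = 0) : cell R n ⟶ P where
  toLin := { cellMap n n p with
    map_smul' := fun a x => by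
      change cellMap n n p (a • x) = a • cellMap n n p x
      induction a using R.isInternal.induction with
      | h0 => simp
      | hadd a b ha hb => rw [add_smul, map_add, ha, hb, add_smul]
      | hom i a ha => rw [cellMap_smul n n p ha]; simp }
  map_mem hx := mem_grading_congr (cellMap_mem n n hp hx) (by ring)
  map_d x := by
    have := d_cellMap n n p x
    rw [hdp, sub_self, Int.negOnePow_zero, one_smul, cellMap_zero, add_zero] at this
    exact this.symm

/-- Every morphism from `P` to a DG module without cohomology in degrees `< c` is null homotopic.
By `DGModule.IsCellularBelow.cone` this holds if `P` is obtained from `0` by successively attaching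
cells with generators in degrees `< c`, and it is the only property of such `P` that is used. -/
def IsCellularBelow (P : DGModule.{w} R) (c : ℤ) : Prop :=
  ∀ C : DGModule.{w} R, C.IsAcyclicBelow c → ∀ f : P ⟶ C, NullHomotopic f

theorem IsCellularBelow.mono {P : DGModule.{w} R} {c c' : ℤ} (h : P.IsCellularBelow c)
    (hc : c ≤ c') : P.IsCellularBelow c' := fun C hC => h C (hC.mono hc)

/-- Cellular approximation: morphisms from a cellular `P` lift, up to homotopy, through maps
inducing isomorphisms on cohomology in low degrees. -/
theorem IsCellularBelow.exists_lift {P M N : DGModule.{w} R} {c : ℤ} (h : P.IsCellularBelow c)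
    {π : M ⟶ N} (hπ : IsTruncEquiv π c) (f : P ⟶ N) :
    ∃ g : P ⟶ M, NullHomotopic (f - g ≫ π) :=
  (h _ hπ.isAcyclicBelow_cone (f ≫ coneInl π)).exists_lift

/-- Attaching a cell: the generator of the cell sits in degree `-n - 1` of the cone. -/
theorem IsCellularBelow.cone {P : DGModule.{v} R} {c : ℤ} (h : P.IsCellularBelow c)
    {n : ℤ} (g : cell R n ⟶ P) (hn : -n - 1 < c) : (cone g).IsCellularBelow c := by
  intro C hC f
  obtain ⟨θ, h1, h2, h3⟩ := h C hC (coneInl g ≫ f)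
  have h3' : ∀ q, lin f (coneMk g q 0) = C.d (θ q) + θ (P.d q) := h3
  have hx₀ := cellMk_one_mem (R := R) n
  -- the generator of the new cell, on which the null homotopy has to be defined
  let e := coneMk g 0 (cellMk R n 1)
  have he : e ∈ (DGModule.cone g).grading (-n - 1) :=
    (coneMk_mem g).2 ⟨Submodule.zero_mem _, mem_grading_congr hx₀ (by omega)⟩
  let p := lin g (cellMk R n 1)
  have hp : p ∈ P.grading (-n) := map_mem g hx₀
  have hdp : P.d p = 0 := by rw [← map_d, cell_d_one, map_zero]
  have hde : (DGModule.cone g).d e = coneMk g p 0 := by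
    rw [cone_d, map_zero, zero_add, cell_d_one, neg_zero]
  obtain ⟨y, hy, hye⟩ : ∃ y ∈ C.grading (-n - 1 - 1), lin f e - θ p = C.d y := by
    have hmem : lin f e - θ p ∈ C.grading (-n - 1) :=
      Submodule.sub_mem _ (map_mem f he) (mem_grading_congr (h1 _ p hp) (by omega))
    obtain ⟨y, hy⟩ := hC (-n - 1) hn _ hmem
      (by rw [map_sub, ← map_d, hde, h3', hdp, map_zero, add_zero, sub_self])
    obtain ⟨y', hy', h⟩ := C.exists_boundary_mem' hmem hy
    exact ⟨y', hy', h⟩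
  have hfe : lin f e = C.d y + θ p := by rw [← hye]; abel
  -- the homotopy on the cell is determined by its value `y` on the generator
  let Θ : (DGModule.cone g).carrier →ₗ[k] C.carrier :=
    θ ∘ₗ LinearMap.fst k P.carrier (shift 1 (cell R n)).carrier +
      cellMap n n y ∘ₗ (toShift 1 (cell R n)).symm.toLinearMap ∘ₗ
        LinearMap.snd k P.carrier (shift 1 (cell R n)).carrier
  have hΘ : ∀ q x, Θ (coneMk g q x) = θ q + cellMap n n y x := fun _ _ => rfl
  refine ⟨Θ, ?_, ?_, ?_⟩
  · intro i z hz
    obtain ⟨q, x, rfl⟩ := coneMk_surj g z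
    rw [coneMk_mem] at hz
    rw [hΘ]
    exact Submodule.add_mem _ (h1 i q hz.1)
      (mem_grading_congr (cellMap_mem n n hy hz.2) (by omega))
  · intro i a z ha
    obtain ⟨q, x, rfl⟩ := coneMk_surj g z
    rw [smul_coneMk g ha, hΘ, hΘ, h2 i a q ha, smul_add, smul_add, units_smul_map,
      cellMap_smul n n y ha, sub_self, zero_mul, Int.negOnePow_zero, one_smul]
  · intro z
    obtain ⟨q, x, rfl⟩ := coneMk_surj g z
    have hfx : lin f (coneMk g 0 x) = cellMap n (n + 1) (lin f e) x := by
      refine eq_cellMap n (n + 1) ((lin f).restrictScalars k ∘ₗ coneInrLin g) ?_ x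
      intro i a x ha
      rw [add_sub_cancel_left, one_mul]
      change lin f (coneMk g 0 (a • x)) = i.negOnePow • a • lin f (coneMk g 0 x)
      rw [← map_smul, smul_coneMk g ha, smul_zero]
      refine Eq.trans (congrArg (lin f) ?_) (units_smul_map ((lin f).restrictScalars k) _ _)
      refine Prod.ext (smul_zero i.negOnePow).symm ?_
      change a • x = i.negOnePow • i.negOnePow • (a • x)
      rw [smul_smul, Int.units_mul_self, one_smul]
    have hθx : θ (lin g x) = cellMap n (n + 1) (θ p) x := by
      refine eq_cellMap n (n + 1) (θ ∘ₗ (lin g).restrictScalars k) ?_ x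
      intro i a x ha
      rw [add_sub_cancel_left, one_mul]
      change θ (lin g (a • x)) = i.negOnePow • a • θ (lin g x)
      rw [map_smul, h2 i a _ ha]
    have hsplit : coneMk g q x = coneMk g q 0 + coneMk g 0 x := by
      rw [coneMk_add, add_zero, zero_add]
    have hf : lin f (coneMk g q x) = lin f (coneMk g q 0) + lin f (coneMk g 0 x) := by
      rw [hsplit, map_add]
    rw [hf, h3', hfx, hfe, cellMap_add, cone_d, hΘ, hΘ, map_add, map_add, d_cellMap, hθx, sub_self,
      Int.negOnePow_zero, one_smul, map_neg]
    abel

end Cells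

section Approximation

variable {k : Type u} [Field k] {R : DGAlgebra.{v} k}

/-- The morphisms of the derived category out of a cellular DG module are represented by morphisms
of DG modules. -/
theorem IsCellularBelow.ofModule_map_surjective {P N : DGModule.{w} R} {c : ℤ}
    (h : P.IsCellularBelow c) (φ : (ofModule R).obj P ⟶ (ofModule R).obj N) :
    ∃ f : P ⟶ N, (ofModule R).map f = φ := by
  obtain ⟨N', f, s, hs, hφ⟩ := exists_leftFraction φ
  obtain ⟨g, hg⟩ := h.exists_lift (IsTruncEquiv.of_bijective hs c) f
  have := isIso_ofModule_map hs
  refine ⟨g, ?_⟩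
  rw [← cancel_mono ((ofModule R).map s), hφ, ofModule_map_eq_of_nullHomotopic hg,
    Functor.map_comp]

end Approximation

variable {k : Type u} [Field k] {R : DGAlgebra.{v} k}

/-! ### Finite dimensional cohomology -/

theorem finite_of_ker_le_range {A B C : Type*} [AddCommGroup A] [AddCommGroup B]
    [AddCommGroup C] [Module k A] [Module k B] [Module k C] [Module.Finite k B]
    [Module.Finite k C] (g : C →ₗ[k] A) (f : A →ₗ[k] B)
    (h : LinearMap.ker f ≤ LinearMap.range g) : Module.Finite k A := by
  have : Module.Finite k (LinearMap.ker f) := Submodule.finiteDimensional_of_le h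
  have : Module.Finite k (A ⧸ LinearMap.ker f) :=
    Module.Finite.equiv f.quotKerEquivRange.symm
  exact Module.Finite.of_submodule_quotient (LinearMap.ker f)

theorem finite_cohomology_of_finite (M : DGModule.{w} R) [Module.Finite k M.carrier] :
    Module.Finite k M.cohomology := by
  have : Module.Finite k M.cocycles := inferInstance
  infer_instance

/-- Modulo coboundaries, a space of cocycles is spanned by finitely many of its elements. -/
theorem exists_finset_cocycles {M : DGModule.{w} R} (hM : Module.Finite k M.cohomology)
    (Z : Submodule k M.carrier) (hZ : ∀ z ∈ Z, M.d z = 0) :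
    ∃ t : Finset M.carrier, ↑t ⊆ (Z : Set M.carrier) ∧
      Z ≤ Submodule.span k t ⊔ LinearMap.range M.d := by
  classical
  let q := (LinearMap.range M.d).mkQ
  let l : M.cohomology →ₗ[k] M.carrier ⧸ LinearMap.range M.d :=
    Submodule.mapQ _ _ M.cocycles.subtype (le_refl _)
  have hle : Submodule.span k (q '' (Z : Set M.carrier)) ≤ LinearMap.range l := by
    rw [Submodule.span_le]
    rintro _ ⟨z, hz, rfl⟩
    exact ⟨Submodule.Quotient.mk ⟨z, hZ z hz⟩, rfl⟩
  have : Module.Finite k (Submodule.span k (q '' (Z : Set M.carrier))) :=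
    Submodule.finiteDimensional_of_le hle
  obtain ⟨s, hs, hspan⟩ := (Submodule.fg_span_iff_fg_span_finset_subset _).1
    (Module.Finite.iff_fg.1 this)
  obtain ⟨t, ht, rfl⟩ := Finset.subset_set_image_iff.1 hs
  refine ⟨t, ht, fun z hz => ?_⟩
  have hqz : q z ∈ Submodule.span k (q '' (t : Set M.carrier)) := by
    rw [← Finset.coe_image, ← hspan]
    exact Submodule.subset_span ⟨z, hz, rfl⟩
  rw [← Submodule.map_span] at hqz
  obtain ⟨y, hy, hyz⟩ := hqz
  have : z - y ∈ LinearMap.range M.d := (Submodule.Quotient.eq _).1 hyz.symm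
  exact Submodule.mem_sup.2 ⟨y, hy, z - y, this, add_sub_cancel _ _⟩

/-- Finite dimensional total cohomology is concentrated in finitely many degrees. -/
theorem exists_finset_isAcyclicAt {M : DGModule.{w} R} (hM : Module.Finite k M.cohomology) :
    ∃ T : Finset ℤ, ∀ i ∉ T, M.IsAcyclicAt i := by
  classical
  obtain ⟨t, -, ht⟩ := exists_finset_cocycles hM (LinearMap.ker M.d) fun z hz => hz
  choose s _ hs' using M.exists_finset_proj
  refine ⟨t.biUnion s, fun i hi x hx hdx => ?_⟩
  obtain ⟨y, hy, _, ⟨z, rfl⟩, hyz⟩ := Submodule.mem_sup.1 (ht hdx)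
  have h0 : M.proj i y = 0 := by
    have : Submodule.span k (t : Set M.carrier) ≤ LinearMap.ker (M.proj i) := by
      rw [Submodule.span_le]
      intro m hm
      exact hs' m i fun h => hi (Finset.mem_biUnion.2 ⟨m, hm, h⟩)
    exact this hy
  refine ⟨M.proj (i - 1) z, ?_⟩
  rw [← proj_of_mem M hx, ← hyz, map_add, h0, zero_add, proj_d']

theorem exists_isAcyclicBelow {M : DGModule.{w} R} (hM : Module.Finite k M.cohomology) :
    ∃ a, M.IsAcyclicBelow a := by
  obtain ⟨T, hT⟩ := exists_finset_isAcyclicAt hM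
  obtain ⟨a, ha⟩ := T.bddBelow
  exact ⟨a, fun i hi => hT i fun h => by have := ha h; omega⟩

theorem exists_isAcyclicAbove {M : DGModule.{w} R} (hM : Module.Finite k M.cohomology) :
    ∃ b, M.IsAcyclicAbove b := by
  obtain ⟨T, hT⟩ := exists_finset_isAcyclicAt hM
  obtain ⟨b, hb⟩ := T.bddAbove
  exact ⟨b, fun i hi => hT i fun h => by have := hb h; omega⟩

theorem finite_cohomology_shift (n : ℤ) {M : DGModule.{w} R}
    (hM : Module.Finite k M.cohomology) : Module.Finite k (shift n M).cohomology := by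
  have hd : ∀ m, (shift n M).d (toShift n M m) = 0 ↔ M.d m = 0 := fun m => by
    rw [shift_d, smul_eq_zero_iff_eq, LinearEquiv.map_eq_zero_iff]
  let c : M.cocycles →ₗ[k] (shift n M).cocycles :=
    (toShift n M).toLinearMap.restrict fun m hm => (hd m).2 hm
  let l : M.cohomology →ₗ[k] (shift n M).cohomology := Submodule.mapQ _ _ c <| by
    rintro ⟨m, hm⟩ ⟨x, hx⟩
    refine ⟨toShift n M (n.negOnePow • x), ?_⟩
    have hx' : M.d x = m := hx
    rw [shift_d, units_smul_map]
    refine (congrArg (n.negOnePow • ·) (units_smul_map (toShift n M).toLinearMap _ _)).trans ?_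
    change n.negOnePow • n.negOnePow • toShift n M (M.d x) = toShift n M m
    rw [smul_smul, Int.units_mul_self, one_smul, hx']
  refine Module.Finite.of_surjective l fun y => ?_
  obtain ⟨⟨y, hy⟩, rfl⟩ := Submodule.Quotient.mk_surjective _ y
  obtain ⟨m, rfl⟩ := (toShift n M).surjective y
  exact ⟨Submodule.Quotient.mk ⟨m, (hd m).1 hy⟩, rfl⟩

theorem finite_cohomology_cone {M N : DGModule.{w} R} (f : M ⟶ N)
    (hM : Module.Finite k M.cohomology) (hN : Module.Finite k N.cohomology) :
    Module.Finite k (cone f).cohomology := by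
  have := finite_cohomology_shift 1 hM
  refine finite_of_ker_le_range (cohomologyMap (coneInl f)) (cohomologyMap (coneSnd f)) ?_
  intro y hy
  obtain ⟨⟨y, hy'⟩, rfl⟩ := Submodule.Quotient.mk_surjective _ y
  obtain ⟨n, m, rfl⟩ := coneMk_surj f y
  obtain ⟨x, hx⟩ := (Submodule.Quotient.mk_eq_zero _).1 hy
  obtain ⟨x, rfl⟩ := (toShift 1 M).surjective x
  have hx' : (shift 1 M).d (toShift 1 M x) = toShift 1 M m := hx
  have hm : m = -M.d x := (toShift 1 M).injective <| by
    rw [← hx', shift_d, map_neg]; simp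
  subst hm
  have hd : (cone f).d (coneMk f n (-M.d x)) = 0 := hy'
  rw [cone_d, ← coneMk_zero, coneMk_inj, map_neg, map_d] at hd
  refine ⟨Submodule.Quotient.mk ⟨n - lin f x, ?_⟩,
    (Submodule.Quotient.eq _).2 ⟨coneMk f 0 (-x), ?_⟩⟩
  · change N.d _ = 0
    rw [map_sub, sub_eq_add_neg, hd.1]
  · change (cone f).d _ = coneMk f (n - lin f x) 0 - coneMk f n (-M.d x)
    rw [cone_d, eq_sub_iff_add_eq, coneMk_add, coneMk_inj]
    constructor
    · simp [sub_eq_neg_add]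
    · simp

/-! ### Approximation by finite cellular DG modules -/

/-- The zero DG module. -/
def zeroModule {k : Type u} [CommRing k] (R : DGAlgebra.{v} k) : DGModule.{w} R where
  carrier := PUnit
  grading _ := ⊤
  isInternal := isInternal_of_proj (fun _ => 0) (fun _ _ _ => rfl) (fun _ _ _ _ _ => rfl)
    (eq_top_iff.2 fun _ _ => Submodule.mem_iSup_of_mem 0 trivial)
  smul_mem _ _ := trivial
  d := 0
  d_mem _ := trivial
  d_d _ := rfl
  leibniz _ _ := rfl

instance {k : Type u} [CommRing k] (R : DGAlgebra.{v} k) :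
    Subsingleton (zeroModule.{w} R).carrier := inferInstanceAs (Subsingleton PUnit)

section

variable (hneg : ∀ i : ℤ, i < 0 → R.grading i = ⊥)
    (hzero : ∀ a : R.carrier, a ∈ R.grading 0 → ∃ c : k, algebraMap k R.carrier c = a)
    (hone : R.grading 1 = ⊥) (hfin : Module.Finite k R.carrier)

include hneg hzero hone hfin

/-- Attaching a cell to `P` kills a nonzero cohomology class `z` of lowest degree `c` of the cone
of `π : P ⟶ M`, and creates no new classes in degrees `≤ c`. -/
theorem exists_attach {P M : DGModule.{v} R} (π : P ⟶ M) {c : ℤ}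
    (hP : Module.Finite k P.carrier) (hcell : P.IsCellularBelow (c + 1))
    (hπ : (cone π).IsAcyclicBelow c) {z : (cone π).carrier} (hz : z ∈ (cone π).grading c)
    (hdz : (cone π).d z = 0) (hz0 : ∀ y, z ≠ (cone π).d y) :
    ∃ (P' : DGModule.{v} R) (π' : P' ⟶ M) (κ : (cone π).carrier →ₗ[k] (cone π').carrier),
      Module.Finite k P'.carrier ∧ P'.IsCellularBelow (c + 1) ∧ (cone π').IsAcyclicBelow c ∧
      (∀ x, κ ((cone π).d x) = (cone π').d (κ x)) ∧
      (∀ x ∈ (cone π).grading c, κ x ∈ (cone π').grading c) ∧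
      (∀ y ∈ (cone π').grading c, (cone π').d y = 0 →
        ∃ x ∈ (cone π).grading c, (cone π).d x = 0 ∧ κ x = y) ∧
      ∃ y, κ z = (cone π').d y := by
  obtain ⟨m₀, p₀, rfl⟩ := coneMk_surj π z
  rw [coneMk_mem] at hz
  rw [cone_d, ← coneMk_zero, coneMk_inj, neg_eq_zero] at hdz
  obtain ⟨n, hn⟩ : ∃ n : ℤ, n = -(c + 1) := ⟨_, rfl⟩
  let g := cellHom n (p := p₀) (mem_grading_congr hz.2 (by omega)) hdz.2
  have hg : ∀ x, lin g x = cellMap n n p₀ x := fun _ => rfl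
  have hdm : M.d (-m₀) = lin π p₀ := by rw [map_neg, neg_eq_iff_add_eq_zero, hdz.1]
  obtain ⟨π', hπ', hπ''⟩ := exists_coneDesc g π (cellMap n (n + 1) (-m₀))
    (fun i x hx => mem_grading_congr (cellMap_mem n (n + 1) (Submodule.neg_mem _ hz.1) hx)
      (by omega))
    (fun i a x ha => by rw [cellMap_smul n (n + 1) _ ha, add_sub_cancel_left, one_mul])
    (fun x => by
      have h1 := d_cellMap n (n + 1) (-m₀) x
      have h2 := eq_cellMap n n ((lin π).restrictScalars k ∘ₗ cellMap n n p₀)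
        (fun i a x ha => by
          change lin π (cellMap n n p₀ (a • x)) = _ • a • lin π (cellMap n n p₀ x)
          rw [cellMap_smul n n _ ha, sub_self, zero_mul, Int.negOnePow_zero, one_smul, one_smul,
            map_smul]) x
      have h3 : lin π (cellMap n n p₀ x) = cellMap n n (lin π p₀) x := by
        refine h2.trans ?_
        rw [LinearMap.comp_apply, cellMap_one]
        rfl
      rw [h1, lin_comp, hg, h3, hdm, cellMap_add_two]
      simp)
  let κ : (cone π).carrier →ₗ[k] (cone π').carrier :=
    (LinearMap.id (M := M.carrier)).prodMap ((toShift 1 (cone g)).toLinearMap ∘ₗ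
      (lin (coneInl g)).restrictScalars k ∘ₗ (toShift 1 P).symm.toLinearMap)
  have hκ : ∀ m p, κ (coneMk π m p) = coneMk π' m (coneMk g p 0) := fun _ _ => rfl
  have hι : ∀ p, lin π' (coneMk g p 0) = lin π p := fun p => by rw [hπ'', map_zero, add_zero]
  have hκd : ∀ x, κ ((cone π).d x) = (cone π').d (κ x) := by
    intro x
    obtain ⟨m, p, rfl⟩ := coneMk_surj π x
    rw [cone_d, hκ, hκ, cone_d, hι, cone_d, map_zero, map_zero, add_zero, neg_zero]
    rw [coneMk_inj]
    refine ⟨rfl, ?_⟩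
    rw [eq_neg_iff_add_eq_zero, coneMk_add, ← coneMk_zero, coneMk_inj]
    simp
  -- in degrees `≤ c`, the only new elements are the multiples of the generator of the cell
  have hgen : ∀ i ≤ c, ∀ x ∈ (cell R n).grading (i + 1 + 1), ∃ a : k, x = a • cellMk R n 1 := by
    intro i hi x hx
    obtain ⟨r, rfl⟩ := (cellMk R n).surjective x
    rw [cellMk_mem] at hx
    rcases lt_trichotomy i (c - 1) with h | h | h
    · rw [hneg _ (by omega), Submodule.mem_bot] at hx
      exact ⟨0, by rw [hx, map_zero, zero_smul]⟩
    · rw [show i + 1 + 1 + n = 0 by omega] at hx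
      obtain ⟨a, rfl⟩ := hzero r hx
      exact ⟨a, by rw [← map_smul, Algebra.algebraMap_eq_smul_one]⟩
    · rw [show i + 1 + 1 + n = 1 by omega, hone, Submodule.mem_bot] at hx
      exact ⟨0, by rw [hx, map_zero, zero_smul]⟩
  have hcoc : ∀ i ≤ c, ∀ y ∈ (cone π').grading i, (cone π').d y = 0 →
      ∃ x ∈ (cone π).grading i, (cone π).d x = 0 ∧ κ x = y := by
    intro i hi y hy hdy
    obtain ⟨m, y', rfl⟩ := coneMk_surj π' y
    obtain ⟨p, x, rfl⟩ := coneMk_surj g y'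
    rw [coneMk_mem, coneMk_mem] at hy
    obtain ⟨a, rfl⟩ := hgen i hi x hy.2.2
    rw [cone_d, ← coneMk_zero, coneMk_inj, hπ'', map_smul, cellMap_one, neg_eq_zero, cone_d,
      ← coneMk_zero, coneMk_inj, hg, map_smul, cellMap_one] at hdy
    have hd : (cone π).d (coneMk π m p) = a • coneMk π m₀ p₀ := by
      rw [cone_d]
      change _ = coneMk π (a • m₀) (a • p₀)
      rw [coneMk_inj]
      have h1 := hdy.1
      have h2 := hdy.2.1
      rw [smul_neg, ← add_assoc, ← sub_eq_add_neg, sub_eq_zero] at h1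
      exact ⟨h1, by rw [neg_eq_iff_add_eq_zero, h2]⟩
    have ha : a = 0 := by
      by_contra ha
      apply hz0 (a⁻¹ • coneMk π m p)
      rw [map_smul, hd, smul_smul, inv_mul_cancel₀ ha, one_smul]
    subst ha
    exact ⟨coneMk π m p, (coneMk_mem π).2 ⟨hy.1, hy.2.1⟩, by rw [hd, zero_smul],
      by rw [hκ, zero_smul]⟩
  refine ⟨cone g, π', κ, ?_, hcell.cone g (by omega), ?_, hκd, ?_, hcoc c le_rfl,
    coneMk π' 0 (coneMk g 0 (-cellMk R n 1)), ?_⟩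
  · exact inferInstanceAs (Module.Finite k (P.carrier × R.carrier))
  · intro i hi y hy hdy
    obtain ⟨x, hx, hdx, rfl⟩ := hcoc i hi.le y hy hdy
    obtain ⟨w, rfl⟩ := hπ i hi x hx hdx
    exact ⟨κ w, hκd w⟩
  · intro x hx
    obtain ⟨m, p, rfl⟩ := coneMk_surj π x
    exact ⟨hx.1, hx.2, Submodule.zero_mem _⟩
  · rw [hκ, cone_d, coneMk_inj, hπ'', map_neg, cellMap_one, cone_d, hg, map_neg, cellMap_one,
      map_neg, cell_d_one]
    have e : -coneMk g (P.d 0 + -p₀) (- -0) = coneMk g (-(P.d 0 + -p₀)) (-(- -0)) := rfl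
    rw [e, coneMk_inj]
    simp

/-- Attaching finitely many cells kills the cohomology of the cone of `π` in its lowest degree `c`.
The list `l` holds cocycles of the cone spanning its cohomology in degree `c`. -/
theorem exists_attach_list {M : DGModule.{v} R} {c : ℤ} (n : ℕ) :
    ∀ (P : DGModule.{v} R) (π : P ⟶ M) (l : List (cone π).carrier), l.length = n →
      Module.Finite k P.carrier → P.IsCellularBelow (c + 1) → (cone π).IsAcyclicBelow c →
      (∀ z ∈ l, z ∈ (cone π).grading c ∧ (cone π).d z = 0) →
      (∀ z ∈ (cone π).grading c, (cone π).d z = 0 →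
        z ∈ Submodule.span k {z | z ∈ l} ⊔ LinearMap.range (cone π).d) →
      ∃ (P' : DGModule.{v} R) (π' : P' ⟶ M), Module.Finite k P'.carrier ∧
        P'.IsCellularBelow (c + 1) ∧ (cone π').IsAcyclicBelow (c + 1) := by
  induction n with
  | zero =>
    intro P π l hl hP hcell hπ _ hspan
    refine ⟨P, π, hP, hcell, fun i hi x hx hdx => ?_⟩
    rcases lt_or_eq_of_le (show i ≤ c by omega) with h | rfl
    · exact hπ i h x hx hdx
    · have := hspan x hx hdx
      rw [List.length_eq_zero_iff.1 hl] at this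
      simp only [List.not_mem_nil, Set.ofPred_false, Submodule.span_empty, bot_sup_eq] at this
      obtain ⟨y, rfl⟩ := this
      exact ⟨y, rfl⟩
  | succ n ih =>
    intro P π l hl hP hcell hπ hlc hspan
    obtain ⟨z, l, rfl⟩ := List.exists_cons_of_length_eq_add_one hl
    have hspan' : ∀ x ∈ (cone π).grading c, (cone π).d x = 0 →
        ∃ (a : k), ∃ y ∈ Submodule.span k {z | z ∈ l}, ∃ w, x = a • z + y + (cone π).d w := by
      intro x hx hdx
      have := hspan x hx hdx
      rw [show {x | x ∈ z :: l} = insert z {x | x ∈ l} by ext; simp] at this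
      obtain ⟨u, hu, _, ⟨w, rfl⟩, rfl⟩ := Submodule.mem_sup.1 this
      obtain ⟨a, y, hy, rfl⟩ := Submodule.mem_span_insert.1 hu
      exact ⟨a, y, hy, w, rfl⟩
    have hn : l.length = n := by simpa using hl
    by_cases hz : ∃ y, z = (cone π).d y
    · obtain ⟨z, rfl⟩ := hz
      refine ih P π l hn hP hcell hπ (fun x hx => hlc x (List.mem_cons_of_mem _ hx)) ?_
      intro x hx hdx
      obtain ⟨a, y, hy, w, rfl⟩ := hspan' x hx hdx
      exact Submodule.mem_sup.2 ⟨y, hy, _, ⟨a • z + w, rfl⟩, by rw [map_add, map_smul]; abel⟩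
    · have hzl := hlc z List.mem_cons_self
      obtain ⟨P', π', κ, hP', hcell', hπ', hκd, hκc, hκs, w₀, hw₀⟩ :=
        exists_attach hneg hzero hone hfin π hP hcell hπ hzl.1 hzl.2 (not_exists.1 hz)
      refine ih P' π' (l.map κ) (by rw [List.length_map, hn]) hP' hcell' hπ' ?_ ?_
      · intro x hx
        obtain ⟨y, hy, rfl⟩ := List.mem_map.1 hx
        have := hlc y (List.mem_cons_of_mem _ hy)
        exact ⟨hκc y this.1, by rw [← hκd, this.2, map_zero]⟩
      · intro x hx hdx
        obtain ⟨x', hx', hdx', rfl⟩ := hκs x hx hdx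
        obtain ⟨a, y, hy, w, rfl⟩ := hspan' x' hx' hdx'
        refine Submodule.mem_sup.2 ⟨κ y, ?_, _, ⟨a • w₀ + κ w, rfl⟩, ?_⟩
        · have : κ y ∈ Submodule.map κ (Submodule.span k {z | z ∈ l}) := ⟨y, hy, rfl⟩
          rw [Submodule.map_span] at this
          refine Submodule.span_mono ?_ this
          rintro _ ⟨y, hy, rfl⟩
          exact List.mem_map.2 ⟨y, hy, rfl⟩
        · rw [map_add, map_add, map_add, map_smul, map_smul, hw₀, hκd]; abel

/-- Each DG module with finite dimensional cohomology is approximated in degrees `< c` by a finite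
dimensional cellular DG module. -/
theorem exists_approximation {M : DGModule.{v} R} (hM : Module.Finite k M.cohomology) (c : ℤ) :
    ∃ (P : DGModule.{v} R) (π : P ⟶ M), Module.Finite k P.carrier ∧ P.IsCellularBelow c ∧
      IsTruncEquiv π c := by
  obtain ⟨a, ha, hac⟩ : ∃ a, M.IsAcyclicBelow a ∧ a ≤ c := by
    obtain ⟨a, ha⟩ := exists_isAcyclicBelow hM
    exact ⟨min a c, ha.mono (min_le_left _ _), min_le_right _ _⟩
  suffices h : ∀ j : ℕ, ∃ (P : DGModule.{v} R) (π : P ⟶ M), Module.Finite k P.carrier ∧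
      P.IsCellularBelow (a + j) ∧ IsTruncEquiv π (a + j) by
    have := h (c - a).toNat
    rwa [show a + ((c - a).toNat : ℤ) = c by omega] at this
  intro j
  induction j with
  | zero =>
    refine ⟨zeroModule R, 0, inferInstanceAs (Module.Finite k PUnit.{v + 1}),
      fun C _ f => ?_, fun i _ => ?_, fun i hi => ?_⟩
    · rw [show f = 0 from hom_ext fun m => (congrArg (lin f) (Subsingleton.elim m 0)).trans
        (map_zero _)]
      exact NullHomotopic.zero _ _
    · exact fun x _ _ _ _ => ⟨0, Subsingleton.elim _ _⟩
    · exact (ha i (by omega)).surjAt _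
  | succ j ih =>
    obtain ⟨P, π, hP, hcell, hπ⟩ := ih
    rw [Nat.cast_succ, ← add_assoc]
    generalize a + (j : ℤ) = c at hcell hπ
    have hC := finite_cohomology_cone π (finite_cohomology_of_finite P) hM
    obtain ⟨t, ht, hspan⟩ := exists_finset_cocycles hC
      ((cone π).grading c ⊓ LinearMap.ker (cone π).d) fun z hz => hz.2
    obtain ⟨P', π', hP', hcell', hπ'⟩ := exists_attach_list hneg hzero hone hfin (c := c) _ P π
      t.toList rfl hP (hcell.mono (by omega)) hπ.isAcyclicBelow_cone
      (fun z hz => ht (by simpa using hz))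
      (fun z hz hdz => by simpa using hspan ⟨hz, hdz⟩)
    exact ⟨P', π', hP', hcell', IsTruncEquiv.of_isAcyclicBelow_cone hπ'⟩

end

/-! ### Finiteness of morphism spaces and splitting of idempotents -/

instance finite_hom_of_finite (P N : DGModule.{w} R) [Module.Finite k P.carrier]
    [Module.Finite k N.carrier] : Module.Finite k (P ⟶ N) := by
  let l : (P ⟶ N) →ₗ[k] (P.carrier →ₗ[k] N.carrier) :=
    { toFun := fun f => (lin f).restrictScalars k
      map_add' := fun _ _ => rfl
      map_smul' := fun _ _ => rfl }
  exact Module.Finite.of_injective l fun f g h => hom_ext fun m => LinearMap.congr_fun h m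

theorem IsTruncEquiv.succ {M N : DGModule.{w} R} {f : M ⟶ N} {c : ℤ} (h : IsTruncEquiv f c)
    (hM : M.IsAcyclicAt (c + 1)) (hN : N.IsAcyclicAt c) : IsTruncEquiv f (c + 1) where
  injAt i hi := by
    rcases lt_or_eq_of_le hi with hi | rfl
    · exact h.injAt i (by omega)
    · exact hM.injAt f
  surjAt i hi := by
    rcases lt_or_eq_of_le (show i ≤ c by omega) with hi | rfl
    · exact h.surjAt i hi
    · exact hN.surjAt f

/-- If `h` lifts an idempotent `e` along `π`, so does each positive power of `h`. -/
theorem ofModule_map_pow_comp {P M : DGModule.{w} R} {h : P ⟶ P} {π : P ⟶ M}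
    {e : (ofModule R).obj M ⟶ (ofModule R).obj M} (he : e ≫ e = e)
    (hh : (ofModule R).map (h ≫ π) = (ofModule R).map π ≫ e) (n : ℕ) :
    ∃ g : P ⟶ P, (∀ x, lin g x = (((lin h).restrictScalars k) ^ (n + 1)) x) ∧
      (ofModule R).map (g ≫ π) = (ofModule R).map π ≫ e := by
  induction n with
  | zero => exact ⟨h, fun x => by rw [zero_add, pow_one]; rfl, hh⟩
  | succ n ih =>
    obtain ⟨g, hg, hgπ⟩ := ih
    refine ⟨h ≫ g, fun x => ?_, ?_⟩
    · rw [lin_comp, hg, pow_succ _ (n + 1)]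
      rfl
    · rw [Category.assoc, Functor.map_comp, hgπ, ← Category.assoc, ← Functor.map_comp, hh,
        Category.assoc, he]

/-- Fitting's lemma for an endomorphism `g` with `P = ker g ⊕ im g`: it is an automorphism of its
image. -/
theorem bijective_image_of_isCompl {P I : DGModule.{w} R} {g : P ⟶ P} {p : P ⟶ I} {i : I ⟶ P}
    (hpi : p ≫ i = g) (hp : Function.Surjective (lin p)) (hi : Function.Injective (lin i))
    (hg : IsCompl (LinearMap.ker (lin g)) (LinearMap.range (lin g))) :
    Function.Bijective (lin (i ≫ p)) := by
  subst hpi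
  constructor
  · rw [injective_iff_map_eq_zero]
    intro x hx
    obtain ⟨y, rfl⟩ := hp x
    have h1 : lin i (lin p y) ∈ LinearMap.ker (lin (p ≫ i)) := by
      rw [LinearMap.mem_ker, lin_comp, ← lin_comp i p, hx, map_zero]
    exact hi ((Submodule.disjoint_def.1 hg.disjoint _ h1 ⟨y, rfl⟩).trans (map_zero _).symm)
  · intro y
    obtain ⟨x, rfl⟩ := hp y
    have : x ∈ LinearMap.ker (lin (p ≫ i)) ⊔ LinearMap.range (lin (p ≫ i)) := by
      rw [hg.sup_eq_top]; trivial
    obtain ⟨a, ha, _, ⟨z, rfl⟩, rfl⟩ := Submodule.mem_sup.1 this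
    have ha' : lin p a = 0 := hi (by rw [map_zero]; exact ha)
    exact ⟨lin p z, by rw [map_add, ha', zero_add]; rfl⟩

theorem bijective_cohomologyMap_of_bijective {M N : DGModule.{w} R} {f : M ⟶ N}
    (hf : Function.Bijective (lin f)) : Function.Bijective (cohomologyMap f) := by
  rw [cohomologyMap_bijective_iff]
  constructor
  · intro m _ n hn
    obtain ⟨x, rfl⟩ := hf.2 n
    exact ⟨x, hf.1 (by rw [hn, map_d])⟩
  · intro n hn
    obtain ⟨m, rfl⟩ := hf.2 n
    exact ⟨m, hf.1 (by rw [map_d, hn, map_zero]), 0, by rw [map_zero, add_zero]⟩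

theorem InjAt.of_comp {M N P : DGModule.{w} R} {f : M ⟶ N} {g : N ⟶ P} {i : ℤ}
    (h : InjAt (f ≫ g) i) : InjAt f i := fun x hx hdx y hy =>
  h x hx hdx (lin g y) (by rw [lin_comp, hy, map_d])

section

variable (hneg : ∀ i : ℤ, i < 0 → R.grading i = ⊥)
    (hzero : ∀ a : R.carrier, a ∈ R.grading 0 → ∃ c : k, algebraMap k R.carrier c = a)
    (hone : R.grading 1 = ⊥) (hfin : Module.Finite k R.carrier)

include hneg hzero hone hfin

/-- If `P` and `P'` approximate `M` and `N` up to the top degree of the cohomology of `N`, then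
`Hom(M, N)` embeds into `Hom(P, N)`, which is a quotient of the space of morphisms of DG modules
from `P` to `P'`. -/
theorem finite_hom {M N : DGModule.{v} R} (hM : Module.Finite k M.cohomology)
    (hN : Module.Finite k N.cohomology) :
    Module.Finite k ((ofModule R).obj M ⟶ (ofModule R).obj N) := by
  obtain ⟨b, hb⟩ := exists_isAcyclicAbove hN
  obtain ⟨P, π, hP, hPc, hπ⟩ := exists_approximation hneg hzero hone hfin hM (b + 1)
  obtain ⟨P', π', hP', -, hπ'⟩ := exists_approximation hneg hzero hone hfin hN (b + 1)
  let Φ : (P ⟶ P') →ₗ[k] ((ofModule R).obj P ⟶ (ofModule R).obj N) :=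
    (ofModule R).mapLinearMap k ∘ₗ Linear.rightComp k P π'
  have hΦ : Function.Surjective Φ := by
    intro φ
    obtain ⟨f, rfl⟩ := hPc.ofModule_map_surjective φ
    obtain ⟨g, hg⟩ := hPc.exists_lift hπ' f
    exact ⟨g, (ofModule_map_eq_of_nullHomotopic hg).symm⟩
  have := Module.Finite.of_surjective Φ hΦ
  exact Module.Finite.of_injective
    (Linear.leftComp k ((ofModule R).obj N) ((ofModule R).map π))
    fun φ ψ h => hπ.precomp_injective hneg hzero hb (lt_add_one b) h

/-- Idempotents split on objects with finite dimensional cohomology: such an idempotent lifts to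
a finite approximation `P`, where it is split by Fitting's lemma, and one truncates the summand. -/
theorem exists_splitting {M : DGModule.{v} R} (hM : Module.Finite k M.cohomology)
    (e : (ofModule R).obj M ⟶ (ofModule R).obj M) (he : e ≫ e = e) :
    ∃ (Y : DGModule.{v} R) (i : (ofModule R).obj Y ⟶ (ofModule R).obj M)
      (p : (ofModule R).obj M ⟶ (ofModule R).obj Y), i ≫ p = 𝟙 _ ∧ p ≫ i = e := by
  obtain ⟨b, hb⟩ := exists_isAcyclicAbove hM
  obtain ⟨P, π, hP, hPc, hπ⟩ := exists_approximation hneg hzero hone hfin hM (b + 2)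
  obtain ⟨f, hf⟩ := hPc.ofModule_map_surjective ((ofModule R).map π ≫ e)
  obtain ⟨h, hh⟩ := hPc.exists_lift hπ f
  have hh' : (ofModule R).map (h ≫ π) = (ofModule R).map π ≫ e := by
    rw [← hf, ofModule_map_eq_of_nullHomotopic hh]
  obtain ⟨n, hn⟩ := Filter.eventually_atTop.1
    (LinearMap.eventually_isCompl_ker_pow_range_pow ((lin h).restrictScalars k))
  obtain ⟨g, hg, hgπ⟩ := ofModule_map_pow_comp he hh' n
  obtain ⟨I, p, i, hpi, hp, hi⟩ := GradedSub.exists_image_fac g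
  have hcompl : IsCompl (LinearMap.ker (lin g)) (LinearMap.range (lin g)) := by
    have hn' := hn (n + 1) (Nat.le_succ n)
    have e1 : ((lin h).restrictScalars k) ^ (n + 1) = (lin g).restrictScalars k :=
      LinearMap.ext fun x => (hg x).symm
    rw [e1] at hn'
    rw [isCompl_iff, Submodule.disjoint_def, codisjoint_iff, eq_top_iff]
    refine ⟨fun x hx hx' => Submodule.disjoint_def.1 hn'.disjoint x hx hx', fun x _ => ?_⟩
    have : x ∈ LinearMap.ker ((lin g).restrictScalars k) ⊔
        LinearMap.range ((lin g).restrictScalars k) := by rw [hn'.sup_eq_top]; trivial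
    obtain ⟨y, hy, z, hz, rfl⟩ := Submodule.mem_sup.1 this
    exact Submodule.mem_sup.2 ⟨y, hy, z, hz, rfl⟩
  have hu := bijective_cohomologyMap_of_bijective
    (bijective_image_of_isCompl hpi hp hi hcompl)
  have hI : ∀ j, b < j → j ≤ b + 2 → I.IsAcyclicAt j := fun j h1 h2 =>
    ((hb j h1).of_injAt (hπ.injAt j h2)).of_injAt (injAt_of_bijective hu j).of_comp
  obtain ⟨Y, q, hY, hq⟩ := (hI (b + 1) (by omega) (by omega)).exists_truncAbove hneg hzero
  have hq2 : IsTruncEquiv q (b + 2) := by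
    have := hq.succ (hI _ (by omega) (by omega)) (hY _ (by omega))
    rwa [add_assoc] at this
  have := isIso_ofModule_map hu
  -- `α ≫ β` restricts along `π` to `p ≫ i ≫ π = g ≫ π`, as does `e`
  obtain ⟨α, hα⟩ := hπ.exists_precomp_eq hneg hzero hY le_rfl ((ofModule R).map (p ≫ q))
  obtain ⟨β, hβ⟩ := hq2.exists_precomp_eq hneg hzero hb le_rfl ((ofModule R).map (i ≫ π))
  obtain ⟨v, hv⟩ := hq2.exists_precomp_eq hneg hzero hY le_rfl
    (inv ((ofModule R).map (i ≫ p)) ≫ (ofModule R).map q)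
  have hαβ : α ≫ β = e := by
    refine hπ.precomp_injective hneg hzero hb (by omega) ?_
    rw [← Category.assoc, hα, ← hgπ, ← hpi, Functor.map_comp, Category.assoc, hβ,
      ← Functor.map_comp, Category.assoc]
  have hβα : (ofModule R).map q ≫ β ≫ α = (ofModule R).map (i ≫ p) ≫ (ofModule R).map q := by
    rw [← Category.assoc, hβ, Functor.map_comp, Category.assoc, hα, ← Functor.map_comp,
      ← Functor.map_comp, Category.assoc]
  -- `v` is a one-sided inverse of `β ≫ α`, whose cube equals its square as `α ≫ β` is idempotent
  refine ⟨Y, β, α, ?_, hαβ⟩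
  have h1 : (β ≫ α) ≫ (β ≫ α) ≫ (β ≫ α) = (β ≫ α) ≫ (β ≫ α) := by
    simp only [Category.assoc]
    rw [← Category.assoc α β, ← Category.assoc α β, hαβ, ← Category.assoc e e, he]
  have h2 : v ≫ (β ≫ α) = 𝟙 _ := by
    refine hq.precomp_injective hneg hzero hY (by omega) ?_
    rw [← Category.assoc, hv, Category.assoc, hβα, IsIso.inv_hom_id_assoc, Category.comp_id]
  calc β ≫ α = v ≫ v ≫ ((β ≫ α) ≫ (β ≫ α) ≫ (β ≫ α)) := by
        rw [← Category.assoc v (β ≫ α), h2, Category.id_comp, ← Category.assoc v (β ≫ α), h2,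
          Category.id_comp]
    _ = 𝟙 _ := by rw [h1, ← Category.assoc v (β ≫ α), h2, Category.id_comp, h2]

end

/-! ### The subcategories `Dᶠ(R)` and `Dᶜ(R)` -/

theorem quasiIso_inverts (R : DGAlgebra.{v} k) :
    (quasiIso.{w} R).IsInvertedBy (cohomologyK R) := fun _ _ _ hf => hf

/-- The total cohomology as a functor on the derived category. -/
noncomputable def cohomologyD (R : DGAlgebra.{v} k) : DerivedCat.{w} R ⥤ ModuleCat.{w} k :=
  Localization.lift (cohomologyK R) (quasiIso_inverts R) (toD R)

/-- The cohomology functor on the derived category extends that on DG modules. -/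
noncomputable def cohomologyDIso (M : DGModule.{w} R) :
    (cohomologyD R).obj ((ofModule R).obj M) ≅ ModuleCat.of k M.cohomology :=
  (Localization.fac (cohomologyK R) (quasiIso_inverts R) (toD R)).app ((toK R).obj M)

theorem exists_ofModule_obj_iso (X : DerivedCat.{w} R) :
    ∃ M : DGModule.{w} R, Nonempty ((ofModule R).obj M ≅ X) :=
  ⟨((toD R).objPreimage X).as, ⟨(toD R).objObjPreimageIso X⟩⟩

theorem finite_cohomology_of_retract {M N : DGModule.{w} R}
    (i : (ofModule R).obj M ⟶ (ofModule R).obj N) (p : (ofModule R).obj N ⟶ (ofModule R).obj M)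
    (hip : i ≫ p = 𝟙 _) (hN : Module.Finite k N.cohomology) : Module.Finite k M.cohomology := by
  let l : ModuleCat.of k M.cohomology ⟶ ModuleCat.of k N.cohomology :=
    (cohomologyDIso M).inv ≫ (cohomologyD R).map i ≫ (cohomologyDIso N).hom
  have hl : l ≫ (cohomologyDIso N).inv ≫ (cohomologyD R).map p ≫ (cohomologyDIso M).hom =
      𝟙 _ := by
    simp only [l, Category.assoc, Iso.hom_inv_id_assoc]
    rw [← Functor.map_comp_assoc, hip, CategoryTheory.Functor.map_id, Category.id_comp,
      Iso.inv_hom_id]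
  refine Module.Finite.of_injective l.hom fun x y h => ?_
  have := fun z => ConcreteCategory.congr_hom hl z
  simp only [ConcreteCategory.comp_apply] at this
  have hx := this x
  have hy := this y
  change (ConcreteCategory.hom l) x = (ConcreteCategory.hom l) y at h
  rw [h, hy] at hx
  exact hx.symm

/-- Whether an object of `D(R)` has finite cohomology does not depend on the DG module
representing it. -/
theorem isFinite_iff {X : DerivedCat.{w} R} {M : DGModule.{w} R}
    (e : (ofModule R).obj M ≅ X) : isFinite R X ↔ Module.Finite k M.cohomology := by
  refine ⟨?_, fun h => ⟨M, h, ⟨e⟩⟩⟩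
  rintro ⟨N, hN, ⟨e'⟩⟩
  exact finite_cohomology_of_retract (e.hom ≫ e'.inv) (e'.hom ≫ e.inv) (by simp) hN

theorem isFinite_of_retract {X Y : DerivedCat.{w} R} (r : Retract X Y) (hY : isFinite R Y) :
    isFinite R X := by
  obtain ⟨M, ⟨e⟩⟩ := exists_ofModule_obj_iso X
  obtain ⟨N, hN, ⟨e'⟩⟩ := hY
  exact (isFinite_iff e).2 (finite_cohomology_of_retract (e.hom ≫ r.i ≫ e'.inv)
    (e'.hom ≫ r.r ≫ e.inv) (by simp) hN)

theorem isFinite_shift (n : ℤ) {X : DerivedCat.{w} R} (hX : isFinite R X) :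
    isFinite R ((shiftD R n).obj X) := by
  obtain ⟨M, hM, ⟨e⟩⟩ := hX
  exact ⟨shift n M, finite_cohomology_shift n hM,
    ⟨(shiftDIso n M).symm ≪≫ (shiftD R n).mapIso e⟩⟩

theorem isFinite_of_isDistinguished {X Y Z : DerivedCat.{w} R} {f : X ⟶ Y} {g : Y ⟶ Z}
    {h : Z ⟶ (shiftD R 1).obj X} (hfgh : IsDistinguished f g h) (hX : isFinite R X)
    (hY : isFinite R Y) : isFinite R Z := by
  obtain ⟨M, N, φ, a, b, c, -⟩ := hfgh
  exact ⟨cone φ, finite_cohomology_cone φ ((isFinite_iff a).1 hX) ((isFinite_iff b).1 hY), ⟨c⟩⟩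

/-- The projection to the first factor. -/
def prodFst (M N : DGModule.{w} R) : prod M N ⟶ M where
  toLin := LinearMap.fst R.carrier M.carrier N.carrier
  map_mem h := h.1
  map_d _ := rfl

/-- The projection to the second factor. -/
def prodSnd (M N : DGModule.{w} R) : prod M N ⟶ N where
  toLin := LinearMap.snd R.carrier M.carrier N.carrier
  map_mem h := h.2
  map_d _ := rfl

theorem prod_total (M N : DGModule.{w} R) :
    prodFst M N ≫ prodInl M N + prodSnd M N ≫ prodInr M N = 𝟙 _ :=
  hom_ext fun m => Prod.ext (add_zero m.1) (zero_add m.2)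

theorem finite_cohomology_prod {M N : DGModule.{w} R} (hM : Module.Finite k M.cohomology)
    (hN : Module.Finite k N.cohomology) : Module.Finite k (prod M N).cohomology := by
  refine finite_of_ker_le_range (cohomologyMap (prodInl M N)) (cohomologyMap (prodSnd M N)) ?_
  intro y hy
  obtain ⟨⟨⟨m, n⟩, hy'⟩, rfl⟩ := Submodule.Quotient.mk_surjective _ y
  obtain ⟨x, hx⟩ := (Submodule.Quotient.mk_eq_zero _).1 hy
  have hx' : N.d x = n := hx
  have hm : M.d m = 0 := congrArg Prod.fst hy'
  refine ⟨Submodule.Quotient.mk ⟨m, hm⟩, (Submodule.Quotient.eq _).2 ⟨prodMk 0 (-x), ?_⟩⟩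
  refine Prod.ext ?_ ?_
  · change M.d 0 = m - m
    simp
  · change N.d (-x) = 0 - n
    rw [map_neg, hx', zero_sub]

/-- The product of DG modules gives biproducts in the derived category. -/
theorem exists_bicone (X Y : DerivedCat.{w} R) :
    ∃ b : BinaryBicone X Y, Nonempty b.IsBilimit ∧ (isFinite R X → isFinite R Y →
      isFinite R b.pt) := by
  obtain ⟨M, ⟨e⟩⟩ := exists_ofModule_obj_iso X
  obtain ⟨N, ⟨e'⟩⟩ := exists_ofModule_obj_iso Y
  have h1 : (ofModule R).map (prodInl M N) ≫ (ofModule R).map (prodFst M N) = 𝟙 _ :=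
    ((ofModule R).map_comp _ _).symm.trans ((ofModule R).map_id _)
  have h2 : (ofModule R).map (prodInr M N) ≫ (ofModule R).map (prodSnd M N) = 𝟙 _ :=
    ((ofModule R).map_comp _ _).symm.trans ((ofModule R).map_id _)
  have h3 : (ofModule R).map (prodInl M N) ≫ (ofModule R).map (prodSnd M N) = 0 :=
    ((ofModule R).map_comp _ _).symm.trans ((ofModule R).map_zero _ _)
  have h4 : (ofModule R).map (prodInr M N) ≫ (ofModule R).map (prodFst M N) = 0 :=
    ((ofModule R).map_comp _ _).symm.trans ((ofModule R).map_zero _ _)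
  have h5 : (ofModule R).map (prodFst M N) ≫ (ofModule R).map (prodInl M N) +
      (ofModule R).map (prodSnd M N) ≫ (ofModule R).map (prodInr M N) = 𝟙 _ := by
    rw [← Functor.map_comp, ← Functor.map_comp, ← Functor.map_add, prod_total,
      CategoryTheory.Functor.map_id]
  refine ⟨
    { pt := (ofModule R).obj (prod M N)
      fst := (ofModule R).map (prodFst M N) ≫ e.hom
      snd := (ofModule R).map (prodSnd M N) ≫ e'.hom
      inl := e.inv ≫ (ofModule R).map (prodInl M N)
      inr := e'.inv ≫ (ofModule R).map (prodInr M N)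
      inl_fst := by rw [Category.assoc, ← Category.assoc _ _ e.hom, h1]; simp
      inl_snd := by rw [Category.assoc, ← Category.assoc _ _ e'.hom, h3]; simp
      inr_fst := by rw [Category.assoc, ← Category.assoc _ _ e.hom, h4]; simp
      inr_snd := by rw [Category.assoc, ← Category.assoc _ _ e'.hom, h2]; simp },
    ⟨isBinaryBilimitOfTotal _ ?_⟩, fun hX hY => ?_⟩
  · simp only [Category.assoc, Iso.hom_inv_id_assoc]
    exact h5
  · exact ⟨prod M N, finite_cohomology_prod ((isFinite_iff e).1 hX) ((isFinite_iff e').1 hY),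
      ⟨Iso.refl _⟩⟩

theorem isFinite_coprod {X Y Z : DerivedCat.{w} R} (i : X ⟶ Z) (j : Y ⟶ Z)
    (hZ : IsColimit (BinaryCofan.mk i j)) (hX : isFinite R X) (hY : isFinite R Y) :
    isFinite R Z := by
  obtain ⟨b, ⟨hb⟩, hfin⟩ := exists_bicone X Y
  obtain ⟨M, hM, ⟨e⟩⟩ := hfin hX hY
  exact ⟨M, hM, ⟨e ≪≫ hb.isColimit.coconePointUniqueUpToIso hZ⟩⟩

theorem isZero_zeroModule : IsZero ((ofModule R).obj (zeroModule.{w} R)) := by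
  rw [Limits.IsZero.iff_id_eq_zero, ← CategoryTheory.Functor.map_id,
    show 𝟙 (zeroModule.{w} R) = 0 from
    hom_ext fun m => Subsingleton.elim (α := (zeroModule.{w} R).carrier) _ _, Functor.map_zero]

/-- `Dᶜ(R)` is contained in `Dᶠ(R)`, as `R` is finite dimensional. -/
theorem isFinite_of_isCompact (hfin : Module.Finite k R.carrier) {X : DerivedCat.{v} R}
    (hX : isCompact R X) : isFinite R X := by
  induction hX with
  | base =>
    have : Module.Finite k (regular R).carrier := hfin
    exact ⟨regular R, finite_cohomology_of_finite _, ⟨Iso.refl _⟩⟩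
  | shift n _ ih => exact isFinite_shift n ih
  | coprod i j hZ _ _ hX hY => exact isFinite_coprod i j hZ.some hX hY
  | summand r _ ih => exact isFinite_of_retract r ih
  | triangle f g h hfgh _ _ hX hY => exact isFinite_of_isDistinguished hfgh hX hY

end DGModule

/-! ### Full subcategories -/

section FullSubcategory

variable {C : Type u} [Category.{v} C] [Preadditive C] (P : ObjectProperty C)

/-- A full subcategory of a preadditive category which is closed under biproducts has finite
biproducts. -/
theorem hasFiniteBiproducts_fullSubcategory
    (hb : ∀ X Y : C, P X → P Y → ∃ b : BinaryBicone X Y, Nonempty b.IsBilimit ∧ P b.pt)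
    (h0 : ∃ Z, IsZero Z ∧ P Z) : HasFiniteBiproducts P.FullSubcategory := by
  have : HasBinaryBiproducts P.FullSubcategory := ⟨fun X Y => by
    obtain ⟨b, ⟨hb⟩, hP⟩ := hb X.obj Y.obj X.property Y.property
    have hι := IsBilimit.binary_total hb
    exact hasBinaryBiproduct_of_total
      { pt := ⟨b.pt, hP⟩
        fst := ObjectProperty.homMk b.fst
        snd := ObjectProperty.homMk b.snd
        inl := ObjectProperty.homMk b.inl
        inr := ObjectProperty.homMk b.inr
        inl_fst := ObjectProperty.hom_ext _ b.inl_fst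
        inl_snd := ObjectProperty.hom_ext _ b.inl_snd
        inr_fst := ObjectProperty.hom_ext _ b.inr_fst
        inr_snd := ObjectProperty.hom_ext _ b.inr_snd } (ObjectProperty.hom_ext _ hι)⟩
  obtain ⟨Z, hZ, hPZ⟩ := h0
  have h : IsZero (⟨Z, hPZ⟩ : P.FullSubcategory) := by
    rw [IsZero.iff_id_eq_zero]
    exact ObjectProperty.hom_ext _ ((IsZero.iff_id_eq_zero _).1 hZ)
  have : HasZeroObject P.FullSubcategory := ⟨⟨_, h⟩⟩
  have : HasFiniteProducts P.FullSubcategory := hasFiniteProducts_of_has_binary_and_terminal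
  exact HasFiniteBiproducts.of_hasFiniteProducts

end FullSubcategory

namespace DGModule

variable {k : Type u} [Field k] {R : DGAlgebra.{v} k}

section

variable (hneg : ∀ i : ℤ, i < 0 → R.grading i = ⊥)
    (hzero : ∀ a : R.carrier, a ∈ R.grading 0 → ∃ c : k, algebraMap k R.carrier c = a)
    (hone : R.grading 1 = ⊥) (hfin : Module.Finite k R.carrier)
    {P : ObjectProperty (DerivedCat.{v} R)} (hP : ∀ X, P X → isFinite R X)

include hneg hzero hone hfin hP

theorem finite_hom_fullSubcategory (X Y : P.FullSubcategory) : Module.Finite k (X ⟶ Y) := by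
  obtain ⟨M, hM, ⟨e⟩⟩ := hP _ X.property
  obtain ⟨N, hN, ⟨e'⟩⟩ := hP _ Y.property
  have := finite_hom hneg hzero hone hfin hM hN
  have : Module.Finite k (X.obj ⟶ Y.obj) := Module.Finite.equiv (Linear.homCongr k e e')
  have : Module.Finite k (P.ι.obj X ⟶ P.ι.obj Y) := this
  exact Module.Finite.of_injective (P.ι.mapLinearMap k (X := X) (Y := Y)) P.ι.map_injective

theorem isIdempotentComplete_fullSubcategory (hr : ∀ X Y, Retract X Y → P Y → P X) :
    IsIdempotentComplete P.FullSubcategory where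
  idempotents_split X e he := by
    obtain ⟨M, hM, ⟨a⟩⟩ := hP _ X.property
    have he' : e.hom ≫ e.hom = e.hom := congrArg InducedCategory.Hom.hom he
    obtain ⟨Y, i, p, hip, hpi⟩ := exists_splitting hneg hzero hone hfin hM
      (a.hom ≫ e.hom ≫ a.inv) (by simp [reassoc_of% he'])
    have h1 : (i ≫ a.hom) ≫ a.inv ≫ p = 𝟙 _ := by simpa using hip
    have h2 : (a.inv ≫ p) ≫ i ≫ a.hom = e.hom := by
      rw [Category.assoc, ← Category.assoc p, hpi]
      simp
    exact ⟨⟨_, hr _ X.obj ⟨i ≫ a.hom, a.inv ≫ p, h1⟩ X.property⟩,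
      ObjectProperty.homMk (i ≫ a.hom), ObjectProperty.homMk (a.inv ≫ p),
      ObjectProperty.hom_ext _ h1, ObjectProperty.hom_ext _ h2⟩

end

end DGModule

/-! ### Krull-Schmidt categories -/

section LocalRings

theorem exists_isUnit_of_isUnit_sum {A ι : Type*} [Ring A] [IsLocalRing A] (s : Finset ι)
    (a : ι → A) (h : IsUnit (∑ i ∈ s, a i)) : ∃ i ∈ s, IsUnit (a i) := by
  classical
  induction s using Finset.induction_on with
  | empty => simp at h
  | insert i s hi ih =>
    rw [Finset.sum_insert hi] at h
    obtain ⟨u, hu⟩ := h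
    have h1 : ↑u⁻¹ * a i + ↑u⁻¹ * ∑ j ∈ s, a j = 1 := by
      rw [← mul_add, ← hu, Units.inv_mul]
    rcases IsLocalRing.isUnit_or_isUnit_of_add_one h1 with h2 | h2
    · exact ⟨i, Finset.mem_insert_self _ _, (Units.isUnit_units_mul _ _).1 h2⟩
    · obtain ⟨j, hj, h⟩ := ih ((Units.isUnit_units_mul _ _).1 h2)
      exact ⟨j, Finset.mem_insert_of_mem hj, h⟩

/-- A finite dimensional algebra without nontrivial idempotents is local, by Fitting's lemma. -/
theorem isLocalRing_of_idempotents {k A : Type*} [Field k] [Ring A] [Algebra k A]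
    [Module.Finite k A] [Nontrivial A] (h : ∀ e : A, e * e = e → e = 0 ∨ e = 1) :
    IsLocalRing A := by
  have key : ∀ a : A, IsUnit a ∨ IsNilpotent a := by
    intro a
    obtain ⟨n, hn⟩ := Filter.eventually_atTop.1
      (LinearMap.eventually_isCompl_ker_pow_range_pow (LinearMap.mulLeft k a))
    have hc := hn (n + 1) (Nat.le_succ n)
    rw [LinearMap.pow_mulLeft] at hc
    have h1 : (1 : A) ∈ LinearMap.ker (LinearMap.mulLeft k (a ^ (n + 1))) ⊔
        LinearMap.range (LinearMap.mulLeft k (a ^ (n + 1))) := by rw [hc.sup_eq_top]; trivial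
    obtain ⟨x, hx, _, ⟨y, rfl⟩, hxy⟩ := Submodule.mem_sup.1 h1
    rw [LinearMap.mem_ker, LinearMap.mulLeft_apply] at hx
    rw [LinearMap.mulLeft_apply] at hxy
    set e := a ^ (n + 1) * y with he
    -- kernel and range are right ideals, so that the component `e` of `1` is idempotent
    have hxe : x * e = 0 := by
      refine Submodule.disjoint_def.1 hc.disjoint _ ?_ ⟨y - y * e, ?_⟩
      · rw [LinearMap.mem_ker, LinearMap.mulLeft_apply, ← mul_assoc, hx, zero_mul]
      · rw [LinearMap.mulLeft_apply, mul_sub, ← mul_assoc, ← he, eq_sub_of_add_eq hxy, sub_mul,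
          one_mul]
    have hee : e * e = e := by
      rw [eq_sub_of_add_eq hxy, sub_mul, one_mul, sub_eq_zero] at hxe
      exact hxe.symm
    rcases h e hee with h0 | h1
    · right
      rw [h0, add_zero] at hxy
      exact ⟨n + 1, by rw [← mul_one (a ^ (n + 1)), ← hxy, hx]⟩
    · left
      have hay : a * (a ^ n * y) = 1 := by rw [← mul_assoc, ← pow_succ', ← h1]
      have hs : Function.Surjective (LinearMap.mulLeft k a) := fun z =>
        ⟨a ^ n * y * z, by rw [LinearMap.mulLeft_apply, ← mul_assoc, hay, one_mul]⟩
      have hya : a ^ n * y * a = 1 := by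
        refine LinearMap.injective_iff_surjective.2 hs ?_
        rw [LinearMap.mulLeft_apply, LinearMap.mulLeft_apply, ← mul_assoc, hay, one_mul, mul_one]
      exact ⟨⟨a, _, hay, hya⟩, rfl⟩
  refine IsLocalRing.of_isUnit_or_isUnit_one_sub_self fun a => ?_
  rcases key a with h | h
  · exact Or.inl h
  · exact Or.inr h.isUnit_one_sub

end LocalRings

section KrullSchmidt

variable {C : Type u} [Category.{v} C] [Preadditive C]

/-- `X` is the direct sum of a family `Y` indexed by any finite type, in terms of the inclusions
and projections. -/
def IsSumOf {ι : Type} [Fintype ι] (X : C) (Y : ι → C) : Prop :=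
  ∃ (inj : ∀ i, Y i ⟶ X) (pr : ∀ i, X ⟶ Y i), (∀ i, inj i ≫ pr i = 𝟙 _) ∧
    (∀ i j, i ≠ j → inj i ≫ pr j = 0) ∧ ∑ i, pr i ≫ inj i = 𝟙 X

theorem isDirectSumOf_iff {n : ℕ} {X : C} {Y : Fin n → C} : IsDirectSumOf X Y ↔ IsSumOf X Y := by
  constructor
  · rintro ⟨b, ⟨hb⟩, ⟨e⟩⟩
    refine ⟨fun i => b.ι i ≫ e.hom, fun i => e.inv ≫ b.π i, fun i => by simp,
      fun i j hij => by simp [bicone_ι_π_ne b hij], ?_⟩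
    have : ∑ i, (e.inv ≫ b.π i) ≫ b.ι i ≫ e.hom = e.inv ≫ (∑ i, b.π i ≫ b.ι i) ≫ e.hom := by
      simp only [Preadditive.sum_comp, Preadditive.comp_sum, Category.assoc]
    rw [this, IsBilimit.total hb]
    simp
  · rintro ⟨inj, pr, h1, h2, h3⟩
    refine ⟨
      { pt := X
        ι := inj
        π := pr
        ι_π := fun i j => ?_ }, ⟨isBilimitOfTotal _ h3⟩, ⟨Iso.refl _⟩⟩
    split_ifs with h
    · subst h; simp [h1]
    · exact h2 i j h

theorem IsSumOf.of_iso {ι : Type} [Fintype ι] {X X' : C} {Y : ι → C} (h : IsSumOf X Y)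
    (e : X ≅ X') : IsSumOf X' Y := by
  obtain ⟨inj, pr, h1, h2, h3⟩ := h
  refine ⟨fun i => inj i ≫ e.hom, fun i => e.inv ≫ pr i, fun i => by simp [h1],
    fun i j hij => by simp [h2 i j hij], ?_⟩
  have : ∑ i, (e.inv ≫ pr i) ≫ inj i ≫ e.hom = e.inv ≫ (∑ i, pr i ≫ inj i) ≫ e.hom := by
    simp only [Preadditive.sum_comp, Preadditive.comp_sum, Category.assoc]
  rw [this, h3]
  simp

theorem IsSumOf.reindex {ι κ : Type} [Fintype ι] [Fintype κ] {X : C} {Y : ι → C}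
    (h : IsSumOf X Y) (e : κ ≃ ι) : IsSumOf X fun j => Y (e j) := by
  obtain ⟨inj, pr, h1, h2, h3⟩ := h
  exact ⟨fun j => inj (e j), fun j => pr (e j), fun j => h1 _, fun i j hij => h2 _ _ (by simpa),
    (e.sum_comp fun i => pr i ≫ inj i).trans h3⟩

theorem IsSumOf.sum {ι κ : Type} [Fintype ι] [Fintype κ] {X X' : C} {Y : ι → C} {Z : κ → C}
    (h : IsSumOf X Y) (h' : IsSumOf X' Z) {b : BinaryBicone X X'} (hb : b.IsBilimit) :
    IsSumOf b.pt (Sum.elim Y Z) := by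
  obtain ⟨inj, pr, h1, h2, h3⟩ := h
  obtain ⟨inj', pr', h1', h2', h3'⟩ := h'
  refine ⟨fun s => match s with
      | .inl i => inj i ≫ b.inl
      | .inr j => inj' j ≫ b.inr, fun s => match s with
      | .inl i => b.fst ≫ pr i
      | .inr j => b.snd ≫ pr' j, ?_, ?_, ?_⟩
  · rintro (i | j)
    · simpa using h1 i
    · simpa using h1' j
  · rintro (i | i) (j | j) hij
    · have := h2 i j fun h => hij (h ▸ rfl)
      simp [this]
      rfl
    · simp
      rfl
    · simp
      rfl
    · have := h2' i j fun h => hij (h ▸ rfl)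
      simp [this]
      rfl
  · rw [Fintype.sum_sum_type]
    have e1 : ∑ i, (b.fst ≫ pr i) ≫ inj i ≫ b.inl = b.fst ≫ (∑ i, pr i ≫ inj i) ≫ b.inl := by
      simp only [Preadditive.sum_comp, Preadditive.comp_sum, Category.assoc]
    have e2 : ∑ i, (b.snd ≫ pr' i) ≫ inj' i ≫ b.inr = b.snd ≫ (∑ i, pr' i ≫ inj' i) ≫ b.inr := by
      simp only [Preadditive.sum_comp, Preadditive.comp_sum, Category.assoc]
    refine (congrArg₂ (· + ·) e1 e2).trans ?_
    rw [h3, h3', Category.id_comp, Category.id_comp, IsBilimit.binary_total hb]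

/-- A summand `Y a` of a finite direct sum splits off, with a complement which is the sum of the
other summands. -/
theorem IsSumOf.exists_complement [HasFiniteBiproducts C] [HasBinaryBiproducts C] {ι : Type}
    [Fintype ι] [DecidableEq ι]
    {X : C} {Y : ι → C} {inj : ∀ i, Y i ⟶ X} {pr : ∀ i, X ⟶ Y i}
    (h1 : ∀ i, inj i ≫ pr i = 𝟙 _) (h2 : ∀ i j, i ≠ j → inj i ≫ pr j = 0)
    (h3 : ∑ i, pr i ≫ inj i = 𝟙 X) (a : ι) :
    ∃ (X' : C) (φ : X ≅ Y a ⊞ X'), IsSumOf X' (fun i : {i // i ≠ a} => Y i) ∧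
      biprod.inl ≫ φ.inv = inj a ∧ φ.hom ≫ biprod.fst = pr a := by
  let Y' := fun i : {i // i ≠ a} => Y i
  refine ⟨⨁ Y',
    { hom := biprod.lift (pr a) (biproduct.lift fun i => pr i)
      inv := biprod.desc (inj a) (biproduct.desc fun i => inj i)
      hom_inv_id := ?_
      inv_hom_id := ?_ }, ?_, by simp, by simp⟩
  · rw [biprod.lift_desc, biproduct.lift_desc, ← h3, Fintype.sum_eq_add_sum_subtype_ne _ a]
  · refine biprod.hom_ext' _ _ (biprod.hom_ext _ _ ?_ ?_) (biprod.hom_ext _ _ ?_ ?_)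
    · simp [h1]
    · refine biproduct.hom_ext _ _ fun i => ?_
      simp [h2 _ _ i.2.symm]
    · refine biproduct.hom_ext' _ _ fun i => ?_
      simp [h2 _ _ i.2]
    · refine biproduct.hom_ext' _ _ fun i => biproduct.hom_ext _ _ fun j => ?_
      by_cases hij : i = j
      · subst hij; simp [h1, Y']
      · simp [h2 i j (fun h => hij (Subtype.ext h)), biproduct.ι_π_ne _ hij]
  · exact ⟨biproduct.ι Y', biproduct.π Y', fun i => biproduct.ι_π_self Y' i,
      fun i j hij => biproduct.ι_π_ne Y' hij, biproduct.total⟩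

/-- Between objects with local endomorphism rings, a split monomorphism is an isomorphism. -/
theorem isIso_of_comp_eq_id_of_isLocalRing {X Y : C} [IsLocalRing (End X)] [IsLocalRing (End Y)]
    {g : X ⟶ Y} {s : Y ⟶ X} (hs : g ≫ s = 𝟙 X) : IsIso g := by
  refine ⟨s, hs, ?_⟩
  -- the idempotent `s ≫ g` of the local ring `End Y` is `1` or `0`
  let e : End Y := s ≫ g
  have he : e * e = e := by
    change (s ≫ g) ≫ s ≫ g = s ≫ g
    rw [Category.assoc, reassoc_of% hs]
  rcases IsLocalRing.isUnit_or_isUnit_of_add_one (add_sub_cancel e 1) with h | h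
  · exact h.mul_left_cancel (he.trans (mul_one e).symm)
  · have h0 : s ≫ g = 0 :=
      h.mul_left_cancel (b := e) (c := 0) (by rw [sub_mul, he, one_mul, sub_self, mul_zero])
    have : (1 : End X) = 0 := by
      change 𝟙 X = 0
      have h1 : (g ≫ s) ≫ g ≫ s = 𝟙 X := by rw [hs, Category.id_comp]
      rw [← h1, Category.assoc, reassoc_of% h0, zero_comp, comp_zero]
    exact absurd this one_ne_zero

/-- Decompositions into objects with local endomorphism rings are unique. For a summand `Y a`, the
identity of `Y a` is the sum of its factorizations through the summands `Z b`, so that one of these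
is invertible and `Y a ≅ Z b`; these two summands can be cancelled. -/
theorem IsSumOf.unique [HasFiniteBiproducts C] (n : ℕ) : ∀ {ι κ : Type} [Fintype ι] [Fintype κ]
    {X X' : C} {Y : ι → C} {Z : κ → C}, Fintype.card ι = n →
    (∀ i, IsLocalRing (End (Y i))) → (∀ j, IsLocalRing (End (Z j))) → IsSumOf X Y →
    IsSumOf X' Z → Nonempty (X ≅ X') → ∃ σ : ι ≃ κ, ∀ i, Nonempty (Y i ≅ Z (σ i)) := by
  classical
  have : HasBinaryBiproducts C := hasBinaryBiproducts_of_finite_biproducts C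
  induction n with
  | zero =>
    intro ι κ _ _ X X' Y Z hn hY hZ hXY hXZ ⟨e⟩
    have hι : IsEmpty ι := Fintype.card_eq_zero_iff.1 hn
    have hXY' := hXY.of_iso e
    obtain ⟨inj, pr, -, -, h3⟩ := hXY'
    obtain ⟨inj', pr', h1', -, -⟩ := hXZ
    have hκ : IsEmpty κ := ⟨fun j => by
      have := hZ j
      refine one_ne_zero (α := End (Z j)) ?_
      change 𝟙 (Z j) = 0
      rw [← h1', ← Category.comp_id (inj' j), ← h3]
      simp⟩
    exact ⟨Equiv.equivOfIsEmpty _ _, fun i => (hι.false i).elim⟩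
  | succ n ih =>
    intro ι κ _ _ X X' Y Z hn hY hZ hXY hXZ ⟨e⟩
    obtain ⟨inj, pr, h1, h2, h3⟩ := hXY.of_iso e
    obtain ⟨inj', pr', h1', h2', h3'⟩ := hXZ
    obtain ⟨a⟩ : Nonempty ι := Fintype.card_pos_iff.1 (by omega)
    have := hY a
    obtain ⟨b, -, hb⟩ : ∃ b ∈ Finset.univ,
        IsUnit (show End (Y a) from (inj a ≫ pr' b) ≫ inj' b ≫ pr a) := by
      refine exists_isUnit_of_isUnit_sum _ _ ?_
      have : ∑ b, (inj a ≫ pr' b) ≫ inj' b ≫ pr a = 𝟙 (Y a) := by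
        have : ∑ b, (inj a ≫ pr' b) ≫ inj' b ≫ pr a = inj a ≫ (∑ b, pr' b ≫ inj' b) ≫ pr a := by
          simp only [Preadditive.sum_comp, Preadditive.comp_sum, Category.assoc]
        rw [this, h3', Category.id_comp, h1]
      exact this ▸ isUnit_one
    obtain ⟨s, hs⟩ : ∃ s : Z b ⟶ Y a, (inj a ≫ pr' b) ≫ s = 𝟙 _ := by
      obtain ⟨u, hu⟩ := hb
      refine ⟨(inj' b ≫ pr a) ≫ (show Y a ⟶ Y a from (↑u⁻¹ : End (Y a))), ?_⟩
      rw [← Category.assoc]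
      have := u.inv_mul
      rw [hu] at this
      exact this
    have hiso : IsIso (inj a ≫ pr' b) :=
      have := hZ b
      isIso_of_comp_eq_id_of_isLocalRing hs
    obtain ⟨X₁, φ, hX₁, hφ, -⟩ := IsSumOf.exists_complement h1 h2 h3 a
    obtain ⟨X₂, ψ, hX₂, -, hψ⟩ := IsSumOf.exists_complement h1' h2' h3' b
    have : IsIso (biprod.inl ≫ (φ.symm ≪≫ ψ).hom ≫ biprod.fst) := by
      rw [Iso.trans_hom, Category.assoc, hψ, Iso.symm_hom, ← Category.assoc, hφ]
      exact hiso
    obtain ⟨σ, hσ⟩ := ih (ι := {i // i ≠ a}) (κ := {j // j ≠ b}) ((Set.card_ne_eq a).trans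
      (by rw [hn, Nat.add_sub_cancel])) (fun i => hY i) (fun j => hZ j) hX₁ hX₂
      ⟨Biprod.isoElim (φ.symm ≪≫ ψ)⟩
    refine ⟨(Equiv.optionSubtypeNe a).symm.trans
      ((Equiv.optionCongr σ).trans (Equiv.optionSubtypeNe b)), fun i => ?_⟩
    by_cases hi : i = a
    · subst hi
      simpa using ⟨asIso (inj i ≫ pr' b)⟩
    · simpa [Equiv.optionSubtypeNe_symm_of_ne hi] using hσ ⟨i, hi⟩

variable (k : Type w) [Field k] [Linear k C]

/-- A nontrivial idempotent of `End X` would decompose `X`. -/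
theorem isLocalRing_end_of_isIndecomposableObj [IsIdempotentComplete C] {X : C}
    [Module.Finite k (X ⟶ X)] (hX : IsIndecomposableObj X) : IsLocalRing (End X) := by
  have hne : Nontrivial (End X) := ⟨⟨𝟙 X, 0, fun h => hX.1 ((IsZero.iff_id_eq_zero X).2 h)⟩⟩
  have : Module.Finite k (End X) := inferInstanceAs (Module.Finite k (X ⟶ X))
  suffices h : ∀ e : X ⟶ X, e ≫ e = e → e = 0 ∨ e = 𝟙 X from
    isLocalRing_of_idempotents (k := k) h
  intro e he
  obtain ⟨Y, i, p, hip, hpi⟩ := IsIdempotentComplete.idempotents_split X e he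
  obtain ⟨Y', i', p', hip', hpi'⟩ := IsIdempotentComplete.idempotents_split X (𝟙 X - e)
    (by simp [Preadditive.sub_comp, Preadditive.comp_sub, he])
  have h1 : i ≫ p' = 0 := by
    have : (i ≫ p ≫ i) ≫ (p' ≫ i') ≫ p' = 0 := by
      rw [hpi, hpi', Preadditive.sub_comp, Preadditive.comp_sub, Category.id_comp, Category.assoc,
        Category.assoc, reassoc_of% he, sub_self]
    simpa [reassoc_of% hip, hip'] using this
  have h2 : i' ≫ p = 0 := by
    have : (i' ≫ p' ≫ i') ≫ (p ≫ i) ≫ p = 0 := by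
      rw [hpi, hpi', Preadditive.comp_sub, Preadditive.sub_comp, Category.comp_id, Category.assoc,
        reassoc_of% he, sub_self]
    simpa [reassoc_of% hip', hip] using this
  let b : BinaryBicone Y Y' :=
    { pt := X, fst := p, snd := p', inl := i, inr := i'
      inl_fst := hip, inl_snd := h1, inr_fst := h2, inr_snd := hip' }
  have hb : b.IsBilimit := isBinaryBilimitOfTotal b (by
    change p ≫ i + p' ≫ i' = 𝟙 X
    rw [hpi, hpi', add_sub_cancel])
  rcases hX.2 Y Y' b ⟨hb⟩ ⟨Iso.refl _⟩ with h | h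
  · exact Or.inl (by rw [← hpi, h.eq_of_tgt p 0, zero_comp])
  · refine Or.inr (sub_eq_zero.1 ?_).symm
    rw [← hpi', h.eq_of_tgt p' 0, zero_comp]

theorem finrank_end_add_finrank_end_le (hfin : ∀ X Y : C, Module.Finite k (X ⟶ Y)) {Y Z : C}
    (b : BinaryBicone Y Z) :
    Module.finrank k (Y ⟶ Y) + Module.finrank k (Z ⟶ Z) ≤ Module.finrank k (b.pt ⟶ b.pt) := by
  let φ : (Y ⟶ Y) × (Z ⟶ Z) →ₗ[k] (b.pt ⟶ b.pt) :=
    { toFun := fun f => b.fst ≫ f.1 ≫ b.inl + b.snd ≫ f.2 ≫ b.inr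
      map_add' := fun f g => by
        simp only [Prod.fst_add, Prod.snd_add, Preadditive.add_comp, Preadditive.comp_add]
        abel
      map_smul' := fun c f => by simp }
  have hφ : Function.Injective φ := by
    refine (injective_iff_map_eq_zero φ).2 fun f hf => ?_
    have hf : b.fst ≫ f.1 ≫ b.inl + b.snd ≫ f.2 ≫ b.inr = 0 := hf
    have h1 : b.inl ≫ (b.fst ≫ f.1 ≫ b.inl + b.snd ≫ f.2 ≫ b.inr) ≫ b.fst = 0 := by simp [hf]
    have h2 : b.inr ≫ (b.fst ≫ f.1 ≫ b.inl + b.snd ≫ f.2 ≫ b.inr) ≫ b.snd = 0 := by simp [hf]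
    exact Prod.ext (by simpa using h1) (by simpa using h2)
  rw [← Module.finrank_prod]
  exact LinearMap.finrank_le_finrank_of_injective hφ

/-- A decomposition exists by induction on the dimension of `X ⟶ X`, which drops for the
summands. -/
theorem exists_isSumOf_isIndecomposableObj (hfin : ∀ X Y : C, Module.Finite k (X ⟶ Y)) (n : ℕ) :
    ∀ X : C, Module.finrank k (X ⟶ X) ≤ n → ∃ (ι : Type) (_ : Fintype ι) (Y : ι → C),
      (∀ i, IsIndecomposableObj (Y i)) ∧ IsSumOf X Y := by
  induction n with
  | zero =>
    intro X hX
    have := Module.finrank_zero_iff.1 (Nat.le_zero.1 hX)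
    refine ⟨Empty, inferInstance, Empty.elim, fun i => i.elim, fun i => i.elim, fun i => i.elim,
      fun i => i.elim, fun i => i.elim, Subsingleton.elim _ _⟩
  | succ n ih =>
    intro X hX
    by_cases hX0 : IsZero X
    · refine ih X ?_
      have : Subsingleton (X ⟶ X) := ⟨hX0.eq_of_src⟩
      rw [Module.finrank_zero_of_subsingleton]
      exact Nat.zero_le n
    by_cases hi : IsIndecomposableObj X
    · exact ⟨Unit, inferInstance, fun _ => X, fun _ => hi, fun _ => 𝟙 X, fun _ => 𝟙 X,
        fun _ => by simp, fun i j h => (h rfl).elim, by simp⟩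
    simp only [IsIndecomposableObj, hX0, not_false_eq_true, true_and, not_forall, not_or] at hi
    obtain ⟨Y, Z, b, ⟨hb⟩, ⟨e⟩, hY, hZ⟩ := hi
    have hpos : ∀ {W : C}, ¬ IsZero W → 0 < Module.finrank k (W ⟶ W) := fun {W} hW => by
      have : Nontrivial (W ⟶ W) := ⟨⟨𝟙 W, 0, fun h => hW ((IsZero.iff_id_eq_zero W).2 h)⟩⟩
      exact Module.finrank_pos
    have hle := finrank_end_add_finrank_end_le k hfin b
    rw [(Linear.homCongr k e e).finrank_eq] at hle
    have h1 := hpos hY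
    have h2 := hpos hZ
    obtain ⟨ι, _, Y', hY', hYs⟩ := ih Y (by omega)
    obtain ⟨κ, _, Z', hZ', hZs⟩ := ih Z (by omega)
    exact ⟨ι ⊕ κ, inferInstance, Sum.elim Y' Z', by rintro (i | i) <;> simp [hY', hZ'],
      (hYs.sum hZs hb).of_iso e⟩

/-- A Hom-finite linear category with finite biproducts and split idempotents is Krull-Schmidt. -/
theorem isKrullSchmidt_of_finite [HasFiniteBiproducts C] [IsIdempotentComplete C]
    (hfin : ∀ X Y : C, Module.Finite k (X ⟶ Y)) : IsKrullSchmidt C where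
  hasFiniteBiproducts := inferInstance
  isLocalRing_end X hX := isLocalRing_end_of_isIndecomposableObj k hX
  exists_decomposition X := by
    obtain ⟨ι, _, Y, hY, hX⟩ := exists_isSumOf_isIndecomposableObj k hfin _ X le_rfl
    exact ⟨Fintype.card ι, fun i => Y ((Fintype.equivFin ι).symm i), fun i => hY _,
      isDirectSumOf_iff.2 (hX.reindex _)⟩
  unique_decomposition X n m Y Z hY hXY hZ hXZ :=
    IsSumOf.unique _ rfl (fun i => isLocalRing_end_of_isIndecomposableObj k (hY i))
      (fun j => isLocalRing_end_of_isIndecomposableObj k (hZ j)) (isDirectSumOf_iff.1 hXY)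
      (isDirectSumOf_iff.1 hXZ) ⟨Iso.refl X⟩

end KrullSchmidt

namespace DGModule

variable {k : Type u} [Field k] {R : DGAlgebra.{v} k}

/-! ### Finite biproducts in `Dᶠ(R)` and `Dᶜ(R)` -/

theorem isFinite_zeroModule : isFinite R ((ofModule R).obj (zeroModule.{w} R)) := by
  have : Subsingleton (zeroModule.{w} R).carrier := inferInstanceAs (Subsingleton PUnit)
  have : Module.Finite k (zeroModule.{w} R).carrier := inferInstance
  exact ⟨zeroModule R, finite_cohomology_of_finite _, ⟨Iso.refl _⟩⟩

theorem hasFiniteBiproducts_df : HasFiniteBiproducts (Df R) :=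
  hasFiniteBiproducts_fullSubcategory _
    (fun X Y hX hY => by
      obtain ⟨b, hb, h⟩ := exists_bicone X Y
      exact ⟨b, hb, h hX hY⟩)
    ⟨_, isZero_zeroModule, isFinite_zeroModule⟩

theorem hasFiniteBiproducts_dc : HasFiniteBiproducts (Dc R) :=
  hasFiniteBiproducts_fullSubcategory _
    (fun X Y hX hY => by
      obtain ⟨b, ⟨hb⟩, -⟩ := exists_bicone X Y
      exact ⟨b, ⟨hb⟩, FinitelyBuilt.coprod b.inl b.inr ⟨hb.isColimit⟩ hX hY⟩)
    ⟨_, isZero_zeroModule, FinitelyBuilt.summand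
      ⟨0, 0, isZero_zeroModule.eq_of_src _ _⟩ FinitelyBuilt.base⟩

end DGModule

theorem proposition2p3 {k : Type u} [Field k] (R : DGAlgebra.{v} k)
    (hR_neg : ∀ i : ℤ, i < 0 → R.grading i = ⊥)
    (hR_inj : Function.Injective (algebraMap k R.carrier))
    (hR_zero : ∀ a : R.carrier, a ∈ R.grading 0 ↔ ∃ c : k, algebraMap k R.carrier c = a)
    (hR_one : R.grading 1 = ⊥)
    (hR_fin : Module.Finite k R.carrier) :
    ((∀ X Y : DGModule.Df R, Module.Finite k (X ⟶ Y)) ∧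
      IsIdempotentComplete (DGModule.Df R) ∧ IsKrullSchmidt (DGModule.Df R)) ∧
    ((∀ X Y : DGModule.Dc R, Module.Finite k (X ⟶ Y)) ∧
      IsIdempotentComplete (DGModule.Dc R) ∧ IsKrullSchmidt (DGModule.Dc R)) := by
  have hzero : ∀ a : R.carrier, a ∈ R.grading 0 → ∃ c : k, algebraMap k R.carrier c = a :=
    fun a => (hR_zero a).1
  have hf := fun X Y => DGModule.finite_hom_fullSubcategory hR_neg hzero hR_one hR_fin
    (P := DGModule.isFinite R) (fun _ h => h) X Y
  have hc := fun X Y => DGModule.finite_hom_fullSubcategory hR_neg hzero hR_one hR_fin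
    (P := DGModule.isCompact R) (fun _ => DGModule.isFinite_of_isCompact hR_fin) X Y
  have hfi : IsIdempotentComplete (DGModule.Df R) :=
    DGModule.isIdempotentComplete_fullSubcategory hR_neg hzero hR_one hR_fin (fun _ h => h)
      fun _ _ => DGModule.isFinite_of_retract
  have hci : IsIdempotentComplete (DGModule.Dc R) :=
    DGModule.isIdempotentComplete_fullSubcategory hR_neg hzero hR_one hR_fin
      (fun _ => DGModule.isFinite_of_isCompact hR_fin)
      fun _ _ => DGModule.FinitelyBuilt.summand
  have := DGModule.hasFiniteBiproducts_df (R := R)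
  have := DGModule.hasFiniteBiproducts_dc (R := R)
  exact ⟨⟨hf, hfi, isKrullSchmidt_of_finite k hf⟩, hc, hci, isKrullSchmidt_of_finite k hc⟩
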